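/- **Theorem ($C\ell(q)$-modules and MCM modules).** Let $k$ be a field, $V\neq 0$ a finite-dimensional $k$-vector space and $q$ a non-singular quadratic form on $V$, with polar form $b_q(v,w)=q(v+w)-q(v)-q(w)$; non-singular means that $v=0$ is the only vector with $q(v)=0$ and $b_q(v,\cdot)=0$ (if $\operatorname{char}k\neq 2$: $b_q$ is non-degenerate). Let $R=k[V^\vee]/(q)$ be the homogeneous coordinate ring of the quadric hypersurface $q=0$, graded with $V^\vee$ in degree $1$, and let $\mathfrak m$ be the ideal generated by $V^\vee$, so $k=R/\mathfrak m$. Let $C\ell(q)=C\ell_0(q)\oplus C\ell_1(q)$ be the Clifford algebra, with $v^2=q(v)$, and let $C\ell_0(q)\text{-mod}$ be the category of finitely generated left $C\ell_0(q)$-modules. Let $\mathrm{MCM}^{\mathrm{lin}}_{\mathrm{gr}}(R)$ be the category whose objects are the $\mathbb Z$-graded finitely generated $R$-modules $M$ that are maximal Cohen–Macaulay ($M=0$ or $\operatorname{depth}_{\mathfrak m}M=\dim R$), have no free direct summand, and admit a graded free presentation $R(-1)^m\to R^m\to M\to 0$ with maps of degree $0$ (so that the first map is a matrix of linear forms); morphisms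 are the $R$-linear maps of degree $0$. Every such $M$ has a minimal graded free cover, and any such cover has the form $\pi:R^r\to M$; write $\mathrm{Syz}_1(M)=\ker\pi$ for its kernel, with the grading shifted by one: $\mathrm{Syz}_1(M)_d=\ker\pi\cap R_{d+1}^r$. Then the spaces $\mathcal T(M)=k\otimes_R M$, for $M$ in $\mathrm{MCM}^{\mathrm{lin}}_{\mathrm{gr}}(R)$, carry $k$-linear actions of $C\ell_0(q)$, natural in $M$, for which the following hold. 1. The functor $\mathcal T:\mathrm{MCM}^{\mathrm{lin}}_{\mathrm{gr}}(R)\to C\ell_0(q)\text{-mod}$, $M\mapsto k\otimes_R M$, $f\mapsto k\otimes_R f$, is an equivalence of categories. 2. For every $M$ and every choice of $\pi$, the module $\mathrm{Syz}_1(M)$ again lies in $\mathrm{MCM}^{\mathrm{lin}}_{\mathrm{gr}}(R)$, and the vector space $\mathcal T(M)\oplus\mathcal T(\mathrm{Syz}_1(M))$ is a $\mathbb Z/2$-graded $C\ell(q)$-module, with even part $\mathcal T(M)$ and odd part $\mathcal T(\mathrm{Syz}_1(M))$, on which $C\ell_0(q)$ acts by the given actions on the two summands. In it, $v\in V$ maps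 $\mathcal T(\mathrm{Syz}_1(M))$ to $\mathcal T(M)$ by evaluating the linear presentation at $v$: if $s\in\mathrm{Syz}_1(M)_0$ equals $(\ell_1,\dots,\ell_r)\in R_1^r$ with $\ell_j\in V^\vee$, then $v\cdot[s]=\sum_j \ell_j(v)\,[\pi(\varepsilon_j)]$, where $\varepsilon_1,\dots,\varepsilon_r$ is the standard basis of $R^r$ and $[x]=1\otimes x$. 3. Clifford multiplication $x\otimes y\mapsto x\cdot y$ is an isomorphism of $C\ell_0(q)$-modules $$C\ell_1(q)\otimes_{C\ell_0(q)}\mathcal T(M)\;\cong\;\mathcal T(\mathrm{Syz}_1(M)).$$ -/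

import Mathlib

open CategoryTheory TensorProduct

universe u v

namespace QuadricMCM

noncomputable section

section Ring

variable {k : Type u} [Field k] {V : Type v} [AddCommGroup V] [Module k V] {n : ℕ}

/-- The quadratic form `Q` written as a homogeneous polynomial of degree two in the coordinates
`X i` dual to the basis `b`. -/
def quadricPoly (Q : QuadraticForm k V) (b : Module.Basis (Fin n) k V) :
    MvPolynomial (Fin n) k :=
  ∑ i, MvPolynomial.C (Q (b i)) * MvPolynomial.X i ^ 2 +
    ∑ i, ∑ j ∈ Finset.Ioi i,
      MvPolynomial.C (QuadraticMap.polar Q (b i) (b j)) * MvPolynomial.X i * MvPolynomial.X j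

theorem eval_quadricPoly (Q : QuadraticForm k V) (b : Module.Basis (Fin n) k V) (c : Fin n → k) :
    MvPolynomial.eval c (quadricPoly Q b) = Q (∑ i, c i • b i) := by
  have key : ∀ (m : ℕ) (w : Fin m → V), Q (∑ i, w i) = ∑ i, Q (w i) +
      ∑ i, ∑ j ∈ Finset.Ioi i, QuadraticMap.polar Q (w i) (w j) := by
    intro m
    induction m with
    | zero => intro w; simp
    | succ m ih =>
      intro w
      rw [Fin.sum_univ_succ, QuadraticMap.map_add Q, ih, Fin.sum_univ_succ,
        Fin.sum_univ_succ
          (f := fun i => ∑ j ∈ Finset.Ioi i, QuadraticMap.polar Q (w i) (w j))]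
      have h0 : QuadraticMap.polar Q (w 0) (∑ i : Fin m, w i.succ) =
          ∑ i : Fin m, QuadraticMap.polar Q (w 0) (w i.succ) := by
        exact map_sum (QuadraticMap.polarBilin Q (w 0)) _ _
      rw [h0, Fin.Ioi_zero_eq_map, Finset.sum_map]
      simp only [Fin.Ioi_succ, Finset.sum_map]
      simp only [Fin.coe_succEmb]
      abel
  rw [key, quadricPoly]
  simp only [map_add, map_sum, map_mul, map_pow, MvPolynomial.eval_C, MvPolynomial.eval_X,
    QuadraticMap.map_smul, QuadraticMap.polar_smul_left, QuadraticMap.polar_smul_right,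
    smul_eq_mul]
  congr 1
  · exact Finset.sum_congr rfl fun i _ => by ring
  · exact Finset.sum_congr rfl fun i _ => Finset.sum_congr rfl fun j _ => by ring

/-- The homogeneous coordinate ring `k[V^∨] / (Q)` of the quadric hypersurface `Q = 0`. -/
def QuadricRing (Q : QuadraticForm k V) (b : Module.Basis (Fin n) k V) : Type u :=
  MvPolynomial (Fin n) k ⧸ Ideal.span {quadricPoly Q b}

instance (Q : QuadraticForm k V) (b : Module.Basis (Fin n) k V) : CommRing (QuadricRing Q b) :=
  inferInstanceAs (CommRing (MvPolynomial (Fin n) k ⧸ Ideal.span {quadricPoly Q b}))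

instance (Q : QuadraticForm k V) (b : Module.Basis (Fin n) k V) : Algebra k (QuadricRing Q b) :=
  inferInstanceAs (Algebra k (MvPolynomial (Fin n) k ⧸ Ideal.span {quadricPoly Q b}))

/-- The quotient map from the polynomial ring to the coordinate ring. -/
def toQuadricRing (Q : QuadraticForm k V) (b : Module.Basis (Fin n) k V) :
    MvPolynomial (Fin n) k →ₐ[k] QuadricRing Q b :=
  Ideal.Quotient.mkₐ k (Ideal.span {quadricPoly Q b})

/-- The graded components of the coordinate ring, indexed by the integers. -/
def ringGr (Q : QuadraticForm k V) (b : Module.Basis (Fin n) k V) :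
    ℤ → Submodule k (QuadricRing Q b)
  | .ofNat d => (MvPolynomial.homogeneousSubmodule (Fin n) k d).map
      (toQuadricRing Q b).toLinearMap
  | .negSucc _ => ⊥

/-- The maximal ideal of the coordinate ring generated by `V^∨`. -/
def irrelevant (Q : QuadraticForm k V) (b : Module.Basis (Fin n) k V) :
    Ideal (QuadricRing Q b) :=
  Ideal.span (Set.range fun i => toQuadricRing Q b (MvPolynomial.X i))

/-- The residue field `k = R / 𝔪`, as an `R`-module. -/
def ResField (Q : QuadraticForm k V) (b : Module.Basis (Fin n) k V) : Type u :=
  QuadricRing Q b ⧸ irrelevant Q b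

instance (Q : QuadraticForm k V) (b : Module.Basis (Fin n) k V) : CommRing (ResField Q b) :=
  inferInstanceAs (CommRing (QuadricRing Q b ⧸ irrelevant Q b))

instance (Q : QuadraticForm k V) (b : Module.Basis (Fin n) k V) :
    Algebra (QuadricRing Q b) (ResField Q b) :=
  inferInstanceAs (Algebra (QuadricRing Q b) (QuadricRing Q b ⧸ irrelevant Q b))

instance (Q : QuadraticForm k V) (b : Module.Basis (Fin n) k V) : Algebra k (ResField Q b) :=
  inferInstanceAs (Algebra k (QuadricRing Q b ⧸ irrelevant Q b))

instance (Q : QuadraticForm k V) (b : Module.Basis (Fin n) k V) :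
    IsScalarTower k (QuadricRing Q b) (ResField Q b) :=
  inferInstanceAs (IsScalarTower k (QuadricRing Q b) (QuadricRing Q b ⧸ irrelevant Q b))

end Ring

section Depth

/-- The depth of `M` with respect to an ideal `I`: the supremum of the lengths of the `M`-regular
sequences in `I`. -/
def depth {R : Type*} [CommRing R] (I : Ideal R) (M : Type*) [AddCommGroup M] [Module R M] : ℕ∞ :=
  ⨆ (rs : List R) (_ : (∀ r ∈ rs, r ∈ I) ∧ RingTheory.Sequence.IsRegular M rs), (rs.length : ℕ∞)

end Depth

section GradedModules

variable {k : Type u} [Field k] {V : Type v} [AddCommGroup V] [Module k V] {n : ℕ}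

/-- A `ℤ`-graded module over the coordinate ring of the quadric. -/
structure GrMod (Q : QuadraticForm k V) (b : Module.Basis (Fin n) k V) where
  carrier : Type u
  [addCommGroup : AddCommGroup carrier]
  [module : Module (QuadricRing Q b) carrier]
  gr : ℤ → AddSubgroup carrier
  isInternal : DirectSum.IsInternal gr
  smul_mem : ∀ (i j : ℤ) (r : QuadricRing Q b) (m : carrier),
    r ∈ ringGr Q b i → m ∈ gr j → r • m ∈ gr (i + j)

attribute [instance] GrMod.addCommGroup GrMod.module

/-- Homomorphisms of graded modules: linear maps of degree zero. -/
@[ext]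
structure GrMod.Hom {Q : QuadraticForm k V} {b : Module.Basis (Fin n) k V}
    (M N : GrMod Q b) where
  toLin : M.carrier →ₗ[QuadricRing Q b] N.carrier
  map_mem : ∀ (d : ℤ) (m : M.carrier), m ∈ M.gr d → toLin m ∈ N.gr d

instance (Q : QuadraticForm k V) (b : Module.Basis (Fin n) k V) : Category (GrMod Q b) where
  Hom M N := GrMod.Hom M N
  id _ := ⟨LinearMap.id, fun _ _ h => h⟩
  comp f g := ⟨g.toLin ∘ₗ f.toLin, fun d m h => g.map_mem d _ (f.map_mem d m h)⟩

variable {Q : QuadraticForm k V} {b : Module.Basis (Fin n) k V}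

/-- Maximal Cohen-Macaulay modules: finitely generated modules which are zero or whose depth is
the Krull dimension of the coordinate ring. -/
def IsMCM (M : GrMod Q b) : Prop :=
  Module.Finite (QuadricRing Q b) M.carrier ∧
    (Subsingleton M.carrier ∨
      ((depth (irrelevant Q b) M.carrier : ℕ∞) : WithBot ℕ∞) = ringKrullDim (QuadricRing Q b))

/-- `M` has no direct summand isomorphic to the free module of rank one. -/
def NoFreeSummand (M : GrMod Q b) : Prop :=
  ¬ ∃ (i : QuadricRing Q b →ₗ[QuadricRing Q b] M.carrier)
      (p : M.carrier →ₗ[QuadricRing Q b] QuadricRing Q b), p ∘ₗ i = LinearMap.id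

/-- `M` has a graded free presentation `R(-1)^m → R^m → M → 0`; the first map is then given by a
matrix of linear forms. -/
def HasLinearPresentation (M : GrMod Q b) : Prop :=
  ∃ (m : ℕ) (φ : (Fin m → QuadricRing Q b) →ₗ[QuadricRing Q b] (Fin m → QuadricRing Q b))
    (π : (Fin m → QuadricRing Q b) →ₗ[QuadricRing Q b] M.carrier),
    (∀ (d : ℤ) (f : Fin m → QuadricRing Q b), (∀ j, f j ∈ ringGr Q b d) →
      ∀ j, φ f j ∈ ringGr Q b (d + 1)) ∧
    (∀ (d : ℤ) (f : Fin m → QuadricRing Q b), (∀ j, f j ∈ ringGr Q b d) → π f ∈ M.gr d) ∧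
    Function.Exact φ π ∧ Function.Surjective π

variable (Q b) in
/-- Graded maximal Cohen-Macaulay modules without free summands which admit a linear graded free
presentation. -/
def isLinearMCM : ObjectProperty (GrMod Q b) :=
  fun M => IsMCM M ∧ NoFreeSummand M ∧ HasLinearPresentation M

variable (Q b) in
/-- The category of linear graded maximal Cohen-Macaulay modules, with the degree-preserving
homomorphisms. -/
abbrev LinMCM := (isLinearMCM Q b).FullSubcategory

/-- `N` is the first syzygy module of `M`, where `M` is generated in degree zero: there is a minimal
graded free cover `π : R^r → M` with kernel `N`. The grading of `N` is shifted by one, so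
that the minimal generators of a linear syzygy have degree zero, that is, `N = Syz₁(M)(1)`. -/
structure FirstSyzygy (M N : GrMod Q b) where
  rank : ℕ
  π : (Fin rank → QuadricRing Q b) →ₗ[QuadricRing Q b] M.carrier
  ι : N.carrier →ₗ[QuadricRing Q b] (Fin rank → QuadricRing Q b)
  π_surjective : Function.Surjective π
  ι_injective : Function.Injective ι
  exact : Function.Exact ι π
  minimal : ∀ s j, ι s j ∈ irrelevant Q b
  π_mem : ∀ (d : ℤ) (f : Fin rank → QuadricRing Q b), (∀ j, f j ∈ ringGr Q b d) → π f ∈ M.gr d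
  mem_gr_iff : ∀ (d : ℤ) (s : N.carrier), s ∈ N.gr d ↔ ∀ j, ι s j ∈ ringGr Q b (d + 1)

/-- The vector space `k ⊗_R M`. -/
def Fiber (M : GrMod Q b) : Type u := ResField Q b ⊗[QuadricRing Q b] M.carrier

instance (M : GrMod Q b) : AddCommGroup (Fiber M) :=
  inferInstanceAs (AddCommGroup (ResField Q b ⊗[QuadricRing Q b] M.carrier))

instance (M : GrMod Q b) : Module k (Fiber M) :=
  inferInstanceAs (Module k (ResField Q b ⊗[QuadricRing Q b] M.carrier))

/-- The class `1 ⊗ x` in `k ⊗_R M`. -/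
def Fiber.mk {M : GrMod Q b} (x : M.carrier) : Fiber M :=
  (1 : ResField Q b) ⊗ₜ[QuadricRing Q b] x

/-- The map `k ⊗_R f`. -/
def Fiber.map {M N : GrMod Q b} (f : M ⟶ N) : Fiber M →ₗ[k] Fiber N :=
  (TensorProduct.AlgebraTensorModule.map (R := QuadricRing Q b) (A := ResField Q b)
    (LinearMap.id : ResField Q b →ₗ[ResField Q b] ResField Q b)
    (GrMod.Hom.toLin f)).restrictScalars k

theorem Fiber.map_id (M : GrMod Q b) (x : Fiber M) : Fiber.map (𝟙 M) x = x :=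
  congrArg (fun g => g x) (TensorProduct.AlgebraTensorModule.map_id
    (R := QuadricRing Q b) (A := ResField Q b) (M := ResField Q b) (N := M.carrier))

theorem Fiber.map_comp {M N P : GrMod Q b} (f : M ⟶ N) (g : N ⟶ P) (x : Fiber M) :
    Fiber.map (f ≫ g) x = Fiber.map g (Fiber.map f x) :=
  congrArg (fun h => h x) (TensorProduct.AlgebraTensorModule.map_comp
    (R := QuadricRing Q b) (A := ResField Q b)
    (LinearMap.id : ResField Q b →ₗ[ResField Q b] ResField Q b)
    (LinearMap.id : ResField Q b →ₗ[ResField Q b] ResField Q b) (GrMod.Hom.toLin g) (GrMod.Hom.toLin f))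

end GradedModules

section Finiteness

variable {k : Type u} [Field k] {V : Type v} [AddCommGroup V] [Module k V] {n : ℕ}
  {Q : QuadraticForm k V} {b : Module.Basis (Fin n) k V}

theorem algebraMap_resField_surjective (Q : QuadraticForm k V) (b : Module.Basis (Fin n) k V) :
    Function.Surjective (algebraMap k (ResField Q b)) := by
  intro x
  obtain ⟨y, rfl⟩ := Ideal.Quotient.mk_surjective (I := irrelevant Q b) x
  obtain ⟨p, rfl⟩ := Ideal.Quotient.mk_surjective (I := Ideal.span {quadricPoly Q b}) y
  let F : MvPolynomial (Fin n) k →+* ResField Q b :=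
    (Ideal.Quotient.mk (irrelevant Q b)).comp (toQuadricRing Q b).toRingHom
  have hX : ∀ i, F (MvPolynomial.X i) = 0 := fun i =>
    Ideal.Quotient.eq_zero_iff_mem.2 (Ideal.subset_span ⟨i, rfl⟩)
  change ∃ a, algebraMap k (ResField Q b) a = F p
  induction p using MvPolynomial.induction_on with
  | C a => exact ⟨a, rfl⟩
  | add p q hp hq =>
    obtain ⟨c, hc⟩ := hp
    obtain ⟨d, hd⟩ := hq
    exact ⟨c + d, by rw [map_add, hc, hd, map_add]⟩
  | mul_X p i _ => exact ⟨0, by rw [map_zero, map_mul, hX, mul_zero]⟩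

theorem finite_fiber (M : GrMod Q b) [Module.Finite (QuadricRing Q b) M.carrier] :
    Module.Finite k (Fiber M) := by
  have : Module.Finite k (ResField Q b) :=
    Module.Finite.of_surjective (Algebra.linearMap k (ResField Q b))
      (algebraMap_resField_surjective Q b)
  exact Module.Finite.trans (R := k) (ResField Q b) (ResField Q b ⊗[QuadricRing Q b] M.carrier)

end Finiteness

section Clifford

variable {k : Type u} [Field k] {V : Type v} [AddCommGroup V] [Module k V] {n : ℕ}

/-- The left action of `Cl₀(Q)` on `Cl₁(Q)`. -/
instance oddLeftModule (Q : QuadraticForm k V) :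
    Module (CliffordAlgebra.even Q) (CliffordAlgebra.evenOdd Q 1) where
  smul a x := ⟨a.1 * x.1, by
    have := SetLike.mul_mem_graded (A := CliffordAlgebra.evenOdd Q) (i := 0) (j := 1) a.2 x.2
    simpa using this⟩
  one_smul x := Subtype.ext (one_mul x.1)
  mul_smul a c x := Subtype.ext (mul_assoc a.1 c.1 x.1)
  smul_zero a := Subtype.ext (mul_zero a.1)
  smul_add a x y := Subtype.ext (mul_add a.1 x.1 y.1)
  add_smul a c x := Subtype.ext (add_mul a.1 c.1 x.1)
  zero_smul x := Subtype.ext (zero_mul x.1)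

/-- Right multiplication of `Cl₀(Q)` on `Cl₁(Q)`. -/
def oddMulEven {Q : QuadraticForm k V} (x : CliffordAlgebra.evenOdd Q 1)
    (a : CliffordAlgebra.even Q) : CliffordAlgebra.evenOdd Q 1 :=
  ⟨x.1 * a.1, by
    have := SetLike.mul_mem_graded (A := CliffordAlgebra.evenOdd Q) (i := 1) (j := 0) x.2 a.2
    simpa using this⟩

/-- The left `Cl₀(Q)`-module `Cl₁(Q) ⊗_{Cl₀(Q)} N`, as the quotient of the tensor product of
abelian groups `Cl₁(Q) ⊗ N` by the relations `x a ⊗ y = x ⊗ a y` with `a ∈ Cl₀(Q)`. -/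
abbrev OddTensor (Q : QuadraticForm k V) (N : Type*) [AddCommGroup N]
    [Module (CliffordAlgebra.even Q) N] : Type _ :=
  (CliffordAlgebra.evenOdd Q 1 ⊗[ℤ] N) ⧸
    Submodule.span (CliffordAlgebra.even Q)
      {t : CliffordAlgebra.evenOdd Q 1 ⊗[ℤ] N |
        ∃ (x : CliffordAlgebra.evenOdd Q 1) (a : CliffordAlgebra.even Q) (y : N),
          t = oddMulEven x a ⊗ₜ[ℤ] y - x ⊗ₜ[ℤ] (a • y)}

/-- The class of `x ⊗ y` in `Cl₁(Q) ⊗_{Cl₀(Q)} N`. -/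
def OddTensor.tmul {Q : QuadraticForm k V} {N : Type*} [AddCommGroup N]
    [Module (CliffordAlgebra.even Q) N] (x : CliffordAlgebra.evenOdd Q 1) (y : N) :
    OddTensor Q N :=
  Submodule.Quotient.mk (x ⊗ₜ[ℤ] y)

/-- A `k`-linear action of `Cl₀(Q)` on the spaces `k ⊗_R M`, natural in the linear maximal
Cohen-Macaulay module `M`. -/
structure EvenAction (Q : QuadraticForm k V) (b : Module.Basis (Fin n) k V) where
  act : ∀ M : LinMCM Q b, CliffordAlgebra.even Q →ₐ[k] Module.End k (Fiber M.obj)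
  naturality : ∀ {M N : LinMCM Q b} (f : M ⟶ N) (a : CliffordAlgebra.even Q) (x : Fiber M.obj),
    Fiber.map f.hom (act M a x) = act N a (Fiber.map f.hom x)

variable {Q : QuadraticForm k V} {b : Module.Basis (Fin n) k V}

/-- The `Cl₀(Q)`-module `k ⊗_R M`. -/
def EvenAction.obj (A : EvenAction Q b) (M : LinMCM Q b) :
    FGModuleCat.{u} (CliffordAlgebra.even Q) :=
  letI : Module (CliffordAlgebra.even Q) (Fiber M.obj) :=
    Module.compHom (Fiber M.obj) (A.act M).toRingHom
  haveI : IsScalarTower k (CliffordAlgebra.even Q) (Fiber M.obj) :=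
    ⟨fun c a x => by
      change A.act M (c • a) x = c • A.act M a x
      rw [map_smul, LinearMap.smul_apply]⟩
  haveI : Module.Finite (QuadricRing Q b) M.obj.carrier := M.property.1.1
  haveI : Module.Finite k (Fiber M.obj) := finite_fiber M.obj
  haveI : Module.Finite (CliffordAlgebra.even Q) (Fiber M.obj) :=
    Module.Finite.of_restrictScalars_finite k _ _
  FGModuleCat.of (CliffordAlgebra.even Q) (Fiber M.obj)

/-- The functor `M ↦ k ⊗_R M`, `f ↦ k ⊗_R f` to finitely generated `Cl₀(Q)`-modules. -/
def EvenAction.functor (A : EvenAction Q b) :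
    LinMCM Q b ⥤ FGModuleCat.{u} (CliffordAlgebra.even Q) where
  obj M := A.obj M
  map {M N} f := ObjectProperty.homMk (ModuleCat.ofHom
    (X := (A.obj M).obj) (Y := (A.obj N).obj)
    { toFun := Fiber.map f.hom
      map_add' := map_add (Fiber.map f.hom)
      map_smul' := fun a x => A.naturality f a x })
  map_id M := by
    refine ObjectProperty.hom_ext _ (ModuleCat.hom_ext (LinearMap.ext fun x => ?_))
    exact Fiber.map_id M.obj x
  map_comp f g := by
    refine ObjectProperty.hom_ext _ (ModuleCat.hom_ext (LinearMap.ext fun x => ?_))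
    exact Fiber.map_comp f.hom g.hom x

end Clifford

end

end QuadricMCM

namespace QuadricMCM

open RingTheory.Sequence IsLocalRing CategoryTheory Abelian
open scoped Pointwise

/-! ### Systems of parameters on Cohen–Macaulay modules over a local ring. -/

section Local

variable {R : Type u} [CommRing R] [IsLocalRing R]

/-! Since the radical is zero and V ≠ 0, some vector v₀ has Q(v₀) ≠ 0; extend it to a basis c with c
0 = v₀. Let S be the polynomial ring in the coordinates vanishing on v₀ and x the remaining
coordinate. The quadric reads Q(v₀)x² + lx + g = 0 with l, g in S, so R = S ⊕ Sx. Nothing is divided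
by 2: a bilinear form β, not symmetric in general, with β(v,v) = Q(v) replaces half of the polar
form.

Let M be a linear MCM module. The coordinates in S are parameters, hence a regular sequence on M
localized at 𝔪, and this makes families that are independent modulo these coordinates independent
over S. Let w_j be degree-zero generators. If some x w_j were not an S₁-combination of the
generators, it would belong to an S-basis of M; the dual functional would induce an R-linear map M →
R with w_j ↦ 1, and M would have a free summand (`coordZero_smul_mem_coordSpan`). Hence M = ⊕ S w_j,
and x acts by −N with N a matrix of linear forms in S. The presentation matrix N + x amounts to a
linear map D : V → Mat_r(k) with D(v₀) = 1; this is a `NormalFrame`.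

Writing b for the polar form, the quadratic equation of x becomes Q(v₀)D(v)² − b(v₀,v)D(v) + Q(v) =
0 for all v (`QuadRel`), and every such D comes from a module (`exists_matMod_frame`). In the
Clifford algebra the elements v v₀ / Q(v₀) satisfy this same relation, and they generate Cl₀ because
u v = (u v₀)(v₀ v)/Q(v₀). So these D are exactly the Cl₀-module structures on k ⊗ M. Degree-zero
morphisms are constant matrices intertwining the D's, that is, Cl₀-linear maps of fibers; this gives
the equivalence.

For the syzygy, N and −x are roots of one monic quadratic, so N + x has a conjugate factor with
product zero in R. Accordingly Syz₁(M) has a frame with matrices b(v₀,v)/Q(v₀) − D(v)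
(`NormalFrame.exists_syzygy_frame`). Identifying the two fibers by η, the operators D(v)η⁻¹ and
η(b(v₀,v) − Q(v₀)D(v)) compose to Q(v) in both orders and define the graded Clifford module. In it η
is multiplication by v₀⁻¹, and since every odd x equals v₀⁻¹(v₀x), every element of Cl₁ ⊗ T(M) has
the form v₀⁻¹ ⊗ y; hence Clifford multiplication is bijective (`OddTensor.exists_linearEquiv`). -/

theorem mem_maximalIdeal_of_isRegular_cons {M : Type*} [AddCommGroup M] [Module R M] {x : R}
    {rs : List R} (reg : IsRegular M (x :: rs)) : x ∈ maximalIdeal R := by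
  simpa using fun isu ↦ reg.2 (by simp [Ideal.span_singleton_eq_top.mpr isu])

variable [IsNoetherianRing R]

/-- Depth is at most dim R/P for every associated prime P. Cutting by a regular element x, one finds
an associated prime of M/xM containing both P and x; as x ∉ P, the dimension drops by at least one,
and induction applies. -/
theorem length_le_ringKrullDim_of_isAssociatedPrime {M : Type*} [AddCommGroup M] [Module R M]
    [Module.Finite R M] (rs : List R) (P : Ideal R) (hP : IsAssociatedPrime P M)
    (reg : IsRegular M rs) : (rs.length : WithBot ℕ∞) ≤ ringKrullDim (R ⧸ P) := by
  induction rs generalizing M P with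
  | nil =>
    have := hP.isPrime
    simpa using! ringKrullDim_nonneg_of_nontrivial
  | cons x rs ih =>
    have hx := mem_maximalIdeal_of_isRegular_cons reg
    rw [isRegular_cons_iff] at reg
    obtain ⟨hPp, z, rfl⟩ := isAssociatedPrime_iff.1 hP
    have hz : z ≠ 0 := by
      rintro rfl
      exact hPp.ne_top (by ext; simp [Submodule.mem_colon_singleton])
    set P := (⊥ : Submodule R M).colon {z} with hPdef
    let N : Submodule R M := Submodule.torsionBySet R M P
    have hzN : z ∈ N := by
      rw [Submodule.mem_torsionBySet_iff]
      rintro ⟨a, ha⟩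
      simpa [hPdef, Submodule.mem_colon_singleton] using ha
    -- If N, the submodule killed by P, were inside xM, regularity of x would give N = xN, and
    -- Nakayama would force N = 0 although z ∈ N.
    have hN : ∃ m ∈ N, m ∉ x • (⊤ : Submodule R M) := by
      by_contra! H
      have hle : N ≤ Ideal.span {x} • N := by
        intro m hm
        obtain ⟨m', -, rfl⟩ := (Submodule.mem_smul_pointwise_iff_exists _ _ _).1 (H m hm)
        refine Submodule.smul_mem_smul (Ideal.mem_span_singleton_self x) ?_
        rw [Submodule.mem_torsionBySet_iff] at hm ⊢
        intro a
        apply reg.1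
        have := hm a
        simp only [smul_zero]
        rw [smul_comm]; exact this
      have := Submodule.eq_bot_of_le_smul_of_le_jacobson_bot (Ideal.span {x}) N
        (IsNoetherian.noetherian N) hle
        (by rw [IsLocalRing.jacobson_eq_maximalIdeal ⊥ bot_ne_top]
            rwa [Ideal.span_singleton_le_iff_mem])
      rw [this] at hzN
      exact hz (by simpa using hzN)
    obtain ⟨m, hmN, hmx⟩ := hN
    have hm0 : (Submodule.Quotient.mk m : QuotSMulTop x M) ≠ 0 := by
      rwa [Ne, Submodule.Quotient.mk_eq_zero]
    obtain ⟨Q', hQ, hle⟩ := exists_le_isAssociatedPrime_of_isNoetherianRing R _ hm0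
    have hPQ : P ≤ Q' := by
      intro a ha
      apply hle
      rw [Submodule.mem_torsionBySet_iff] at hmN
      have := hmN ⟨a, ha⟩
      rw [Submodule.mem_colon_singleton, ← Submodule.Quotient.mk_smul]
      simp only at this
      rw [this]; simp
    have hxQ : x ∈ Q' := by
      apply hle
      rw [Submodule.mem_colon_singleton, ← Submodule.Quotient.mk_smul, Submodule.mem_bot,
        Submodule.Quotient.mk_eq_zero]
      exact Submodule.smul_mem_pointwise_smul _ _ _ trivial
    have hxP : x ∉ P := by
      intro h
      rw [hPdef, Submodule.mem_colon_singleton, Submodule.mem_bot] at h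
      exact hz (reg.1 (by simpa using h))
    have h1 := ih Q' hQ reg.2
    have := hQ.isPrime
    have h2 := ringKrullDim_succ_le_of_surjective (Ideal.Quotient.factor hPQ)
      (Ideal.Quotient.factor_surjective hPQ) (r := Ideal.Quotient.mk P x)
      (mem_nonZeroDivisors_of_ne_zero (by rwa [Ne, Ideal.Quotient.eq_zero_iff_mem]))
      (by simpa [Ideal.Quotient.eq_zero_iff_mem] using hxQ)
    refine le_trans ?_ h2
    rw [List.length_cons]
    push_cast
    gcongr

/-- Depth drops by at most one modulo any regular y, whichever regular sequence witnessed the depth: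
Ext vanishing detects depth, and the long exact sequence of multiplication by y carries it from
degrees i and i + 1 of M to degree i of M/yM. -/
theorem exists_isRegular_quotSMulTop {M : Type u} [AddCommGroup M] [Module R M]
    [Module.Finite R M] {y : R} (hy : y ∈ maximalIdeal R) (hyM : IsSMulRegular M y)
    {rs : List R} {l : ℕ} (hl : rs.length = l + 1) (reg : IsRegular M rs)
    (hrs : ∀ r ∈ rs, r ∈ maximalIdeal R) :
    ∃ rs' : List R, rs'.length = l ∧ (∀ r ∈ rs', r ∈ maximalIdeal R) ∧
      IsRegular (QuotSMulTop y M) rs' := by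
  have := reg.nontrivial
  have hlt : ∀ (N : Type u) [AddCommGroup N] [Module R N] [Module.Finite R N] [Nontrivial N],
      maximalIdeal R • (⊤ : Submodule R N) < ⊤ := fun N _ _ _ _ =>
    (Submodule.top_ne_ideal_smul_of_le_jacobson_annihilator
      (IsLocalRing.maximalIdeal_le_jacobson _)).symm.lt_top
  have : Nontrivial (QuotSMulTop y M) := nontrivial_quotSMulTop_of_mem_maximalIdeal M hy
  have hE := ((ModuleCat.exists_isRegular_tfae (maximalIdeal R) (l + 1) (ModuleCat.of R M)
    (hlt M)).out 3 1 :
      (∃ rs : List R, rs.length = l + 1 ∧ (∀ r ∈ rs, r ∈ maximalIdeal R) ∧ IsRegular M rs) ↔ _).1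
    ⟨rs, hl, hrs, reg⟩
  refine ((ModuleCat.exists_isRegular_tfae (maximalIdeal R) l (ModuleCat.of R (QuotSMulTop y M))
    (hlt _)).out 1 3).1 fun i hi => ?_
  have zero1 := AddCommGrpCat.isZero_of_iff_subsingleton.mpr (hE i (by omega))
  have zero2 := AddCommGrpCat.isZero_of_iff_subsingleton.mpr (hE (i + 1) (by omega))
  exact AddCommGrpCat.subsingleton_of_isZero <| ShortComplex.Exact.isZero_of_both_zeros
    ((Ext.covariant_sequence_exact₃' _
      (IsSMulRegular.smulShortComplex_shortExact (M := ModuleCat.of R M) hyM)) i (i + 1) rfl)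
    (zero1.eq_zero_of_src _) (zero2.eq_zero_of_tgt _)

/-- In R/P the maximal ideal is a minimal prime over the images of the elements, so Krull's height
theorem bounds its height. -/
theorem ringKrullDim_quotient_le_length {P : Ideal R} [P.IsPrime] {ys : List R}
    (hys : ∀ y ∈ ys, y ∈ maximalIdeal R)
    (h : maximalIdeal R ≤ (P ⊔ Ideal.ofList ys).radical) :
    ringKrullDim (R ⧸ P) ≤ ys.length := by
  have : IsLocalRing (R ⧸ P) :=
    IsLocalRing.of_surjective' (Ideal.Quotient.mk P) Ideal.Quotient.mk_surjective
  rw [← IsLocalRing.maximalIdeal_height_eq_ringKrullDim]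
  have hmax : (maximalIdeal (R ⧸ P)).comap (Ideal.Quotient.mk P) = maximalIdeal R :=
    IsLocalRing.eq_maximalIdeal (Ideal.comap_isMaximal_of_surjective _
      Ideal.Quotient.mk_surjective)
  have hmin : maximalIdeal (R ⧸ P) ∈
      (Ideal.span {r | r ∈ ys.map (Ideal.Quotient.mk P)}).minimalPrimes := by
    refine ⟨⟨inferInstance, ?_⟩, ?_⟩
    · rw [Ideal.span_le]
      rintro _ hr
      obtain ⟨y, hy, rfl⟩ := List.mem_map.1 hr
      exact Ideal.mem_comap.1 (hmax ▸ hys y hy)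
    · rintro J ⟨hJ, hle⟩ -
      have hJ' : (P ⊔ Ideal.ofList ys).radical ≤ J.comap (Ideal.Quotient.mk P) := by
        rw [(hJ.comap (Ideal.Quotient.mk P)).radical_le_iff]
        refine sup_le (fun a ha => ?_) (Ideal.span_le.2 fun y hy => ?_)
        · rw [Ideal.mem_comap, Ideal.Quotient.eq_zero_iff_mem.2 ha]; exact J.zero_mem
        · exact hle (Ideal.subset_span (List.mem_map_of_mem hy))
      intro r hr
      obtain ⟨r, rfl⟩ := Ideal.Quotient.mk_surjective r
      exact hJ' (h (hmax ▸ hr))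
  have hfin := List.finite_toSet (ys.map (Ideal.Quotient.mk P))
  refine (WithBot.coe_le_coe.2 (Ideal.height_le_card_of_mem_minimalPrimes_span hfin hmin)).trans ?_
  norm_cast
  classical
  have : {r | r ∈ ys.map (Ideal.Quotient.mk P)} = ((ys.map (Ideal.Quotient.mk P)).toFinset : Set _) := by
    ext; simp
  rw [this, Set.ncard_coe_finset]
  exact (List.toFinset_card_le _).trans (by simp)

/-- Parameters on a Cohen–Macaulay module form a regular sequence. If the first one were a zero
divisor it would lie in an associated prime P, and the remaining ones would bound dim R/P strictly
below the depth. Otherwise pass to the quotient, whose depth is again large enough. -/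
theorem isWeaklyRegular_of_le_radical {M : Type u} [AddCommGroup M] [Module R M]
    [Module.Finite R M] {rs : List R} (ys : List R) (hl : rs.length = ys.length)
    (reg : IsRegular M rs) (hrs : ∀ r ∈ rs, r ∈ maximalIdeal R)
    (hys : ∀ y ∈ ys, y ∈ maximalIdeal R)
    (h : maximalIdeal R ≤ (Module.annihilator R M ⊔ Ideal.ofList ys).radical) :
    IsWeaklyRegular M ys := by
  induction ys generalizing M rs with
  | nil => simp
  | cons y ys ih =>
    simp only [List.mem_cons, forall_eq_or_imp] at hys
    have hy : IsSMulRegular M y := by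
      by_contra hcon
      have hmem : y ∈ ⋃ p ∈ associatedPrimes R M, (p : Set R) := by
        rw [biUnion_associatedPrimes_eq_compl_regular]; exact hcon
      simp only [Set.mem_iUnion, SetLike.mem_coe, exists_prop] at hmem
      obtain ⟨P, hP, hyP⟩ := hmem
      have := hP.isPrime
      have h1 := length_le_ringKrullDim_of_isAssociatedPrime rs P hP reg
      have hann : Module.annihilator R M ≤ P := by
        rw [← Submodule.annihilator_top]; exact hP.annihilator_le
      have h2 := ringKrullDim_quotient_le_length (P := P) hys.2 (h.trans (Ideal.radical_mono (by
        rw [Ideal.ofList_cons, ← sup_assoc]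
        exact sup_le_sup_right (sup_le hann (by rwa [Ideal.span_singleton_le_iff_mem])) _)))
      have h3 := h1.trans h2
      rw [hl, List.length_cons] at h3
      norm_cast at h3
      omega
    obtain ⟨rs', hl', hrs', reg'⟩ := exists_isRegular_quotSMulTop hys.1 hy hl reg hrs
    rw [isWeaklyRegular_cons_iff]
    refine ⟨hy, ih hl' reg' hrs' hys.2 (h.trans (Ideal.radical_mono ?_))⟩
    rw [Ideal.ofList_cons, ← sup_assoc]
    refine sup_le_sup_right (sup_le ?_ ?_) _
    · exact LinearMap.annihilator_le_of_surjective _ (Submodule.mkQ_surjective _)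
    · rw [Ideal.span_singleton_le_iff_mem, Module.mem_annihilator]
      intro m
      obtain ⟨m, rfl⟩ := Submodule.Quotient.mk_surjective _ m
      rw [← Submodule.Quotient.mk_smul, Submodule.Quotient.mk_eq_zero]
      exact Submodule.smul_mem_pointwise_smul _ _ _ trivial

end Local

end QuadricMCM

namespace QuadricMCM

open RingTheory.Sequence IsLocalRing
open scoped Pointwise

/-! ### Independence over a polynomial ring from regularity of the variables. -/

section Independence

variable {k : Type*} [Field k] {d : ℕ}

/-- The images of the variables, as a list. -/
noncomputable def varList {R : Type*} [CommRing R] (θ : MvPolynomial (Fin d) k →+* R) : List R :=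
  List.ofFn fun i => θ (MvPolynomial.X i)

theorem mem_varList {R : Type*} [CommRing R] {θ : MvPolynomial (Fin d) k →+* R} {r : R} :
    r ∈ varList θ ↔ ∃ i, θ (MvPolynomial.X i) = r := by
  simp [varList, List.mem_ofFn]

theorem map_mem_ofList_varList {R : Type*} [CommRing R] (θ : MvPolynomial (Fin d) k →+* R)
    (i : Fin d) : θ (MvPolynomial.X i) ∈ Ideal.ofList (varList θ) :=
  Ideal.subset_span (mem_varList.2 ⟨i, rfl⟩)

theorem map_sub_constantCoeff_mem {R : Type*} [CommRing R] (θ : MvPolynomial (Fin d) k →+* R)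
    (a : MvPolynomial (Fin d) k) :
    θ a - θ (MvPolynomial.C (MvPolynomial.constantCoeff a)) ∈ Ideal.ofList (varList θ) := by
  induction a using MvPolynomial.induction_on with
  | C a => simp
  | add p q hp hq =>
    have := Ideal.add_mem _ hp hq
    convert this using 1
    simp only [map_add]; ring
  | mul_X p i _ =>
    simp only [map_mul, MvPolynomial.constantCoeff_X, mul_zero, map_zero, sub_zero]
    exact Ideal.mul_mem_left _ _ (map_mem_ofList_varList θ i)

variable {R : Type*} [CommRing R] (θ : MvPolynomial (Fin d) k →+* R)
  {E : Type*} [AddCommGroup E] [Module R E]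

/-- Descending induction on i: a relation modulo the first i variables has coefficients in the ideal
of those variables. The start i = d is the hypothesis on constant terms; i = 0 is linear
independence. -/
theorem mem_span_X_of_sum_smul_mem (hreg : IsWeaklyRegular E (varList θ))
    {ι : Type*} [Fintype ι] (w : ι → E)
    (hw : ∀ a : ι → MvPolynomial (Fin d) k,
      ∑ j, θ (a j) • w j ∈ Ideal.ofList (varList θ) • (⊤ : Submodule R E) →
        ∀ j, MvPolynomial.constantCoeff (a j) = 0)
    (i : ℕ) (hi : i ≤ d) (a : ι → MvPolynomial (Fin d) k)
    (ha : ∑ j, θ (a j) • w j ∈ Ideal.ofList ((varList θ).take i) • (⊤ : Submodule R E)) (j : ι) :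
    a j ∈ Ideal.span (MvPolynomial.X '' {l : Fin d | (l : ℕ) < i} :
      Set (MvPolynomial (Fin d) k)) := by
  have hlen : (varList θ).length = d := by simp [varList]
  induction hi using Nat.decreasingInduction generalizing a j with
  | self =>
    rw [List.take_of_length_le hlen.le] at ha
    rw [MvPolynomial.mem_ideal_span_X_image]
    intro m hm
    have h0 := hw a ha j
    by_contra! hcon
    have : m = 0 := by
      ext l; exact hcon l l.2
    rw [this, MvPolynomial.mem_support_iff] at hm
    exact hm h0
  | of_succ i hi ih =>
    have hmono : Ideal.ofList ((varList θ).take i) ≤ Ideal.ofList ((varList θ).take (i + 1)) :=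
      Ideal.span_mono fun r hr => (List.take_subset_take_left _ (Nat.le_succ i)) hr
    -- A second induction, on a degree bound for the coefficients: dividing by the variable of index
    -- i lowers the degree.
    have key : ∀ (N : ℕ) (a : ι → MvPolynomial (Fin d) k),
        (∀ j, ∀ m ∈ (a j).support, m.degree < N) →
        ∑ j, θ (a j) • w j ∈ Ideal.ofList ((varList θ).take i) • (⊤ : Submodule R E) →
        ∀ j, a j ∈ Ideal.span (MvPolynomial.X '' {l : Fin d | (l : ℕ) < i} :
          Set (MvPolynomial (Fin d) k)) := by
      intro N
      induction N with
      | zero =>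
        intro a hN _ j
        have : a j = 0 := by
          rw [← MvPolynomial.support_eq_empty, Finset.eq_empty_iff_forall_notMem]
          exact fun m hm => absurd (hN j m hm) (Nat.not_lt_zero _)
        rw [this]; exact Ideal.zero_mem _
      | succ N ihN =>
        intro a hN ha
        have hai := ih a (Submodule.smul_mono_left hmono ha)
        let x : Fin d := ⟨i, hi⟩
        -- Write a_j = X_i c_j + r_j with no monomial of r_j divisible by X_i. The case i + 1 then
        -- puts r_j in the ideal of the first i variables, so X_i ∑ c_j w_j lies in the submodule
        -- they generate, and regularity cancels X_i.
        let c : ι → MvPolynomial (Fin d) k := fun j => (a j).divMonomial (Finsupp.single x 1)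
        let r : ι → MvPolynomial (Fin d) k := fun j => (a j).modMonomial (Finsupp.single x 1)
        have hcr : ∀ j, a j = MvPolynomial.X x * c j + r j := fun j =>
          (MvPolynomial.divMonomial_add_modMonomial_single (a j) x).symm
        have hr : ∀ j, r j ∈ Ideal.span (MvPolynomial.X '' {l : Fin d | (l : ℕ) < i} :
            Set (MvPolynomial (Fin d) k)) := by
          intro j
          rw [MvPolynomial.mem_ideal_span_X_image]
          intro m hm
          have hm0 : ¬ Finsupp.single x 1 ≤ m := by
            intro hle
            rw [MvPolynomial.mem_support_iff] at hm
            exact hm (MvPolynomial.coeff_modMonomial_of_le _ hle)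
          have hma : m ∈ (a j).support := by
            rw [MvPolynomial.mem_support_iff] at hm ⊢
            rwa [← MvPolynomial.coeff_modMonomial_of_not_le _ hm0]
          obtain ⟨l, hl, hml⟩ := (MvPolynomial.mem_ideal_span_X_image.1 (hai j)) m hma
          refine ⟨l, ?_, hml⟩
          rcases Nat.lt_succ_iff_lt_or_eq.1 hl with h | h
          · exact h
          · exfalso
            apply hm0
            have : l = x := Fin.ext h
            rw [Finsupp.single_le_iff, ← this]
            omega
        have hJ : ∀ p ∈ Ideal.span (MvPolynomial.X '' {l : Fin d | (l : ℕ) < i} :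
            Set (MvPolynomial (Fin d) k)), θ p ∈ Ideal.ofList ((varList θ).take i) := by
          intro p hp
          have : Ideal.span (MvPolynomial.X '' {l : Fin d | (l : ℕ) < i} :
              Set (MvPolynomial (Fin d) k)) ≤ (Ideal.ofList ((varList θ).take i)).comap θ := by
            rw [Ideal.span_le]
            rintro _ ⟨l, hl, rfl⟩
            refine Ideal.subset_span ?_
            change _ ∈ List.take i _
            rw [List.mem_take_iff_getElem]
            exact ⟨l, by rw [hlen]; exact lt_min hl l.2, by simp [varList]⟩
          exact this hp
        have hsum : θ (MvPolynomial.X x) • ∑ j, θ (c j) • w j ∈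
            Ideal.ofList ((varList θ).take i) • (⊤ : Submodule R E) := by
          have h1 : θ (MvPolynomial.X x) • ∑ j, θ (c j) • w j =
              ∑ j, θ (a j) • w j - ∑ j, θ (r j) • w j := by
            rw [Finset.smul_sum, ← Finset.sum_sub_distrib]
            refine Finset.sum_congr rfl fun j _ => ?_
            rw [hcr j, map_add, map_mul, add_smul, mul_smul]; abel
          rw [h1]
          exact Submodule.sub_mem _ ha (Submodule.sum_mem _ fun j _ =>
            Submodule.smul_mem_smul (hJ _ (hr j)) trivial)
        have hreg' := hreg.regular_mod_prev i (by omega)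
        have hx : (varList θ)[i]'(by omega) = θ (MvPolynomial.X x) := by simp [varList, x]
        rw [hx] at hreg'
        have hc := mem_of_isSMulRegular_quotient_of_smul_mem hreg' hsum
        intro j
        rw [hcr j]
        refine Ideal.add_mem _ (Ideal.mul_mem_left _ _ (ihN c ?_ hc j)) (hr j)
        intro j m hm
        rw [MvPolynomial.mem_support_iff, MvPolynomial.coeff_divMonomial,
          ← MvPolynomial.mem_support_iff] at hm
        have := hN j _ hm
        rw [map_add, Finsupp.degree_single] at this
        omega
    obtain ⟨N, hN⟩ : ∃ N, ∀ j, ∀ m ∈ (a j).support, m.degree < N := by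
      refine ⟨∑ j, ∑ m ∈ (a j).support, (m.degree + 1), fun j m hm => ?_⟩
      calc m.degree < m.degree + 1 := Nat.lt_succ_self _
        _ ≤ ∑ m ∈ (a j).support, (m.degree + 1) :=
            Finset.single_le_sum (f := fun m : Fin d →₀ ℕ => m.degree + 1) (fun _ _ => Nat.zero_le _) hm
        _ ≤ _ := Finset.single_le_sum (f := fun j => ∑ m ∈ (a j).support, (m.degree + 1))
            (fun _ _ => Nat.zero_le _) (Finset.mem_univ j)
    exact key N a hN ha j

theorem eq_zero_of_sum_smul_eq_zero_of_isWeaklyRegular (hreg : IsWeaklyRegular E (varList θ))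
    {ι : Type*} [Fintype ι] (w : ι → E)
    (hw : ∀ a : ι → MvPolynomial (Fin d) k,
      ∑ j, θ (a j) • w j ∈ Ideal.ofList (varList θ) • (⊤ : Submodule R E) →
        ∀ j, MvPolynomial.constantCoeff (a j) = 0)
    (a : ι → MvPolynomial (Fin d) k) (ha : ∑ j, θ (a j) • w j = 0) (j : ι) : a j = 0 := by
  have := mem_span_X_of_sum_smul_mem θ hreg w hw 0 (Nat.zero_le _) a
    (by rw [ha]; exact Submodule.zero_mem _) j
  simpa using this

end Independence

/-! ### Transfer between a maximal ideal and the localization at it. -/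

section Regular

variable {k : Type*} [Field k] {d : ℕ} {R : Type u} [CommRing R] [IsNoetherianRing R]
  (θ : MvPolynomial (Fin d) k →+* R) {M : Type u} [AddCommGroup M] [Module R M]
  [Module.Finite R M]

omit [Module.Finite R M] in
-- Some power of I lies in Y, and s is invertible modulo every power of I because I is maximal.
theorem mem_smul_top_of_smul_mem {I Y : Ideal R} [I.IsMaximal] (hI : I ≤ Y.radical) {s : R}
    (hs : s ∉ I) {z : M} (hz : s • z ∈ Y • (⊤ : Submodule R M)) : z ∈ Y • (⊤ : Submodule R M) := by
  obtain ⟨N, hN⟩ := Ideal.exists_pow_le_of_le_radical_of_fg hI (IsNoetherian.noetherian I)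
  have h1 : I ⊔ Ideal.span {s} = ⊤ := by
    refine (Ideal.isMaximal_def.1 ‹_›).2 _ (lt_of_le_of_ne le_sup_left fun h => hs ?_)
    rw [h]
    exact Ideal.mem_sup_right (Ideal.mem_span_singleton_self s)
  have h2 := Ideal.pow_sup_eq_top (n := N) h1
  obtain ⟨e, he, t, ht, hsum⟩ := Submodule.mem_sup.1 ((Ideal.eq_top_iff_one _).1 h2)
  obtain ⟨t, rfl⟩ := Ideal.mem_span_singleton'.1 ht
  rw [← one_smul R z, ← hsum, add_smul, mul_smul]
  exact Submodule.add_mem _ (Submodule.smul_mem_smul (hN he) trivial) (Submodule.smul_mem _ _ hz)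

/-- The coordinate ring is not local, so the statement on parameters is applied after localizing at
I. The localized module may be zero as far as the hypotheses show at once; this case is trivial for
weak regularity. -/
theorem isWeaklyRegular_localizedModule {I : Ideal R} [I.IsMaximal] {ys : List R}
    (hI : I ≤ (Ideal.ofList ys).radical) (hys : ∀ y ∈ ys, y ∈ I) {rs : List R}
    (hl : rs.length = ys.length) (hrs : ∀ r ∈ rs, r ∈ I) (reg : IsRegular M rs) :
    IsWeaklyRegular (LocalizedModule I.primeCompl M) ys := by
  cases subsingleton_or_nontrivial (LocalizedModule I.primeCompl M) with
  | inl h => exact ⟨fun i hi => fun x y _ => Subsingleton.elim _ _⟩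
  | inr h =>
    let S := Localization.AtPrime I
    have reg' := reg.1.isRegular_of_isLocalizedModule_of_mem S I
      (LocalizedModule.mkLinearMap I.primeCompl M) hrs
    rw [← isWeaklyRegular_map_algebraMap_iff S]
    have hmap : ∀ r ∈ I, algebraMap R S r ∈ maximalIdeal S := fun r hr =>
      (IsLocalization.AtPrime.to_map_mem_maximal_iff S I r).2 hr
    refine isWeaklyRegular_of_le_radical _ (by simpa using hl) reg' ?_ ?_ ?_
    · intro r hr
      obtain ⟨r', hr', rfl⟩ := List.mem_map.1 hr
      exact hmap r' (hrs r' hr')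
    · intro r hr
      obtain ⟨r', hr', rfl⟩ := List.mem_map.1 hr
      exact hmap r' (hys r' hr')
    · rw [← Localization.AtPrime.map_eq_maximalIdeal, Ideal.map_le_iff_le_comap]
      intro r hr
      obtain ⟨n, hn⟩ := hI hr
      refine ⟨n, Ideal.mem_sup_right ?_⟩
      rw [← map_pow, ← Ideal.map_ofList]
      exact Ideal.mem_map_of_mem _ hn

omit [IsNoetherianRing R] [Module.Finite R M] in
theorem exists_smul_mem_of_mk_mem {T : Submonoid R} {Y : Ideal R} {z : M}
    (hz : LocalizedModule.mkLinearMap T M z ∈ Y • (⊤ : Submodule R (LocalizedModule T M))) :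
    ∃ s ∈ T, s • z ∈ Y • (⊤ : Submodule R M) := by
  have key : ∀ e ∈ Y • (⊤ : Submodule R (LocalizedModule T M)),
      ∃ s ∈ T, ∃ m ∈ Y • (⊤ : Submodule R M), s • e = LocalizedModule.mkLinearMap T M m := by
    intro e he
    induction he using Submodule.smul_induction_on' with
    | smul r hr e _ =>
      obtain ⟨⟨m, s⟩, hms⟩ := IsLocalizedModule.surj T (LocalizedModule.mkLinearMap T M) e
      refine ⟨s, s.2, r • m, Submodule.smul_mem_smul hr trivial, ?_⟩
      rw [map_smul, ← hms, smul_comm]; rfl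
    | add x _ y _ hx hy =>
      obtain ⟨s, hs, m, hm, h1⟩ := hx
      obtain ⟨t, ht, m', hm', h2⟩ := hy
      refine ⟨s * t, T.mul_mem hs ht, t • m + s • m', Submodule.add_mem _
        (Submodule.smul_mem _ _ hm) (Submodule.smul_mem _ _ hm'), ?_⟩
      rw [map_add, map_smul, map_smul, ← h1, ← h2, smul_add, mul_smul, mul_smul, smul_comm s t x]
  obtain ⟨s, hs, m, hm, h⟩ := key _ hz
  rw [← map_smul] at h
  obtain ⟨t, ht⟩ := IsLocalizedModule.exists_of_eq (S := T) h
  refine ⟨t * s, T.mul_mem t.2 hs, ?_⟩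
  rw [mul_smul]
  change (t : R) • s • z = (t : R) • m at ht
  rw [ht]
  exact Submodule.smul_mem _ _ hm

/-- It suffices to test independence over k modulo the variables, in M itself: the localization
supplies regularity, and denominators outside I can be cancelled modulo an ideal whose radical
contains I. -/
theorem eq_zero_of_sum_smul_eq_zero_of_isRegular {I : Ideal R} [I.IsMaximal]
    (hI : I ≤ (Ideal.ofList (varList θ)).radical) (hX : ∀ i, θ (MvPolynomial.X i) ∈ I)
    {rs : List R} (hl : rs.length = d) (hrs : ∀ r ∈ rs, r ∈ I) (reg : IsRegular M rs)
    {ι : Type*} [Fintype ι] (w : ι → M)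
    (hw : ∀ c : ι → k, ∑ j, θ (MvPolynomial.C (c j)) • w j ∈
      Ideal.ofList (varList θ) • (⊤ : Submodule R M) → ∀ j, c j = 0)
    (a : ι → MvPolynomial (Fin d) k) (ha : ∑ j, θ (a j) • w j = 0) (j : ι) : a j = 0 := by
  let F := LocalizedModule.mkLinearMap I.primeCompl M
  refine eq_zero_of_sum_smul_eq_zero_of_isWeaklyRegular θ (E := LocalizedModule I.primeCompl M)
    (isWeaklyRegular_localizedModule hI ?_ (by simpa [varList] using hl) hrs reg)
    (fun j => F (w j)) ?_ a ?_ j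
  · intro y hy
    obtain ⟨i, rfl⟩ := mem_varList.1 hy
    exact hX i
  · intro a ha
    refine hw _ ?_
    have h1 : F (∑ j, θ (MvPolynomial.C (MvPolynomial.constantCoeff (a j))) • w j) ∈
        Ideal.ofList (varList θ) • (⊤ : Submodule R (LocalizedModule I.primeCompl M)) := by
      have h2 : F (∑ j, θ (MvPolynomial.C (MvPolynomial.constantCoeff (a j))) • w j) =
          ∑ j, θ (a j) • F (w j) -
          ∑ j, (θ (a j) - θ (MvPolynomial.C (MvPolynomial.constantCoeff (a j)))) • F (w j) := by
        rw [map_sum, ← Finset.sum_sub_distrib]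
        refine Finset.sum_congr rfl fun j _ => ?_
        rw [sub_smul, map_smul]; abel
      rw [h2]
      exact Submodule.sub_mem _ ha (Submodule.sum_mem _ fun j _ =>
        Submodule.smul_mem_smul (map_sub_constantCoeff_mem θ _) trivial)
    obtain ⟨s, hs, hsz⟩ := exists_smul_mem_of_mk_mem h1
    exact mem_smul_top_of_smul_mem hI hs hsz
  · have := congrArg F ha
    simpa using this

end Regular

end QuadricMCM

namespace QuadricMCM

noncomputable section

/-! ### Regular sequences bounded by dimension, and the integer grading of polynomial rings. -/

section Dimension

open RingTheory.Sequence in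
theorem length_le_supportDim_of_isRegular {R : Type*} [CommRing R] {M : Type*} [AddCommGroup M]
    [Module R M] [Module.Finite R M] (rs : List R) (reg : IsRegular M rs) :
    (rs.length : WithBot ℕ∞) ≤ Module.supportDim R M := by
  induction rs generalizing M with
  | nil =>
    have := reg.nontrivial
    have : Nonempty (Module.support R M) := Module.nonempty_support_of_nontrivial.to_subtype
    simpa using! Order.krullDim_nonneg
  | cons x rs ih =>
    rw [isRegular_cons_iff] at reg
    refine le_trans ?_ (Module.supportDim_quotSMulTop_succ_le_of_notMem_minimalPrimes
      (x := x) fun _ => reg.1.notMem_of_mem_minimalPrimes)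
    rw [List.length_cons]
    push_cast
    gcongr
    exact ih reg.2

end Dimension

section PolyGr

variable {k : Type*} [Field k] {σ : Type*}

/-- The grading of a polynomial ring by degree, indexed by the integers. -/
def polyGr (k : Type*) [Field k] (σ : Type*) (e : ℤ) : Submodule k (MvPolynomial σ k) where
  carrier := {a | ∀ m, a.coeff m ≠ 0 → (m.degree : ℤ) = e}
  add_mem' {a a'} ha ha' m hm := by
    by_cases h : a.coeff m = 0
    · exact ha' m fun h' => hm (by rw [MvPolynomial.coeff_add, h, h', add_zero])
    · exact ha m h
  zero_mem' m hm := absurd (MvPolynomial.coeff_zero m) hm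
  smul_mem' t a ha m hm := ha m fun h => hm (by rw [MvPolynomial.coeff_smul, h, smul_zero])

theorem mem_polyGr_natCast {e : ℕ} {a : MvPolynomial σ k} :
    a ∈ polyGr k σ e ↔ a.IsHomogeneous e := by
  refine forall_congr' fun m => imp_congr_right fun _ => ?_
  rw [Nat.cast_inj, Finsupp.degree_eq_weight_one]; rfl

theorem polyGr_of_neg {e : ℤ} (he : e < 0) {a : MvPolynomial σ k} (ha : a ∈ polyGr k σ e) :
    a = 0 := by
  ext m
  by_contra h
  have := ha m h
  omega

theorem polyGr_mul {e f : ℤ} {a a' : MvPolynomial σ k} (ha : a ∈ polyGr k σ e)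
    (ha' : a' ∈ polyGr k σ f) : a * a' ∈ polyGr k σ (e + f) := by
  intro m hm
  classical
  rw [MvPolynomial.coeff_mul] at hm
  obtain ⟨x, hx, h⟩ := Finset.exists_ne_zero_of_sum_ne_zero hm
  rw [← ha x.1 (left_ne_zero_of_mul h), ← ha' x.2 (right_ne_zero_of_mul h),
    ← Finset.HasAntidiagonal.mem_antidiagonal.1 hx,
    map_add, Nat.cast_add]

theorem C_mem_polyGr (t : k) : (MvPolynomial.C t : MvPolynomial σ k) ∈ polyGr k σ 0 :=
  mem_polyGr_natCast.2 (MvPolynomial.isHomogeneous_C σ t)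

theorem X_mem_polyGr (i : σ) : (MvPolynomial.X i : MvPolynomial σ k) ∈ polyGr k σ 1 :=
  mem_polyGr_natCast.2 (MvPolynomial.isHomogeneous_X k i)

theorem polyGr_zero {a : MvPolynomial σ k} (ha : a ∈ polyGr k σ 0) :
    a = MvPolynomial.C (MvPolynomial.constantCoeff a) := by
  classical
  ext m
  rw [MvPolynomial.coeff_C]
  split_ifs with h
  · rw [← h]; rfl
  · by_contra h'
    have := ha m h'
    rw [Nat.cast_eq_zero, Finsupp.degree_eq_zero_iff] at this
    exact h this.symm

theorem constantCoeff_of_mem_polyGr {e : ℤ} (he : e ≠ 0) {a : MvPolynomial σ k}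
    (ha : a ∈ polyGr k σ e) : MvPolynomial.constantCoeff a = 0 := by
  by_contra h
  exact he (by simpa using (ha 0 h).symm)

/-- The component of degree `e` of a polynomial. -/
def polyComp (e : ℤ) : MvPolynomial σ k →ₗ[k] MvPolynomial σ k :=
  if 0 ≤ e then MvPolynomial.homogeneousComponent e.toNat else 0

theorem coeff_polyComp (e : ℤ) (a : MvPolynomial σ k) (m : σ →₀ ℕ) :
    (polyComp e a).coeff m = if (m.degree : ℤ) = e then a.coeff m else 0 := by
  unfold polyComp
  split_ifs with h h' h'
  · rw [MvPolynomial.coeff_homogeneousComponent, if_pos (by omega)]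
  · rw [MvPolynomial.coeff_homogeneousComponent, if_neg (by omega)]
  · omega
  · simp

theorem polyComp_mem (e : ℤ) (a : MvPolynomial σ k) : polyComp e a ∈ polyGr k σ e := by
  intro m hm
  rw [coeff_polyComp] at hm
  by_contra h
  exact hm (if_neg h)

theorem polyComp_of_mem {e : ℤ} {a : MvPolynomial σ k} (ha : a ∈ polyGr k σ e) :
    polyComp e a = a := by
  ext m
  rw [coeff_polyComp]
  split_ifs with h
  · rfl
  · by_contra h'
    exact h (ha m (Ne.symm h'))

theorem polyComp_of_mem_ne {e f : ℤ} (hef : e ≠ f) {a : MvPolynomial σ k}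
    (ha : a ∈ polyGr k σ f) : polyComp e a = 0 := by
  ext m
  rw [coeff_polyComp, MvPolynomial.coeff_zero]
  split_ifs with h
  · by_contra h'
    exact hef (h.symm.trans (ha m h'))
  · rfl

theorem sum_polyComp {N : ℕ} {a : MvPolynomial σ k} (hN : a.totalDegree < N) :
    ∑ e ∈ Finset.range N, polyComp (e : ℤ) a = a := by
  ext m
  rw [MvPolynomial.coeff_sum]
  simp only [coeff_polyComp, Nat.cast_inj]
  rw [Finset.sum_ite_eq]
  split_ifs with h
  · rfl
  · by_contra h'
    refine h (Finset.mem_range.2 (lt_of_le_of_lt ?_ hN))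
    exact MvPolynomial.le_totalDegree (MvPolynomial.mem_support_iff.2 (Ne.symm h'))

end PolyGr

/-! ### The equation of the quadric in a basis adapted to an anisotropic vector. -/

section RingStructure

variable {k : Type u} [Field k] {V : Type v} [AddCommGroup V] [Module k V] {n : ℕ}
  (Q : QuadraticForm k V) (b : Module.Basis (Fin n) k V)

theorem mem_ringGr_natCast {e : ℕ} {r : QuadricRing Q b} :
    r ∈ ringGr Q b e ↔ ∃ p, p.IsHomogeneous e ∧ toQuadricRing Q b p = r := Iff.rfl

theorem ringGr_of_neg {e : ℤ} (he : e < 0) {r : QuadricRing Q b} (hr : r ∈ ringGr Q b e) :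
    r = 0 := by
  obtain ⟨m, rfl⟩ := Int.eq_negSucc_of_lt_zero he
  exact hr

theorem ringGr_mul {e f : ℤ} {r s : QuadricRing Q b} (hr : r ∈ ringGr Q b e)
    (hs : s ∈ ringGr Q b f) : r * s ∈ ringGr Q b (e + f) := by
  rcases lt_or_ge e 0 with he | he
  · rw [ringGr_of_neg Q b he hr, zero_mul]; exact Submodule.zero_mem _
  rcases lt_or_ge f 0 with hf | hf
  · rw [ringGr_of_neg Q b hf hs, mul_zero]; exact Submodule.zero_mem _
  lift e to ℕ using he
  lift f to ℕ using hf
  obtain ⟨p, hp, rfl⟩ := (mem_ringGr_natCast Q b).1 hr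
  obtain ⟨p', hp', rfl⟩ := (mem_ringGr_natCast Q b).1 hs
  rw [← map_mul, ← Nat.cast_add]
  exact (mem_ringGr_natCast Q b).2 ⟨_, hp.mul hp', rfl⟩

theorem algebraMap_mem_ringGr (t : k) : algebraMap k (QuadricRing Q b) t ∈ ringGr Q b 0 :=
  (mem_ringGr_natCast Q b (e := 0)).2 ⟨MvPolynomial.C t, MvPolynomial.isHomogeneous_C _ t, rfl⟩

theorem toQuadricRing_surjective : Function.Surjective (toQuadricRing Q b) :=
  Ideal.Quotient.mk_surjective

/-- A linear form on `V`, as an element of degree one of the coordinate ring. -/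
def linForm : Module.Dual k V →ₗ[k] QuadricRing Q b where
  toFun f := ∑ i, f (b i) • toQuadricRing Q b (MvPolynomial.X i)
  map_add' f g := by simp [add_smul, Finset.sum_add_distrib]
  map_smul' t f := by simp [mul_smul, Finset.smul_sum]

theorem linForm_apply (f : Module.Dual k V) :
    linForm Q b f = ∑ i, f (b i) • toQuadricRing Q b (MvPolynomial.X i) := rfl

theorem linForm_mem (f : Module.Dual k V) : linForm Q b f ∈ ringGr Q b 1 := by
  rw [linForm_apply]
  exact Submodule.sum_mem (ringGr Q b 1) fun i _ => Submodule.smul_mem _ _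
    ((mem_ringGr_natCast Q b (e := 1)).2 ⟨_, MvPolynomial.isHomogeneous_X _ i, rfl⟩)

theorem linForm_coord (i : Fin n) :
    linForm Q b (b.coord i) = toQuadricRing Q b (MvPolynomial.X i) := by
  rw [linForm_apply, Finset.sum_eq_single i]
  · simp
  · intro j _ hj
    simp [Finsupp.single_eq_of_ne hj.symm]
  · simp

theorem linForm_eq_sum {ι : Type*} [Fintype ι] (c : Module.Basis ι k V) (f : Module.Dual k V) :
    linForm Q b f = ∑ i, f (c i) • linForm Q b (c.coord i) := by
  conv_lhs => rw [← c.sum_dual_apply_smul_coord f]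
  rw [map_sum]
  simp only [map_smul]

/-- A bilinear form `β` with `β v v = Q v`. -/
def halfPolar : LinearMap.BilinMap k V k := Q.toBilin b

theorem halfPolar_self (v : V) : halfPolar Q b v v = Q v := by
  conv_rhs => rw [← Q.toQuadraticMap_toBilin b]
  rfl

theorem halfPolar_add_halfPolar (v w : V) :
    halfPolar Q b v w + halfPolar Q b w v = QuadraticMap.polar Q v w := by
  simp only [QuadraticMap.polar, ← halfPolar_self Q b, map_add, LinearMap.add_apply]
  ring

theorem aeval_quadricPoly {B : Type*} [CommRing B] [Algebra k B] (z : Fin n → B) :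
    MvPolynomial.aeval z (quadricPoly Q b) =
      ∑ i, ∑ j, halfPolar Q b (b i) (b j) • (z i * z j) := by
  simp only [halfPolar, QuadraticMap.toBilin_apply]
  rw [quadricPoly]
  simp only [map_add, map_sum, map_mul, map_pow, MvPolynomial.aeval_C, MvPolynomial.aeval_X]
  rw [← Finset.sum_add_distrib]
  refine Finset.sum_congr rfl fun i _ => ?_
  rw [← Finset.sum_subset (Finset.subset_univ (Finset.Ici i)), ← Finset.Ioi_insert,
    Finset.sum_insert Finset.notMem_Ioi_self]
  · congr 1
    · simp [Algebra.smul_def, pow_two]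
    · refine Finset.sum_congr rfl fun j hj => ?_
      have hj := Finset.mem_Ioi.1 hj
      simp [hj.ne, hj, Algebra.smul_def, mul_assoc]
  · intro j _ hj
    have hj : j < i := by simpa using hj
    simp [hj.ne', hj.not_gt]

theorem sum_comm_four {ι κ B : Type*} [Fintype ι] [Fintype κ] [AddCommMonoid B]
    (F : ι → ι → κ → κ → B) :
    ∑ s, ∑ t, ∑ i, ∑ j, F s t i j = ∑ i, ∑ j, ∑ s, ∑ t, F s t i j :=
  calc ∑ s, ∑ t, ∑ i, ∑ j, F s t i j = ∑ s, ∑ i, ∑ t, ∑ j, F s t i j :=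
        Finset.sum_congr rfl fun _ _ => Finset.sum_comm
    _ = ∑ i, ∑ s, ∑ t, ∑ j, F s t i j := Finset.sum_comm
    _ = ∑ i, ∑ s, ∑ j, ∑ t, F s t i j :=
        Finset.sum_congr rfl fun _ _ => Finset.sum_congr rfl fun _ _ => Finset.sum_comm
    _ = ∑ i, ∑ j, ∑ s, ∑ t, F s t i j := Finset.sum_congr rfl fun _ _ => Finset.sum_comm

/-- Writing the quadric through a bilinear form makes the change of basis from b to c a formal
expansion, whereas `quadricPoly` itself depends on the ordering of b. -/
theorem aeval_quadricPoly_basis {B : Type*} [CommRing B] [Algebra k B] {ι : Type*} [Fintype ι]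
    (c : Module.Basis ι k V) (g : ι → B) :
    MvPolynomial.aeval (fun i => ∑ s, b.coord i (c s) • g s) (quadricPoly Q b) =
      ∑ s, ∑ t, halfPolar Q b (c s) (c t) • (g s * g t) := by
  rw [aeval_quadricPoly]
  have h : ∀ s t, halfPolar Q b (c s) (c t) =
      ∑ i, ∑ j, b.coord i (c s) * (b.coord j (c t) * halfPolar Q b (b i) (b j)) := by
    intro s t
    conv_lhs => rw [← b.sum_repr (c s), ← b.sum_repr (c t)]
    simp only [map_sum, map_smul, LinearMap.sum_apply, LinearMap.smul_apply, smul_eq_mul,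
      Module.Basis.coord_apply]
    rw [Finset.sum_comm]
    refine Finset.sum_congr rfl fun _ _ => ?_
    rw [Finset.mul_sum]
    exact Finset.sum_congr rfl fun _ _ => by ring
  simp only [h, Finset.sum_smul, Finset.sum_mul_sum, Finset.smul_sum]
  rw [sum_comm_four]
  refine Finset.sum_congr rfl fun i _ => Finset.sum_congr rfl fun j _ =>
    Finset.sum_congr rfl fun s _ => Finset.sum_congr rfl fun t _ => ?_
  rw [smul_mul_smul_comm, smul_smul]
  congr 1
  ring

variable {d : ℕ} (c : Module.Basis (Fin (d + 1)) k V)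

/-- The two mixed terms between index 0 and a later index add up to the polar form, so the asymmetry
of `halfPolar` does not affect the linear coefficient. -/
theorem sum_halfPolar_basis {B : Type*} [CommRing B] [Algebra k B] (g : Fin (d + 1) → B) :
    ∑ s, ∑ t, halfPolar Q b (c s) (c t) • (g s * g t) =
      Q (c 0) • g 0 ^ 2 + (∑ j : Fin d, QuadraticMap.polar Q (c 0) (c j.succ) • g j.succ) * g 0 +
        ∑ i : Fin d, ∑ j : Fin d, halfPolar Q b (c i.succ) (c j.succ) •
          (g i.succ * g j.succ) := by
  simp only [Fin.sum_univ_succ, Finset.sum_add_distrib, ← halfPolar_add_halfPolar Q b,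
    halfPolar_self, add_smul, add_mul, Finset.sum_mul]
  simp only [pow_two, smul_mul_assoc, mul_comm (g 0) (g _)]
  abel

/-- The polynomial subring generated by the coordinates which vanish on `c 0`. -/
def coordHom : MvPolynomial (Fin d) k →ₐ[k] QuadricRing Q b :=
  MvPolynomial.aeval fun j => linForm Q b (c.coord j.succ)

/-- The remaining coordinate. -/
def coordZero : QuadricRing Q b := linForm Q b (c.coord 0)

/-- The linear coefficient of the quadric as a polynomial in `coordZero`. -/
def linCoeff : MvPolynomial (Fin d) k :=
  ∑ j : Fin d, QuadraticMap.polar Q (c 0) (c j.succ) • MvPolynomial.X j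

/-- The constant coefficient of the quadric as a polynomial in `coordZero`. -/
def constCoeff : MvPolynomial (Fin d) k :=
  ∑ i : Fin d, ∑ j : Fin d, halfPolar Q b (c i.succ) (c j.succ) •
    (MvPolynomial.X i * MvPolynomial.X j)

theorem coordHom_X (j : Fin d) :
    coordHom Q b c (MvPolynomial.X j) = linForm Q b (c.coord j.succ) :=
  MvPolynomial.aeval_X _ _

theorem quadric_relation :
    Q (c 0) • coordZero Q b c ^ 2 + coordHom Q b c (linCoeff Q c) * coordZero Q b c +
      coordHom Q b c (constCoeff Q b c) = 0 := by
  have h := aeval_quadricPoly_basis Q b c (fun s => linForm Q b (c.coord s))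
  have h1 : (fun i => ∑ s, b.coord i (c s) • linForm Q b (c.coord s)) =
      fun i => toQuadricRing Q b (MvPolynomial.X i) := by
    funext i
    rw [← linForm_eq_sum, linForm_coord]
  rw [h1, sum_halfPolar_basis] at h
  have h2 : MvPolynomial.aeval (fun i => toQuadricRing Q b (MvPolynomial.X i)) (quadricPoly Q b) =
      toQuadricRing Q b (quadricPoly Q b) := by
    conv_rhs => rw [MvPolynomial.aeval_unique (toQuadricRing Q b)]
    rfl
  have h3 : toQuadricRing Q b (quadricPoly Q b) = 0 :=
    Ideal.Quotient.eq_zero_iff_mem.2 (Ideal.mem_span_singleton_self _)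
  rw [h2, h3] at h
  simp only [linCoeff, constCoeff, map_sum, map_smul, map_mul, coordHom_X]
  exact h.symm

end RingStructure

end

end QuadricMCM

namespace QuadricMCM

noncomputable section

/-! ### The coordinate ring is free of rank two over a polynomial subring. -/

section RingStructure

variable {k : Type u} [Field k] {V : Type v} [AddCommGroup V] [Module k V] {n : ℕ}
  (Q : QuadraticForm k V) (b : Module.Basis (Fin n) k V)
  {d : ℕ} (c : Module.Basis (Fin (d + 1)) k V)

/-- The quadric as a polynomial in the coordinate `coordZero`. -/
def quadricPolynomial : Polynomial (MvPolynomial (Fin d) k) :=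
  Polynomial.C (MvPolynomial.C (Q (c 0))) * Polynomial.X ^ 2 +
    Polynomial.C (linCoeff Q c) * Polynomial.X + Polynomial.C (constCoeff Q b c)

/-- The coordinates as polynomials in the zeroth coordinate. -/
def polyCoord (k : Type*) [Field k] (d : ℕ) : Fin (d + 1) → Polynomial (MvPolynomial (Fin d) k) :=
  Fin.cons Polynomial.X fun j => Polynomial.C (MvPolynomial.X j)

theorem aeval_polyCoord_quadricPoly :
    MvPolynomial.aeval (fun i => ∑ s, b.coord i (c s) • polyCoord k d s) (quadricPoly Q b) =
      quadricPolynomial Q b c := by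
  rw [aeval_quadricPoly_basis, sum_halfPolar_basis]
  simp only [polyCoord, Fin.cons_zero, Fin.cons_succ, quadricPolynomial, linCoeff, constCoeff,
    map_sum, Algebra.smul_def, map_mul]
  rfl

/-- The coordinate ring as a quotient of a polynomial ring in one variable. -/
def toPolyQuot : QuadricRing Q b →ₐ[k]
    Polynomial (MvPolynomial (Fin d) k) ⧸ Ideal.span {quadricPolynomial Q b c} :=
  Ideal.Quotient.liftₐ (Ideal.span {quadricPoly Q b})
    ((Ideal.Quotient.mkₐ k (Ideal.span {quadricPolynomial Q b c})).comp
      (MvPolynomial.aeval fun i => ∑ s, b.coord i (c s) • polyCoord k d s)) (by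
    intro a ha
    obtain ⟨a, rfl⟩ := Ideal.mem_span_singleton'.1 ha
    rw [AlgHom.comp_apply]
    refine Ideal.Quotient.eq_zero_iff_mem.2 ?_
    rw [map_mul, aeval_polyCoord_quadricPoly]
    exact Ideal.mul_mem_left _ _ (Ideal.mem_span_singleton_self _))

theorem toPolyQuot_linForm (f : Module.Dual k V) :
    toPolyQuot Q b c (linForm Q b f) = Ideal.Quotient.mkₐ k _ (∑ s, f (c s) • polyCoord k d s) := by
  have h : ∀ i, toPolyQuot Q b c (toQuadricRing Q b (MvPolynomial.X i)) =
      Ideal.Quotient.mkₐ k _ (∑ s, b.coord i (c s) • polyCoord k d s) := fun i =>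
    (Ideal.Quotient.liftₐ_apply _ _ _ _).trans (by
      change (Ideal.Quotient.mkₐ k _) (MvPolynomial.aeval _ (MvPolynomial.X i)) = _
      rw [MvPolynomial.aeval_X])
  rw [linForm_apply, map_sum]
  simp only [map_smul, h]
  simp only [← map_smul]
  rw [← map_sum]
  congr 1
  simp only [Finset.smul_sum, smul_smul]
  rw [Finset.sum_comm]
  refine Finset.sum_congr rfl fun s _ => ?_
  rw [← Finset.sum_smul]
  congr 1
  conv_rhs => rw [← b.sum_repr (c s), map_sum]
  exact Finset.sum_congr rfl fun i _ => by rw [map_smul, smul_eq_mul, mul_comm]; rfl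

theorem toPolyQuot_coordZero :
    toPolyQuot Q b c (coordZero Q b c) = Ideal.Quotient.mk _ Polynomial.X := by
  rw [coordZero, toPolyQuot_linForm, Finset.sum_eq_single 0]
  · simp [polyCoord]
  · intro s _ hs
    simp [Finsupp.single_eq_of_ne hs.symm]
  · simp

theorem toPolyQuot_coordHom (a : MvPolynomial (Fin d) k) :
    toPolyQuot Q b c (coordHom Q b c a) = Ideal.Quotient.mk _ (Polynomial.C a) := by
  have : (toPolyQuot Q b c).comp (coordHom Q b c) =
      (Ideal.Quotient.mkₐ k (Ideal.span {quadricPolynomial Q b c})).comp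
        (Algebra.ofId (MvPolynomial (Fin d) k) (Polynomial (MvPolynomial (Fin d) k))
          |>.restrictScalars k) := by
    apply MvPolynomial.algHom_ext
    intro j
    rw [AlgHom.comp_apply, coordHom_X, toPolyQuot_linForm, Finset.sum_eq_single j.succ]
    · simp [polyCoord]
    · intro s _ hs
      simp [Finsupp.single_eq_of_ne hs.symm]
    · simp
  exact congrArg (fun f => f a) this

theorem quadricPolynomial_natDegree (ha : Q (c 0) ≠ 0) :
    (quadricPolynomial Q b c).natDegree = 2 := by
  refine Polynomial.natDegree_quadratic ?_
  rwa [Ne, MvPolynomial.C_eq_zero]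

/-- As Q (c 0) ≠ 0, the quadric has degree exactly 2 in the zeroth coordinate, and it cannot divide
a nonzero polynomial of degree at most 1. -/
theorem eq_zero_of_coordHom_add (ha : Q (c 0) ≠ 0) {α β : MvPolynomial (Fin d) k}
    (h : coordHom Q b c α + coordHom Q b c β * coordZero Q b c = 0) : α = 0 ∧ β = 0 := by
  have h' := congrArg (toPolyQuot Q b c) h
  rw [map_add, map_mul, toPolyQuot_coordHom, toPolyQuot_coordHom, toPolyQuot_coordZero, map_zero,
    ← map_mul, ← map_add, Ideal.Quotient.eq_zero_iff_mem, Ideal.mem_span_singleton] at h'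
  have h0 : Polynomial.C α + Polynomial.C β * Polynomial.X = 0 := by
    refine Polynomial.eq_zero_of_dvd_of_natDegree_lt h' ?_
    rw [quadricPolynomial_natDegree Q b c ha, add_comm]
    exact Nat.lt_succ_of_le Polynomial.natDegree_linear_le
  constructor
  · have := congrArg (Polynomial.coeff · 0) h0
    simpa using this
  · have := congrArg (Polynomial.coeff · 1) h0
    simpa [Polynomial.coeff_C] using this

theorem coordHom_add_inj (ha : Q (c 0) ≠ 0) {α β α' β' : MvPolynomial (Fin d) k}
    (h : coordHom Q b c α + coordHom Q b c β * coordZero Q b c =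
      coordHom Q b c α' + coordHom Q b c β' * coordZero Q b c) : α = α' ∧ β = β' := by
  have := eq_zero_of_coordHom_add Q b c ha (α := α - α') (β := β - β') (by
    rw [map_sub, map_sub, sub_mul]
    linear_combination h)
  exact ⟨sub_eq_zero.1 this.1, sub_eq_zero.1 this.2⟩

theorem linForm_eq_add (f : Module.Dual k V) :
    linForm Q b f = coordHom Q b c (∑ j : Fin d, f (c j.succ) • MvPolynomial.X j) +
      coordHom Q b c (MvPolynomial.C (f (c 0))) * coordZero Q b c := by
  rw [linForm_eq_sum Q b c, Fin.sum_univ_succ, add_comm, map_sum, MvPolynomial.C_eq_smul_one]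
  congr 1
  · exact Finset.sum_congr rfl fun j _ => by rw [map_smul, coordHom_X]
  · rw [map_smul, map_one, smul_mul_assoc, one_mul]; rfl

/-- The relation is quadratic and hence kills no linear form. This is what lets identities between
matrices over R be read as identities between their values at each v. -/
theorem linForm_injective (ha : Q (c 0) ≠ 0) : Function.Injective (linForm Q b) := by
  rw [injective_iff_map_eq_zero]
  intro f hf
  rw [linForm_eq_add Q b c] at hf
  obtain ⟨h1, h2⟩ := eq_zero_of_coordHom_add Q b c ha hf
  refine c.ext fun s => ?_
  rw [LinearMap.zero_apply]
  refine Fin.cases ?_ (fun j => ?_) s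
  · simpa using h2
  · have := congrArg (MvPolynomial.coeff (Finsupp.single j 1)) h1
    simpa [MvPolynomial.coeff_sum, MvPolynomial.coeff_X, Finsupp.single_left_inj] using this

theorem linCoeff_mem : linCoeff Q c ∈ polyGr k (Fin d) 1 :=
  Submodule.sum_mem _ fun j _ => Submodule.smul_mem _ _ (X_mem_polyGr j)

theorem constCoeff_mem : constCoeff Q b c ∈ polyGr k (Fin d) 2 :=
  Submodule.sum_mem _ fun i _ => Submodule.sum_mem _ fun j _ => Submodule.smul_mem _ _
    (polyGr_mul (X_mem_polyGr i) (X_mem_polyGr j))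

theorem coordZero_sq (ha : Q (c 0) ≠ 0) :
    coordZero Q b c ^ 2 = -(coordHom Q b c ((Q (c 0))⁻¹ • constCoeff Q b c) +
      coordHom Q b c ((Q (c 0))⁻¹ • linCoeff Q c) * coordZero Q b c) := by
  have h := quadric_relation Q b c
  have h2 := congrArg ((Q (c 0))⁻¹ • ·) h
  simp only [smul_add, smul_smul, inv_mul_cancel₀ ha, one_smul, smul_zero] at h2
  rw [map_smul, map_smul, smul_mul_assoc]
  linear_combination h2

theorem coordHom_mem {e : ℤ} {α : MvPolynomial (Fin d) k} (hα : α ∈ polyGr k (Fin d) e) :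
    coordHom Q b c α ∈ ringGr Q b e := by
  rcases lt_or_ge e 0 with he | he
  · rw [polyGr_of_neg he hα, map_zero]; exact Submodule.zero_mem _
  lift e to ℕ using he
  rw [mem_ringGr_natCast]
  let g : Fin d → MvPolynomial (Fin n) k := fun j => ∑ i, c.coord j.succ (b i) • MvPolynomial.X i
  have hg : ∀ j, (g j).IsHomogeneous 1 := fun j =>
    Submodule.sum_mem (MvPolynomial.homogeneousSubmodule (Fin n) k 1) fun i _ =>
      Submodule.smul_mem _ _ (MvPolynomial.isHomogeneous_X k i)
  refine ⟨MvPolynomial.aeval g α, ?_, ?_⟩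
  · have := (mem_polyGr_natCast.1 hα).aeval g hg
    rwa [one_mul] at this
  · have : (toQuadricRing Q b).comp (MvPolynomial.aeval g) = coordHom Q b c := by
      apply MvPolynomial.algHom_ext
      intro j
      rw [AlgHom.comp_apply, MvPolynomial.aeval_X, coordHom_X, map_sum, linForm_apply]
      simp only [map_smul]
    exact congrArg (fun f => f α) this

/-- Multiply by one linear form at a time and eliminate the square of the zeroth coordinate. Keeping
track of degrees gives the decomposition of each graded piece, with the second coefficient one
degree lower. -/
theorem exists_eq_of_mem_ringGr (ha : Q (c 0) ≠ 0) {e : ℤ} {r : QuadricRing Q b}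
    (hr : r ∈ ringGr Q b e) : ∃ α ∈ polyGr k (Fin d) e, ∃ β ∈ polyGr k (Fin d) (e - 1),
      r = coordHom Q b c α + coordHom Q b c β * coordZero Q b c := by
  rcases lt_or_ge e 0 with he | he
  · exact ⟨0, Submodule.zero_mem _, 0, Submodule.zero_mem _, by
      rw [ringGr_of_neg Q b he hr]; simp⟩
  lift e to ℕ using he
  obtain ⟨p, hp, rfl⟩ := (mem_ringGr_natCast Q b).1 hr
  clear hr
  change p ∈ MvPolynomial.homogeneousSubmodule (Fin n) k e at hp
  rw [← MvPolynomial.homogeneousSubmodule_one_pow] at hp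
  induction e generalizing p with
  | zero =>
    rw [pow_zero, Submodule.mem_one] at hp
    obtain ⟨t, rfl⟩ := hp
    exact ⟨MvPolynomial.C t, C_mem_polyGr t, 0, Submodule.zero_mem _, by
      rw [map_zero, zero_mul, add_zero, AlgHom.commutes]
      exact ((coordHom Q b c).commutes t).symm⟩
  | succ e ih =>
    rw [pow_succ] at hp
    induction hp using Submodule.mul_induction_on' with
    | mem_mul_mem p hp l hl =>
      obtain ⟨α, hα, β, hβ, h⟩ := ih p hp
      obtain ⟨f, hf⟩ : ∃ f, toQuadricRing Q b l = linForm Q b f := by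
        rw [MvPolynomial.homogeneousSubmodule_one_eq_span_X] at hl
        induction hl using Submodule.span_induction with
        | mem x hx =>
          obtain ⟨i, rfl⟩ := hx
          exact ⟨_, (linForm_coord Q b i).symm⟩
        | zero => exact ⟨0, by simp⟩
        | add x y _ _ hx hy =>
          obtain ⟨f, hf⟩ := hx
          obtain ⟨g, hg⟩ := hy
          exact ⟨f + g, by rw [map_add, map_add, hf, hg]⟩
        | smul t x _ hx =>
          obtain ⟨f, hf⟩ := hx
          exact ⟨t • f, by rw [map_smul, map_smul, hf]⟩
      set lam := ∑ j : Fin d, f (c j.succ) • (MvPolynomial.X j : MvPolynomial (Fin d) k) with hlam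
      have hlam' : lam ∈ polyGr k (Fin d) 1 :=
        Submodule.sum_mem _ fun j _ => Submodule.smul_mem _ _ (X_mem_polyGr j)
      set C0 : MvPolynomial (Fin d) k := MvPolynomial.C (f (c 0))
      have hC : C0 ∈ polyGr k (Fin d) 0 := C_mem_polyGr _
      -- These are the coefficients of (α + βx)(lam + C0·x) after substituting `coordZero_sq` for
      -- x².
      refine ⟨α * lam - C0 * (β * ((Q (c 0))⁻¹ • constCoeff Q b c)), ?_,
        C0 * α + β * lam - C0 * (β * ((Q (c 0))⁻¹ • linCoeff Q c)), ?_, ?_⟩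
      · refine Submodule.sub_mem _ ?_ ?_
        · have := polyGr_mul hα hlam'
          exact_mod_cast this
        · have := polyGr_mul hC (polyGr_mul hβ (Submodule.smul_mem _ ((Q (c 0))⁻¹)
            (constCoeff_mem Q b c)))
          convert this using 2
          push_cast; ring
      · refine Submodule.sub_mem _ (Submodule.add_mem _ ?_ ?_) ?_
        · have := polyGr_mul hC hα
          convert this using 2
          push_cast; ring
        · have := polyGr_mul hβ hlam'
          convert this using 2
          push_cast; ring
        · have := polyGr_mul hC (polyGr_mul hβ (Submodule.smul_mem _ ((Q (c 0))⁻¹)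
            (linCoeff_mem Q c)))
          convert this using 2
          push_cast; ring
      · rw [map_mul, h, hf, linForm_eq_add Q b c f]
        simp only [map_sub, map_add, map_mul]
        linear_combination (coordHom Q b c C0 * coordHom Q b c β) * coordZero_sq Q b c ha
    | add x _ y _ hx hy =>
      obtain ⟨α, hα, β, hβ, h⟩ := hx
      obtain ⟨α', hα', β', hβ', h'⟩ := hy
      refine ⟨α + α', Submodule.add_mem _ hα hα', β + β', Submodule.add_mem _ hβ hβ', ?_⟩
      rw [map_add, h, h', map_add, map_add]; ring

theorem mem_ringGr_iff (ha : Q (c 0) ≠ 0) {e : ℤ} {α β : MvPolynomial (Fin d) k} :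
    coordHom Q b c α + coordHom Q b c β * coordZero Q b c ∈ ringGr Q b e ↔
      α ∈ polyGr k (Fin d) e ∧ β ∈ polyGr k (Fin d) (e - 1) := by
  constructor
  · intro h
    obtain ⟨α', hα', β', hβ', h'⟩ := exists_eq_of_mem_ringGr Q b c ha h
    obtain ⟨rfl, rfl⟩ := coordHom_add_inj Q b c ha h'
    exact ⟨hα', hβ'⟩
  · rintro ⟨hα, hβ⟩
    refine Submodule.add_mem _ (coordHom_mem Q b c hα) ?_
    have := ringGr_mul Q b (coordHom_mem Q b c hβ) (linForm_mem Q b (c.coord 0))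
    rwa [sub_add_cancel] at this

theorem exists_sum_ringGr (r : QuadricRing Q b) :
    ∃ (N : ℕ) (s : ℕ → QuadricRing Q b), (∀ e : ℕ, s e ∈ ringGr Q b e) ∧
      r = ∑ e ∈ Finset.range N, s e := by
  obtain ⟨p, rfl⟩ := toQuadricRing_surjective Q b r
  refine ⟨p.totalDegree + 1, fun e => toQuadricRing Q b (MvPolynomial.homogeneousComponent e p),
    fun e => (mem_ringGr_natCast Q b).2 ⟨_, MvPolynomial.homogeneousComponent_isHomogeneous _ _, rfl⟩,
    ?_⟩
  rw [← map_sum, MvPolynomial.sum_homogeneousComponent]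

theorem exists_eq_coordHom_add (ha : Q (c 0) ≠ 0) (r : QuadricRing Q b) :
    ∃ α β, r = coordHom Q b c α + coordHom Q b c β * coordZero Q b c := by
  obtain ⟨N, s, hs, rfl⟩ := exists_sum_ringGr Q b r
  choose α _ β _ h using fun e : ℕ => exists_eq_of_mem_ringGr Q b c ha (hs e)
  refine ⟨∑ e ∈ Finset.range N, α e, ∑ e ∈ Finset.range N, β e, ?_⟩
  rw [map_sum, map_sum, Finset.sum_mul, ← Finset.sum_add_distrib]
  exact Finset.sum_congr rfl fun e _ => h e

/-- Evaluation at the vertex of the cone. -/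
def vertexEval : QuadricRing Q b →ₐ[k] k :=
  Ideal.Quotient.liftₐ (Ideal.span {quadricPoly Q b}) (MvPolynomial.aeval 0) (by
    intro a ha
    obtain ⟨a, rfl⟩ := Ideal.mem_span_singleton'.1 ha
    rw [map_mul, aeval_quadricPoly]
    simp)

theorem vertexEval_X (i : Fin n) : vertexEval Q b (toQuadricRing Q b (MvPolynomial.X i)) = 0 :=
  (Ideal.Quotient.liftₐ_apply _ _ _ _).trans (MvPolynomial.aeval_X _ _)

theorem vertexEval_linForm (f : Module.Dual k V) : vertexEval Q b (linForm Q b f) = 0 := by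
  simp [linForm_apply, vertexEval_X]

theorem vertexEval_coordHom (α : MvPolynomial (Fin d) k) :
    vertexEval Q b (coordHom Q b c α) = MvPolynomial.constantCoeff α := by
  have : (vertexEval Q b).comp (coordHom Q b c) = MvPolynomial.aeval 0 := by
    apply MvPolynomial.algHom_ext
    intro j
    rw [AlgHom.comp_apply, coordHom_X, vertexEval_linForm, MvPolynomial.aeval_X]; rfl
  have h := congrArg (fun f => f α) this
  refine h.trans ?_
  simp [MvPolynomial.aeval_zero]

theorem sub_vertexEval_mem (r : QuadricRing Q b) :
    r - algebraMap k _ (vertexEval Q b r) ∈ irrelevant Q b := by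
  obtain ⟨p, rfl⟩ := toQuadricRing_surjective Q b r
  induction p using MvPolynomial.induction_on with
  | C a =>
    have : toQuadricRing Q b (MvPolynomial.C a) = algebraMap k _ a := rfl
    rw [this, AlgHom.commutes]
    simp
  | add p q hp hq =>
    have := Ideal.add_mem _ hp hq
    convert this using 1
    simp only [map_add]; ring
  | mul_X p i _ =>
    rw [map_mul, map_mul, vertexEval_X, mul_zero, map_zero, sub_zero]
    exact Ideal.mul_mem_left _ _ (Ideal.subset_span ⟨i, rfl⟩)

theorem mem_irrelevant {r : QuadricRing Q b} : r ∈ irrelevant Q b ↔ vertexEval Q b r = 0 := by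
  constructor
  · intro h
    have : irrelevant Q b ≤ RingHom.ker (vertexEval Q b) := by
      rw [irrelevant, Ideal.span_le]
      rintro _ ⟨i, rfl⟩
      exact vertexEval_X Q b i
    exact this h
  · intro h
    have := sub_vertexEval_mem Q b r
    rwa [h, map_zero, sub_zero] at this

theorem linForm_mem_irrelevant (f : Module.Dual k V) : linForm Q b f ∈ irrelevant Q b :=
  (mem_irrelevant Q b).2 (vertexEval_linForm Q b f)

instance : (irrelevant Q b).IsMaximal := by
  have : irrelevant Q b = RingHom.ker (vertexEval Q b) := by
    ext r; exact mem_irrelevant Q b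
  rw [this]
  exact RingHom.ker_isMaximal_of_surjective _ fun t => ⟨algebraMap k _ t, AlgHom.commutes _ t⟩

instance : IsNoetherianRing (QuadricRing Q b) :=
  inferInstanceAs (IsNoetherianRing (MvPolynomial (Fin n) k ⧸ Ideal.span {quadricPoly Q b}))

/-- The coordinates which vanish on `c 0`, as elements of the coordinate ring. -/
def coordList : List (QuadricRing Q b) :=
  varList (coordHom Q b c : MvPolynomial (Fin d) k →+* QuadricRing Q b)

/-- The equation expresses the square of the zeroth coordinate through the others, so the other d
coordinates are parameters at the vertex. -/
theorem irrelevant_le_radical (ha : Q (c 0) ≠ 0) :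
    irrelevant Q b ≤ (Ideal.ofList (coordList Q b c)).radical := by
  have hX : ∀ α, MvPolynomial.constantCoeff α = 0 →
      coordHom Q b c α ∈ Ideal.ofList (coordList Q b c) := by
    intro α hα
    have := map_sub_constantCoeff_mem (coordHom Q b c : MvPolynomial (Fin d) k →+* QuadricRing Q b) α
    rwa [hα, map_zero, map_zero, sub_zero] at this
  have h0 : coordZero Q b c ∈ (Ideal.ofList (coordList Q b c)).radical := by
    refine ⟨2, ?_⟩
    rw [coordZero_sq Q b c ha]
    refine neg_mem (Ideal.add_mem _ (hX _ ?_) (Ideal.mul_mem_right _ _ (hX _ ?_)))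
    · exact constantCoeff_of_mem_polyGr two_ne_zero
        (Submodule.smul_mem _ _ (constCoeff_mem Q b c))
    · exact constantCoeff_of_mem_polyGr one_ne_zero
        (Submodule.smul_mem _ _ (linCoeff_mem Q c))
  rw [irrelevant, Ideal.span_le]
  rintro _ ⟨i, rfl⟩
  change toQuadricRing Q b (MvPolynomial.X i) ∈ Ideal.radical _
  rw [← linForm_coord, linForm_eq_add Q b c]
  refine Ideal.add_mem _ (Ideal.le_radical (hX _ ?_)) (Ideal.mul_mem_left _ _ h0)
  exact constantCoeff_of_mem_polyGr one_ne_zero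
    (Submodule.sum_mem _ fun j _ => Submodule.smul_mem _ _ (X_mem_polyGr j))

end RingStructure

end

end QuadricMCM

namespace QuadricMCM

noncomputable section

/-! ### Free modules over the polynomial subring: regular sequences and gradings. -/

section CoordBasis

open RingTheory.Sequence

variable {k : Type*} [Field k] {d : ℕ} {R : Type*} [CommRing R]
  {θ : MvPolynomial (Fin d) k →+* R} {E : Type*} [AddCommGroup E] [Module R E]
  {ι : Type*} [Fintype ι] {w : ι → E}

theorem exists_mem_span_X_of_mem_smul_top
    (hw : Function.Surjective fun a : ι → MvPolynomial (Fin d) k => ∑ j, θ (a j) • w j) {i : ℕ}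
    {z : E} (hz : z ∈ Ideal.ofList ((varList θ).take i) • (⊤ : Submodule R E)) :
    ∃ a : ι → MvPolynomial (Fin d) k, (∀ j, a j ∈ Ideal.span
      (MvPolynomial.X '' {l : Fin d | (l : ℕ) < i} : Set (MvPolynomial (Fin d) k))) ∧
        z = ∑ j, θ (a j) • w j := by
  have hlen : (varList θ).length = d := by simp [varList]
  induction hz using Submodule.smul_induction_on' with
  | smul r hr e _ =>
    induction hr using Submodule.span_induction generalizing e with
    | mem x hx =>
      change x ∈ List.take i _ at hx
      rw [List.mem_take_iff_getElem] at hx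
      obtain ⟨l, hl, rfl⟩ := hx
      rw [hlen, lt_min_iff] at hl
      obtain ⟨a, rfl⟩ := hw e
      refine ⟨fun j => MvPolynomial.X ⟨l, hl.2⟩ * a j, fun j => Ideal.mul_mem_right _ _
        (Ideal.subset_span ⟨_, hl.1, rfl⟩), ?_⟩
      simp [varList, Finset.smul_sum, mul_smul]
    | zero => exact ⟨0, fun _ => Ideal.zero_mem _, by simp⟩
    | add x y _ _ hx hy =>
      obtain ⟨a, ha, h⟩ := hx e trivial
      obtain ⟨a', ha', h'⟩ := hy e trivial
      exact ⟨a + a', fun j => Ideal.add_mem _ (ha j) (ha' j), by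
        simp [add_smul, h, h', Finset.sum_add_distrib]⟩
    | smul t x _ hx =>
      obtain ⟨a, ha, h⟩ := hx (t • e) trivial
      exact ⟨a, ha, by rw [← h, smul_eq_mul, mul_comm, mul_smul]⟩
  | add x _ y _ hx hy =>
    obtain ⟨a, ha, h⟩ := hx
    obtain ⟨a', ha', h'⟩ := hy
    exact ⟨a + a', fun j => Ideal.add_mem _ (ha j) (ha' j), by
      simp [add_smul, h, h', Finset.sum_add_distrib]⟩

theorem constantCoeff_eq_zero_of_mem_smul_top
    (hw : Function.Bijective fun a : ι → MvPolynomial (Fin d) k => ∑ j, θ (a j) • w j)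
    {a : ι → MvPolynomial (Fin d) k}
    (ha : ∑ j, θ (a j) • w j ∈ Ideal.ofList (varList θ) • (⊤ : Submodule R E)) (j : ι) :
    MvPolynomial.constantCoeff (a j) = 0 := by
  have hlen : (varList θ).length = d := by simp [varList]
  rw [← List.take_of_length_le hlen.le] at ha
  obtain ⟨a', ha', h⟩ := exists_mem_span_X_of_mem_smul_top hw.2 ha
  rw [hw.1 h]
  by_contra hne
  obtain ⟨i, -, hi⟩ := (MvPolynomial.mem_ideal_span_X_image.1 (ha' j)) 0
    (MvPolynomial.mem_support_iff.2 hne)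
  exact hi rfl

/-- In terms of unique coordinates this is the statement that X_i · a in the ideal of the first i
variables forces a into that ideal, visible on monomials. -/
theorem isWeaklyRegular_varList
    (hw : Function.Bijective fun a : ι → MvPolynomial (Fin d) k => ∑ j, θ (a j) • w j) :
    IsWeaklyRegular E (varList θ) := by
  have hlen : (varList θ).length = d := by simp [varList]
  refine ⟨fun i hi => ?_⟩
  rw [isSMulRegular_quotient_iff_mem_of_smul_mem]
  intro z hz
  obtain ⟨a, rfl⟩ := hw.2 z
  obtain ⟨a', ha', h⟩ := exists_mem_span_X_of_mem_smul_top hw.2 hz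
  have hx : (varList θ)[i] = θ (MvPolynomial.X ⟨i, by omega⟩) := by simp [varList]
  have h1 : (fun j => MvPolynomial.X ⟨i, by omega⟩ * a j) = a' := by
    apply hw.1
    rw [hx] at h
    simp only [← h, Finset.smul_sum, map_mul, mul_smul]
  refine Submodule.sum_mem _ fun j _ => Submodule.smul_mem_smul ?_ trivial
  have haj : a j ∈ Ideal.span (MvPolynomial.X '' {l : Fin d | (l : ℕ) < i} :
      Set (MvPolynomial (Fin d) k)) := by
    rw [MvPolynomial.mem_ideal_span_X_image]
    intro m hm
    have h2 := ha' j
    rw [← h1, MvPolynomial.mem_ideal_span_X_image] at h2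
    obtain ⟨l, hl, hml⟩ := h2 (m + Finsupp.single ⟨i, by omega⟩ 1) (by
      rw [MvPolynomial.mem_support_iff, add_comm, MvPolynomial.coeff_X_mul]
      exact MvPolynomial.mem_support_iff.1 hm)
    refine ⟨l, hl, ?_⟩
    have hne : (⟨i, by omega⟩ : Fin d) ≠ l := fun h => by
      have : i = l := congrArg Fin.val h
      have : (l : ℕ) < i := hl
      omega
    simpa [Finsupp.single_eq_of_ne' hne] using hml
  have hle : Ideal.span (MvPolynomial.X '' {l : Fin d | (l : ℕ) < i} :
      Set (MvPolynomial (Fin d) k)) ≤ (Ideal.ofList ((varList θ).take i)).comap θ := by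
    rw [Ideal.span_le]
    rintro _ ⟨l, hl, rfl⟩
    refine Ideal.subset_span ?_
    change _ ∈ List.take i _
    rw [List.mem_take_iff_getElem]
    exact ⟨l, by rw [hlen]; exact lt_min hl l.2, by simp [varList]⟩
  exact hle haj

theorem isRegular_varList [Nonempty ι]
    (hw : Function.Bijective fun a : ι → MvPolynomial (Fin d) k => ∑ j, θ (a j) • w j) :
    IsRegular E (varList θ) := by
  refine ⟨isWeaklyRegular_varList hw, fun h => ?_⟩
  have := constantCoeff_eq_zero_of_mem_smul_top hw (a := 1) (by rw [← h]; trivial)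
    (Classical.arbitrary ι)
  simp at this

end CoordBasis

section Internal

theorem isInternal_of_components {M : Type*} [AddCommGroup M] (gr : ℤ → AddSubgroup M)
    (p : ℤ → M →+ M) (hp : ∀ e, ∀ m ∈ gr e, p e m = m)
    (hp' : ∀ e f, e ≠ f → ∀ m ∈ gr f, p e m = 0) (hs : ⨆ e, gr e = ⊤) :
    DirectSum.IsInternal gr := by
  have h : ∀ e, (p e).comp (DirectSum.coeAddMonoidHom gr) =
      (gr e).subtype.comp (DFinsupp.evalAddMonoidHom e) := by
    intro e
    refine DirectSum.addHom_ext fun f m => ?_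
    rw [AddMonoidHom.comp_apply, DirectSum.coeAddMonoidHom_of, AddMonoidHom.comp_apply]
    by_cases hef : e = f
    · subst hef
      rw [hp e m m.2]
      exact (congrArg Subtype.val (DirectSum.of_eq_same (β := fun e => gr e) e m)).symm
    · rw [hp' e f hef m m.2]
      exact (congrArg Subtype.val (DirectSum.of_eq_of_ne (β := fun e => gr e) f e m hef)).symm
  constructor
  · rw [injective_iff_map_eq_zero]
    intro x hx
    ext e
    have := congrArg (fun g => g x) (h e)
    simp only [AddMonoidHom.comp_apply, hx, map_zero] at this
    exact this.symm
  · intro m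
    have hle : ⨆ e, gr e ≤ (DirectSum.coeAddMonoidHom gr).range :=
      iSup_le fun e m hm => ⟨DirectSum.of (fun e => gr e) e ⟨m, hm⟩,
        DirectSum.coeAddMonoidHom_of _ _ _⟩
    exact hle (hs ▸ AddSubgroup.mem_top m)

/-- A grading can be checked coordinatewise in a basis over the polynomial ring; both the modules
built from matrices and the syzygy modules obtain their gradings this way. -/
theorem isInternal_of_polyGr {k : Type*} [Field k] {d : ℕ} {ι : Type*} [Fintype ι] {M : Type*}
    [AddCommGroup M] (gr : ℤ → AddSubgroup M) (φ : (ι → MvPolynomial (Fin d) k) →+ M)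
    (hφ : Function.Bijective φ) (hgr : ∀ e a, φ a ∈ gr e ↔ ∀ j, a j ∈ polyGr k (Fin d) e) :
    DirectSum.IsInternal gr := by
  let ψ := AddEquiv.ofBijective φ hφ
  let p : ℤ → M →+ M := fun e => φ.comp ((AddMonoidHom.pi fun j =>
    (polyComp e).toAddMonoidHom.comp (Pi.evalAddMonoidHom _ j)).comp ψ.symm.toAddMonoidHom)
  have hpφ : ∀ e a, p e (φ a) = φ fun j => polyComp e (a j) := by
    intro e a
    have : ψ.symm (φ a) = a := ψ.symm_apply_apply a
    simp only [p, AddMonoidHom.comp_apply]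
    erw [this]
    rfl
  refine isInternal_of_components gr p ?_ ?_ ?_
  · intro e m hm
    obtain ⟨a, rfl⟩ := hφ.2 m
    rw [hpφ]
    congr 1
    funext j
    exact polyComp_of_mem ((hgr e a).1 hm j)
  · intro e f hef m hm
    obtain ⟨a, rfl⟩ := hφ.2 m
    rw [hpφ, ← map_zero φ]
    congr 1
    funext j
    exact polyComp_of_mem_ne hef ((hgr f a).1 hm j)
  · rw [eq_top_iff]
    intro m _
    obtain ⟨a, rfl⟩ := hφ.2 m
    have ha : a = ∑ e ∈ Finset.range (∑ j, (a j).totalDegree + 1),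
        fun j => polyComp (e : ℤ) (a j) := by
      funext j
      rw [Finset.sum_apply, sum_polyComp]
      exact Nat.lt_succ_of_le (Finset.single_le_sum (f := fun j => (a j).totalDegree)
        (fun _ _ => Nat.zero_le _) (Finset.mem_univ j))
    rw [ha, map_sum]
    exact sum_mem fun e _ => AddSubgroup.mem_iSup_of_mem (e : ℤ)
      ((hgr _ _).2 fun j => polyComp_mem _ _)

end Internal

/-! ### The Krull dimension of the quadric. -/

section Dimension

variable {k : Type u} [Field k] {V : Type v} [AddCommGroup V] [Module k V] {n : ℕ}
  {Q : QuadraticForm k V} {b : Module.Basis (Fin n) k V}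
  {d : ℕ} {c : Module.Basis (Fin (d + 1)) k V}

theorem bijective_coordHom (ha : Q (c 0) ≠ 0) :
    Function.Bijective fun a : Fin 2 → MvPolynomial (Fin d) k =>
      ∑ j, (coordHom Q b c : MvPolynomial (Fin d) k →+* QuadricRing Q b) (a j) •
        (![1, coordZero Q b c] : Fin 2 → QuadricRing Q b) j := by
  have h : ∀ a : Fin 2 → MvPolynomial (Fin d) k,
      ∑ j, (coordHom Q b c : MvPolynomial (Fin d) k →+* QuadricRing Q b) (a j) •
        (![1, coordZero Q b c] : Fin 2 → QuadricRing Q b) j =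
      coordHom Q b c (a 0) + coordHom Q b c (a 1) * coordZero Q b c := by
    intro a; simp [Fin.sum_univ_two]
  simp only [h]
  constructor
  · intro a a' haa
    obtain ⟨h0, h1⟩ := coordHom_add_inj Q b c ha haa
    funext j
    fin_cases j
    · exact h0
    · exact h1
  · intro r
    obtain ⟨α, β, rfl⟩ := exists_eq_coordHom_add Q b c ha r
    exact ⟨![α, β], rfl⟩

/-- Modulo the other coordinates the ring becomes k[x]/(x²), where x ≠ 0. Multiplication by x
distinguishes R from a module with a frame, on which x becomes zero. -/
theorem coordZero_notMem (ha : Q (c 0) ≠ 0) :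
    coordZero Q b c ∉ Ideal.ofList (coordList Q b c) := by
  intro h
  have := constantCoeff_eq_zero_of_mem_smul_top (bijective_coordHom (b := b) ha) (a := ![0, 1])
    (by simpa [Fin.sum_univ_two] using! h) 1
  simp at this

/-- Upper bound: a nonzero equation in d + 1 variables. Lower bound: the d coordinates vanishing on
c 0 form a regular sequence, because R has the basis 1, x over them. -/
theorem ringKrullDim_quadricRing (ha : Q (c 0) ≠ 0) : ringKrullDim (QuadricRing Q b) = d := by
  apply le_antisymm
  · have hne : quadricPoly Q b ≠ 0 := by
      intro h
      have h1 := aeval_polyCoord_quadricPoly Q b c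
      have h2 := quadricPolynomial_natDegree Q b c ha
      rw [h, map_zero] at h1
      rw [← h1] at h2
      simp at h2
    have h1 := ringKrullDim_quotient_succ_le_of_nonZeroDivisor (mem_nonZeroDivisors_of_ne_zero hne)
    have hn : n = d + 1 := by simpa using Fintype.card_congr (b.indexEquiv c)
    rw [MvPolynomial.ringKrullDim_of_isNoetherianRing, ringKrullDim_eq_zero_of_field, zero_add,
      Nat.card_fin] at h1
    have h2 : ringKrullDim (QuadricRing Q b) + 1 ≤ (d : WithBot ℕ∞) + 1 :=
      h1.trans (le_of_eq (by exact_mod_cast hn))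
    generalize ringKrullDim (QuadricRing Q b) = x at h2 ⊢
    induction x with
    | bot => exact bot_le
    | coe x =>
      have h3 : x + 1 ≤ (d : ℕ∞) + 1 := by exact_mod_cast h2
      exact_mod_cast (ENat.add_le_add_iff_right ENat.one_ne_top).1 h3
  · have := length_le_supportDim_of_isRegular _ (isRegular_varList (bijective_coordHom (b := b) ha))
    rw [Module.supportDim_self_eq_ringKrullDim] at this
    simpa [varList] using this

end Dimension

end

end QuadricMCM

/-! ### Frames: modules over the quadric as matrices of linear forms. -/

namespace QuadricMCM

noncomputable section

variable {k : Type u} [Field k] {V : Type v} [AddCommGroup V] [Module k V] {n : ℕ}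
  {Q : QuadraticForm k V} {b : Module.Basis (Fin n) k V}
  {d : ℕ} {c : Module.Basis (Fin (d + 1)) k V}

instance (M : GrMod Q b) : Module k M.carrier :=
  Module.compHom M.carrier (algebraMap k (QuadricRing Q b))

instance (M : GrMod Q b) : IsScalarTower k (QuadricRing Q b) M.carrier :=
  IsScalarTower.of_algebraMap_smul fun _ _ => rfl

theorem GrMod.smul_mem_gr (M : GrMod Q b) {e : ℤ} (t : k) {m : M.carrier} (hm : m ∈ M.gr e) :
    t • m ∈ M.gr e := by
  have := M.smul_mem 0 e _ m (algebraMap_mem_ringGr Q b t) hm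
  rwa [zero_add] at this

/-- The entries of a family of matrices depending linearly on a vector. -/
def matEntry {r : ℕ} (D : V →ₗ[k] Matrix (Fin r) (Fin r) k) (i j : Fin r) : Module.Dual k V :=
  (Matrix.entryLinearMap k k i j).comp D

theorem matEntry_apply {r : ℕ} (D : V →ₗ[k] Matrix (Fin r) (Fin r) k) (i j : Fin r) (v : V) :
    matEntry D i j v = D v i j := rfl

variable (Q b) in
/-- The matrix of linear forms attached to a family of matrices depending linearly on a vector. -/
def linMat {r : ℕ} (D : V →ₗ[k] Matrix (Fin r) (Fin r) k) :
    Matrix (Fin r) (Fin r) (QuadricRing Q b) :=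
  Matrix.of fun i j => linForm Q b (matEntry D i j)

theorem linMat_apply {r : ℕ} (D : V →ₗ[k] Matrix (Fin r) (Fin r) k) (i j : Fin r) :
    linMat Q b D i j = linForm Q b (matEntry D i j) := rfl

/-- A basis in degree zero of a graded module over the polynomial subring of the coordinate ring,
together with the matrix of linear forms which presents the module. -/
structure NormalFrame (c : Module.Basis (Fin (d + 1)) k V) (M : GrMod Q b) (r : ℕ) where
  w : Fin r → M.carrier
  bijective : Function.Bijective fun a : Fin r → MvPolynomial (Fin d) k =>
    ∑ j, coordHom Q b c (a j) • w j
  sum_mem_iff : ∀ (e : ℤ) (a : Fin r → MvPolynomial (Fin d) k),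
    ∑ j, coordHom Q b c (a j) • w j ∈ M.gr e ↔ ∀ j, a j ∈ polyGr k (Fin d) e
  mat : V →ₗ[k] Matrix (Fin r) (Fin r) k
  mat_zero : mat (c 0) = 1
  rel : ∀ j, ∑ i, linMat Q b mat i j • w i = 0

section LinMat

variable {r : ℕ} {D : V →ₗ[k] Matrix (Fin r) (Fin r) k} (hD : D (c 0) = 1)

/-- The part of a matrix of linear forms not involving the zeroth coordinate. -/
def restMat (c : Module.Basis (Fin (d + 1)) k V) (D : V →ₗ[k] Matrix (Fin r) (Fin r) k)
    (i j : Fin r) : MvPolynomial (Fin d) k :=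
  ∑ s : Fin d, D (c s.succ) i j • MvPolynomial.X s

theorem restMat_mem (i j : Fin r) : restMat c D i j ∈ polyGr k (Fin d) 1 :=
  Submodule.sum_mem _ fun s _ => Submodule.smul_mem _ _ (X_mem_polyGr s)

include hD in
theorem linMat_eq (i j : Fin r) :
    linMat Q b D i j = coordHom Q b c (restMat c D i j) +
      (if i = j then coordZero Q b c else 0) := by
  rw [linMat_apply, linForm_eq_add Q b c]
  congr 1
  rw [matEntry_apply, hD, Matrix.one_apply]
  split_ifs <;> simp

include hD in
theorem sum_linMat_mul (i : Fin r) (a : Fin r → MvPolynomial (Fin d) k) :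
    ∑ j, linMat Q b D i j * coordHom Q b c (a j) =
      coordHom Q b c (∑ j, restMat c D i j * a j) + coordHom Q b c (a i) * coordZero Q b c := by
  simp only [linMat_eq (Q := Q) (b := b) hD, add_mul, Finset.sum_add_distrib, map_sum, map_mul]
  congr 1
  simp [ite_mul, mul_comm]

end LinMat

namespace NormalFrame

variable {M : GrMod Q b} {r : ℕ} (F : NormalFrame c M r)

theorem w_mem (j : Fin r) : F.w j ∈ M.gr 0 := by
  have := (F.sum_mem_iff 0 (Pi.single j 1)).2 fun l => by
    by_cases h : l = j
    · subst h; rw [Pi.single_eq_same]; exact C_mem_polyGr 1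
    · rw [Pi.single_eq_of_ne h]; exact Submodule.zero_mem _
  rwa [Finset.sum_eq_single j (fun l _ h => by simp [Pi.single_eq_of_ne h]) (by simp),
    Pi.single_eq_same, map_one, one_smul] at this

theorem eq_zero_of_sum_eq_zero {a : Fin r → MvPolynomial (Fin d) k}
    (h : ∑ j, coordHom Q b c (a j) • F.w j = 0) (j : Fin r) : a j = 0 :=
  congrFun (F.bijective.1 (a₁ := a) (a₂ := 0) (by simpa using h)) j

theorem surjective : Function.Surjective (Fintype.linearCombination (QuadricRing Q b) F.w) := by
  intro m
  obtain ⟨a, rfl⟩ := F.bijective.2 m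
  exact ⟨fun j => coordHom Q b c (a j), Fintype.linearCombination_apply _ _ _⟩

theorem sum_linMat_mul_smul (β : Fin r → QuadricRing Q b) :
    ∑ i, (∑ j, linMat Q b F.mat i j * β j) • F.w i = 0 := by
  simp only [Finset.sum_smul]
  rw [Finset.sum_comm]
  refine Finset.sum_eq_zero fun j _ => ?_
  have := congrArg (β j • ·) (F.rel j)
  simpa [Finset.smul_sum, smul_smul, mul_comm] using this

/-- The relations between the elements of a frame are generated by the presentation matrix. -/
theorem eq_sum_linMat_mul {f : Fin r → QuadricRing Q b} {α β : Fin r → MvPolynomial (Fin d) k}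
    (hf : ∀ i, f i = coordHom Q b c (α i) + coordHom Q b c (β i) * coordZero Q b c)
    (h : ∑ i, f i • F.w i = 0) (i : Fin r) :
    f i = ∑ j, linMat Q b F.mat i j * coordHom Q b c (β j) := by
  -- Subtracting the combination of columns with coefficients β removes the zeroth coordinate from
  -- the relation, because the matrix is that coordinate times the identity plus terms free of it;
  -- what is left is a relation over the polynomial subring, hence trivial.
  have h1 : ∑ i, coordHom Q b c (α i - ∑ j, restMat c F.mat i j * β j) • F.w i = 0 := by
    have h2 : ∀ i, coordHom Q b c (α i - ∑ j, restMat c F.mat i j * β j) =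
        f i - ∑ j, linMat Q b F.mat i j * coordHom Q b c (β j) := by
      intro i
      rw [hf, sum_linMat_mul F.mat_zero, map_sub]; ring
    simp only [h2, sub_smul, Finset.sum_sub_distrib, h, F.sum_linMat_mul_smul, sub_zero]
  have h3 := F.eq_zero_of_sum_eq_zero h1 i
  rw [hf, sum_linMat_mul F.mat_zero, sub_eq_zero.1 h3]

theorem exists_eq_sum_linMat_mul (ha : Q (c 0) ≠ 0) {f : Fin r → QuadricRing Q b}
    (h : ∑ i, f i • F.w i = 0) : ∃ β : Fin r → MvPolynomial (Fin d) k, ∀ i,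
      f i = ∑ j, linMat Q b F.mat i j * coordHom Q b c (β j) := by
  choose α β hf using fun i => exists_eq_coordHom_add Q b c ha (f i)
  exact ⟨β, F.eq_sum_linMat_mul hf h⟩

theorem bijective' : Function.Bijective fun a : Fin r → MvPolynomial (Fin d) k =>
    ∑ j, (coordHom Q b c : MvPolynomial (Fin d) k →+* QuadricRing Q b) (a j) • F.w j :=
  F.bijective

include F in
theorem finite : Module.Finite (QuadricRing Q b) M.carrier :=
  Module.Finite.of_surjective _ F.surjective

include F in
theorem isMCM (ha : Q (c 0) ≠ 0) : IsMCM M := by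
  have hfin := F.finite
  refine ⟨hfin, ?_⟩
  rcases isEmpty_or_nonempty (Fin r) with hr | hr
  · left
    refine ⟨fun x y => ?_⟩
    obtain ⟨a, rfl⟩ := F.bijective.2 x
    obtain ⟨a', rfl⟩ := F.bijective.2 y
    simp
  · right
    rw [ringKrullDim_quadricRing ha]
    have h : depth (irrelevant Q b) M.carrier = (d : ℕ∞) := by
      apply le_antisymm
      · refine iSup₂_le fun rs hrs => ?_
        have h1 := (length_le_supportDim_of_isRegular rs hrs.2).trans
          (Module.supportDim_le_ringKrullDim _ _)
        rw [ringKrullDim_quadricRing ha] at h1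
        exact_mod_cast h1
      · have h1 := isRegular_varList F.bijective'
        have h2 : ∀ x ∈ coordList Q b c, x ∈ irrelevant Q b := by
          intro x hx
          obtain ⟨i, rfl⟩ := mem_varList.1 hx
          change coordHom Q b c _ ∈ _
          rw [coordHom_X]
          exact linForm_mem_irrelevant Q b _
        have h3 : (coordList Q b c).length = d := by simp [coordList, varList]
        exact le_iSup₂_of_le (coordList Q b c) ⟨h2, h1⟩ (by rw [h3])
    rw [h]
    rfl

include F in
-- The relations of the frame solve for x w_j as a combination of the w_i with linear coefficients
-- in the other coordinates, so x acts as zero modulo those coordinates.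
theorem coordZero_smul_mem (m : M.carrier) :
    coordZero Q b c • m ∈ Ideal.ofList (coordList Q b c) •
      (⊤ : Submodule (QuadricRing Q b) M.carrier) := by
  have hX : ∀ α, MvPolynomial.constantCoeff α = 0 →
      coordHom Q b c α ∈ Ideal.ofList (coordList Q b c) := by
    intro α hα
    have := map_sub_constantCoeff_mem
      (coordHom Q b c : MvPolynomial (Fin d) k →+* QuadricRing Q b) α
    rwa [hα, map_zero, map_zero, sub_zero] at this
  have hw : ∀ j, coordZero Q b c • F.w j ∈ Ideal.ofList (coordList Q b c) •
      (⊤ : Submodule (QuadricRing Q b) M.carrier) := by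
    intro j
    have h := F.rel j
    simp only [linMat_eq (Q := Q) (b := b) F.mat_zero, add_smul, Finset.sum_add_distrib, ite_smul,
      zero_smul, Finset.sum_ite_eq', Finset.mem_univ, if_true] at h
    rw [eq_neg_of_add_eq_zero_right h]
    refine Submodule.neg_mem _ (Submodule.sum_mem _ fun i _ => Submodule.smul_mem_smul (hX _ ?_)
      trivial)
    exact constantCoeff_of_mem_polyGr one_ne_zero (restMat_mem i j)
  obtain ⟨a, rfl⟩ := F.bijective.2 m
  rw [Finset.smul_sum]
  refine Submodule.sum_mem _ fun j _ => ?_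
  rw [smul_comm]
  exact Submodule.smul_mem _ _ (hw j)

include F in
-- A retraction p applied to x · i(1) would put x in the ideal of the other coordinates of R,
-- contrary to `coordZero_notMem`.
theorem noFreeSummand (ha : Q (c 0) ≠ 0) : NoFreeSummand M := by
  rintro ⟨i, p, hpi⟩
  have h1 := F.coordZero_smul_mem (i 1)
  have h2 : p (coordZero Q b c • i 1) ∈ Ideal.ofList (coordList Q b c) •
      (⊤ : Submodule (QuadricRing Q b) (QuadricRing Q b)) := by
    have := Submodule.mem_map_of_mem (f := p) h1
    rw [Submodule.map_smul''] at this
    exact Submodule.smul_mono le_rfl le_top this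
  have h3 : p (i 1) = 1 := congrArg (fun f => f 1) hpi
  rw [map_smul, h3] at h2
  exact coordZero_notMem (b := b) ha (by simpa using h2)

include F in
theorem hasLinearPresentation (ha : Q (c 0) ≠ 0) : HasLinearPresentation M := by
  refine ⟨r, Matrix.mulVecLin (linMat Q b F.mat), Fintype.linearCombination _ F.w, ?_, ?_, ?_,
    F.surjective⟩
  · intro e f hf i
    rw [Matrix.mulVecLin_apply, Matrix.mulVec, dotProduct]
    refine Submodule.sum_mem _ fun j _ => ?_
    rw [add_comm]
    exact ringGr_mul Q b (linForm_mem Q b _) (hf j)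
  · intro e f hf
    rw [Fintype.linearCombination_apply]
    refine AddSubgroup.sum_mem _ fun j _ => ?_
    have := M.smul_mem e 0 _ _ (hf j) (F.w_mem j)
    rwa [add_zero] at this
  · intro f
    constructor
    · intro hf
      rw [Fintype.linearCombination_apply] at hf
      obtain ⟨β, hβ⟩ := F.exists_eq_sum_linMat_mul ha hf
      exact ⟨fun j => coordHom Q b c (β j), funext fun i => (hβ i).symm⟩
    · rintro ⟨β, rfl⟩
      rw [Fintype.linearCombination_apply]
      exact F.sum_linMat_mul_smul β

include F in
theorem isLinearMCM (ha : Q (c 0) ≠ 0) : isLinearMCM Q b M :=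
  ⟨F.isMCM ha, F.noFreeSummand ha, F.hasLinearPresentation ha⟩

end NormalFrame

end

end QuadricMCM

/-! ### Independence of the degree-zero generators over the polynomial subring. -/

namespace QuadricMCM

noncomputable section

variable {k : Type u} [Field k] {V : Type v} [AddCommGroup V] [Module k V] {n : ℕ}
  {Q : QuadraticForm k V} {b : Module.Basis (Fin n) k V}
  {d : ℕ} {c : Module.Basis (Fin (d + 1)) k V}

section Generation

variable {M : GrMod Q b}

/-- The sum of the graded components of degree at least `e`. -/
def grGE (M : GrMod Q b) (e : ℤ) : AddSubgroup M.carrier := ⨆ f : ℤ, ⨆ _ : e ≤ f, M.gr f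

theorem mem_grGE {e f : ℤ} (h : e ≤ f) {m : M.carrier} (hm : m ∈ M.gr f) : m ∈ grGE M e :=
  AddSubgroup.mem_iSup_of_mem f (AddSubgroup.mem_iSup_of_mem h hm)

theorem smul_mem_grGE {e f : ℤ} {s : QuadricRing Q b} (hs : s ∈ ringGr Q b f) {m : M.carrier}
    (hm : m ∈ grGE M e) : s • m ∈ grGE M (f + e) := by
  have : grGE M e ≤ (grGE M (f + e)).comap (DistribSMul.toAddMonoidHom M.carrier s) :=
    iSup₂_le fun i hi m hm => mem_grGE (by omega) (M.smul_mem f i s m hs hm)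
  exact this hm

theorem eq_zero_of_mem_gr_of_mem_iSup {e : ℤ} {m : M.carrier} (hm : m ∈ M.gr e)
    (hm' : m ∈ ⨆ f : ℤ, ⨆ _ : f ≠ e, M.gr f) : m = 0 :=
  (AddSubgroup.disjoint_def.1 (M.isInternal.addSubgroup_iSupIndep e)) hm hm'

theorem eq_zero_of_add_add_eq_zero {x y z : M.carrier} (hx : x ∈ M.gr 0) (hy : y ∈ M.gr 1)
    (hz : z ∈ grGE M 2) (h : x + y + z = 0) : x = 0 ∧ y = 0 := by
  have hz' : ∀ e : ℤ, e < 2 → z ∈ ⨆ f : ℤ, ⨆ _ : f ≠ e, M.gr f := by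
    intro e he
    have : grGE M 2 ≤ ⨆ f : ℤ, ⨆ _ : f ≠ e, M.gr f :=
      iSup₂_le fun f hf => le_iSup₂_of_le f (by omega) le_rfl
    exact this hz
  constructor
  · refine eq_zero_of_mem_gr_of_mem_iSup hx ?_
    rw [add_assoc] at h
    rw [eq_neg_of_add_eq_zero_left h]
    exact neg_mem (add_mem (AddSubgroup.mem_iSup_of_mem 1
      (AddSubgroup.mem_iSup_of_mem one_ne_zero hy)) (hz' 0 (by norm_num)))
  · refine eq_zero_of_mem_gr_of_mem_iSup hy ?_
    rw [add_comm x y, add_assoc] at h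
    rw [eq_neg_of_add_eq_zero_left h]
    exact neg_mem (add_mem (AddSubgroup.mem_iSup_of_mem 0
      (AddSubgroup.mem_iSup_of_mem zero_ne_one hx)) (hz' 1 (by norm_num)))

theorem exists_eq_algebraMap (ha : Q (c 0) ≠ 0) {s : QuadricRing Q b} (hs : s ∈ ringGr Q b 0) :
    ∃ t : k, s = algebraMap k _ t := by
  obtain ⟨α, hα, β, hβ, rfl⟩ := exists_eq_of_mem_ringGr Q b c ha hs
  rw [polyGr_of_neg (by norm_num) hβ, polyGr_zero hα]
  refine ⟨MvPolynomial.constantCoeff α, ?_⟩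
  rw [map_zero, zero_mul, add_zero]
  exact (coordHom Q b c).commutes _

variable {r : ℕ} {w : Fin r → M.carrier} (hw0 : ∀ j, w j ∈ M.gr 0)
  (hgen : Function.Surjective (Fintype.linearCombination (QuadricRing Q b) w))

include hw0 hgen in
theorem exists_eq_sum_add_mem_grGE_one (ha : Q (c 0) ≠ 0) (m : M.carrier) :
    ∃ (t : Fin r → k) (z : M.carrier), z ∈ grGE M 1 ∧ m = ∑ j, t j • w j + z := by
  obtain ⟨f, rfl⟩ := hgen m
  rw [Fintype.linearCombination_apply]
  have h : ∀ j, ∃ (t : k) (z : M.carrier), z ∈ grGE M 1 ∧ f j • w j = t • w j + z := by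
    intro j
    obtain ⟨N, s, hs, hsum⟩ := exists_sum_ringGr Q b (f j)
    obtain ⟨t, ht⟩ := exists_eq_algebraMap (c := c) ha (hs 0)
    have hz : ∀ N : ℕ, ∑ e ∈ Finset.range N, s (e + 1) • w j ∈ grGE M 1 := fun N =>
      AddSubgroup.sum_mem _ fun e _ => mem_grGE (f := (e + 1 : ℕ) + 0) (by push_cast; omega)
        (M.smul_mem _ _ _ _ (hs (e + 1)) (hw0 j))
    rw [hsum, Finset.sum_smul]
    cases N with
    | zero => exact ⟨0, 0, zero_mem _, by simp⟩
    | succ N =>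
      refine ⟨t, _, hz N, ?_⟩
      rw [Finset.sum_range_succ', ht, add_comm, algebraMap_smul]
  choose t z hz h using h
  exact ⟨t, ∑ j, z j, AddSubgroup.sum_mem _ fun j _ => hz j, by
    rw [← Finset.sum_add_distrib]; exact Finset.sum_congr rfl fun j _ => h j⟩

/-- The part of degree one of the submodule generated by the coordinates vanishing on `c 0`. -/
def coordSpan (c : Module.Basis (Fin (d + 1)) k V) (w : Fin r → M.carrier) :
    Submodule k M.carrier :=
  Submodule.span k (Set.range fun x : Fin d × Fin r =>
    coordHom Q b c (MvPolynomial.X x.1) • w x.2)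

include hw0 in
theorem coordSpan_le_gr {u : M.carrier} (hu : u ∈ coordSpan c w) : u ∈ M.gr 1 := by
  induction hu using Submodule.span_induction with
  | mem x hx =>
    obtain ⟨⟨i, j⟩, rfl⟩ := hx
    exact M.smul_mem 1 0 _ _ (coordHom_mem Q b c (X_mem_polyGr i)) (hw0 j)
  | zero => exact zero_mem _
  | add x y _ _ hx hy => exact add_mem hx hy
  | smul t x _ hx => exact M.smul_mem_gr t hx

include hw0 hgen in
-- As M is generated in degree 0, a coordinate multiplies every element into a combination of its
-- multiples of the generators plus terms of degree at least 2.
theorem exists_eq_add_of_mem_smul_top (ha : Q (c 0) ≠ 0) {m : M.carrier}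
    (hm : m ∈ Ideal.ofList (coordList Q b c) • (⊤ : Submodule (QuadricRing Q b) M.carrier)) :
    ∃ u ∈ coordSpan c w, ∃ z ∈ grGE M 2, m = u + z := by
  have hX : ∀ (i : Fin d) (e : M.carrier), ∃ u ∈ coordSpan c w, ∃ z ∈ grGE M 2,
      coordHom Q b c (MvPolynomial.X i) • e = u + z := by
    intro i e
    obtain ⟨t, z, hz, rfl⟩ := exists_eq_sum_add_mem_grGE_one (c := c) hw0 hgen ha e
    have h1 : ∑ j, t j • coordHom Q b c (MvPolynomial.X i) • w j ∈ coordSpan c w :=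
      Submodule.sum_mem _ fun j _ => Submodule.smul_mem _ _
        (Submodule.subset_span (Set.mem_range_self (i, j)))
    have h2 := smul_mem_grGE (coordHom_mem Q b c (X_mem_polyGr i)) hz
    refine ⟨_, h1, _, h2, ?_⟩
    rw [smul_add, Finset.smul_sum]
    congr 1
    exact Finset.sum_congr rfl fun j _ => smul_comm _ _ _
  induction hm using Submodule.smul_induction_on' with
  | smul s hs e _ =>
    induction hs using Submodule.span_induction generalizing e with
    | mem x hx =>
      obtain ⟨i, rfl⟩ := mem_varList.1 hx
      exact hX i e
    | zero => exact ⟨0, zero_mem _, 0, zero_mem _, by rw [zero_smul, add_zero]⟩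
    | add x y _ _ hx hy =>
      obtain ⟨u, hu, z, hz, h⟩ := hx e trivial
      obtain ⟨u', hu', z', hz', h'⟩ := hy e trivial
      exact ⟨u + u', add_mem hu hu', z + z', add_mem hz hz', by rw [add_smul, h, h']; abel⟩
    | smul t x _ hx =>
      obtain ⟨u, hu, z, hz, h⟩ := hx (t • e) trivial
      exact ⟨u, hu, z, hz, by rw [← h, smul_eq_mul, mul_comm, mul_smul]⟩
  | add x _ y _ hx hy =>
    obtain ⟨u, hu, z, hz, h⟩ := hx
    obtain ⟨u', hu', z', hz', h'⟩ := hy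
    exact ⟨u + u', add_mem hu hu', z + z', add_mem hz hz', by rw [h, h']; abel⟩

/-- A finite supremum of lengths is attained; for depth 0 the empty sequence serves, which is
regular since the module is nonzero. -/
theorem exists_isRegular_of_depth_eq {R : Type*} [CommRing R] {I : Ideal R} {N : Type*}
    [AddCommGroup N] [Module R N] [Nontrivial N] (h : depth I N = (d : ℕ∞)) :
    ∃ rs : List R, rs.length = d ∧ (∀ r ∈ rs, r ∈ I) ∧ RingTheory.Sequence.IsRegular N rs := by
  have hle : ∀ rs : List R, (∀ r ∈ rs, r ∈ I) ∧ RingTheory.Sequence.IsRegular N rs →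
      rs.length ≤ d := by
    intro rs hrs
    have : (rs.length : ℕ∞) ≤ depth I N := le_iSup₂_of_le rs hrs le_rfl
    rw [h] at this
    exact_mod_cast this
  cases d with
  | zero => exact ⟨[], rfl, by simp, RingTheory.Sequence.IsRegular.nil R N⟩
  | succ d =>
    have h1 : (d : ℕ∞) < depth I N := by
      rw [h]; exact_mod_cast Nat.lt_succ_self d
    rw [depth, lt_iSup_iff] at h1
    obtain ⟨rs, h1⟩ := h1
    rw [lt_iSup_iff] at h1
    obtain ⟨hrs, h1⟩ := h1
    have h2 : d < rs.length := by exact_mod_cast h1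
    exact ⟨rs, le_antisymm (hle rs hrs) h2, hrs⟩

variable (hind : ∀ t : Fin r → k, ∑ j, t j • w j = 0 → ∀ j, t j = 0)

/-- The generators together with the multiples of some of them by the zeroth coordinate. -/
def extendedFamily (c : Module.Basis (Fin (d + 1)) k V) (w : Fin r → M.carrier)
    (J : Set (Fin r)) : Fin r ⊕ J → M.carrier :=
  Sum.elim w fun j => coordZero Q b c • w j

include hw0 hgen hind in
-- By the regularity criterion only independence over k modulo the coordinates has to be checked.
-- There the components of degree 0 and 1 separate: the first gives independence of the w_j, the
-- second the hypothesis on J.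
theorem extendedFamily_independent (ha : Q (c 0) ≠ 0) (hM : IsMCM M) (J : Set (Fin r)) [Fintype J]
    (hJ : ∀ t : J → k, ∑ j, t j • coordZero Q b c • w j ∈ coordSpan c w → ∀ j, t j = 0)
    (a : Fin r ⊕ J → MvPolynomial (Fin d) k)
    (h : ∑ j, coordHom Q b c (a j) • extendedFamily c w J j = 0) (j : Fin r ⊕ J) : a j = 0 := by
  obtain ⟨hfin, hdepth⟩ := hM
  cases subsingleton_or_nontrivial M.carrier with
  | inl hs =>
    have : IsEmpty (Fin r) := ⟨fun j => one_ne_zero (α := k)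
      (hind (fun _ => 1) (Subsingleton.elim _ _) j)⟩
    exact isEmptyElim (Sum.elim id Subtype.val j)
  | inr hs =>
    have hd : depth (irrelevant Q b) M.carrier = (d : ℕ∞) := by
      have := hdepth.resolve_left (not_subsingleton _)
      rw [ringKrullDim_quadricRing ha] at this
      exact_mod_cast this
    obtain ⟨rs, hl, hrs, reg⟩ := exists_isRegular_of_depth_eq hd
    refine eq_zero_of_sum_smul_eq_zero_of_isRegular
      (coordHom Q b c : MvPolynomial (Fin d) k →+* QuadricRing Q b)
      (irrelevant_le_radical Q b c ha) (fun i => ?_) hl hrs reg (extendedFamily c w J) ?_ a h j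
    · change coordHom Q b c _ ∈ _
      rw [coordHom_X]
      exact linForm_mem_irrelevant Q b _
    · intro t ht
      have hC : ∀ t : k, (coordHom Q b c : MvPolynomial (Fin d) k →+* QuadricRing Q b)
          (MvPolynomial.C t) = algebraMap k _ t := fun t => (coordHom Q b c).commutes t
      simp only [hC, algebraMap_smul] at ht
      obtain ⟨u, hu, z, hz, huz⟩ := exists_eq_add_of_mem_smul_top hw0 hgen ha ht
      rw [Fintype.sum_sum_type] at huz
      simp only [extendedFamily, Sum.elim_inl, Sum.elim_inr] at huz
      obtain ⟨h0, h1⟩ := eq_zero_of_add_add_eq_zero (M := M)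
        (x := ∑ j, t (Sum.inl j) • w j)
        (y := ∑ j : J, t (Sum.inr j) • coordZero Q b c • w j - u) (z := -z)
        (sum_mem fun j _ => M.smul_mem_gr _ (hw0 j))
        (sub_mem (sum_mem fun j _ => M.smul_mem_gr _
          (M.smul_mem 1 0 _ _ (linForm_mem Q b _) (hw0 j))) (coordSpan_le_gr hw0 hu))
        (neg_mem hz) (by rw [add_sub, huz]; abel)
      have h2 := hJ (fun j => t (Sum.inr j)) (by rw [sub_eq_zero.1 h1]; exact hu)
      have h3 := hind _ h0
      rintro (j | j)
      · exact h3 j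
      · exact h2 j

end Generation

end

end QuadricMCM

/-! ### Existence of frames. -/

namespace QuadricMCM

noncomputable section

variable {k : Type u} [Field k] {V : Type v} [AddCommGroup V] [Module k V] {n : ℕ}
  {Q : QuadraticForm k V} {b : Module.Basis (Fin n) k V}
  {d : ℕ} {c : Module.Basis (Fin (d + 1)) k V} {M : GrMod Q b}

section FrameMap

variable {ι : Type*} [Fintype ι]

/-- Linear combinations of a family with coefficients in the polynomial subring. -/
def frameMap (c : Module.Basis (Fin (d + 1)) k V) (w : ι → M.carrier) :
    (ι → MvPolynomial (Fin d) k) →ₗ[k] M.carrier where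
  toFun a := ∑ j, coordHom Q b c (a j) • w j
  map_add' a a' := by simp [add_smul, Finset.sum_add_distrib]
  map_smul' t a := by simp [Finset.smul_sum, smul_assoc]

theorem frameMap_apply (w : ι → M.carrier) (a : ι → MvPolynomial (Fin d) k) :
    frameMap c w a = ∑ j, coordHom Q b c (a j) • w j := rfl

theorem frameMap_mul (w : ι → M.carrier) (s : MvPolynomial (Fin d) k)
    (a : ι → MvPolynomial (Fin d) k) :
    frameMap c w (fun j => s * a j) = coordHom Q b c s • frameMap c w a := by
  simp [frameMap_apply, Finset.smul_sum, mul_smul]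

theorem frameMap_single [DecidableEq ι] (w : ι → M.carrier) (j : ι) :
    frameMap c w (Pi.single j 1) = w j := by
  rw [frameMap_apply, Finset.sum_eq_single j (fun l _ h => by simp [Pi.single_eq_of_ne h])
    (by simp), Pi.single_eq_same, map_one, one_smul]

theorem frameMap_eq_top_of_coordZero_smul_mem (ha : Q (c 0) ≠ 0) {r : ℕ} {w : Fin r → M.carrier}
    (hgen : Function.Surjective (Fintype.linearCombination (QuadricRing Q b) w))
    (w' : ι → M.carrier) (hw : ∀ j, w j ∈ LinearMap.range (frameMap c w'))
    (h0 : ∀ j, coordZero Q b c • w' j ∈ LinearMap.range (frameMap c w')) :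
    LinearMap.range (frameMap c w') = ⊤ := by
  have hθ : ∀ (s : MvPolynomial (Fin d) k), ∀ m ∈ LinearMap.range (frameMap c w'),
      coordHom Q b c s • m ∈ LinearMap.range (frameMap c w') := by
    rintro s _ ⟨a, rfl⟩
    exact ⟨_, frameMap_mul w' s a⟩
  have hx : ∀ m ∈ LinearMap.range (frameMap c w'),
      coordZero Q b c • m ∈ LinearMap.range (frameMap c w') := by
    rintro _ ⟨a, rfl⟩
    rw [frameMap_apply, Finset.smul_sum]
    refine Submodule.sum_mem _ fun j _ => ?_
    rw [smul_comm]
    exact hθ _ _ (h0 j)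
  refine eq_top_iff.2 fun m _ => ?_
  obtain ⟨f, rfl⟩ := hgen m
  rw [Fintype.linearCombination_apply]
  refine Submodule.sum_mem _ fun j _ => ?_
  obtain ⟨α, β, h⟩ := exists_eq_coordHom_add Q b c ha (f j)
  rw [h, add_smul, mul_smul]
  exact Submodule.add_mem _ (hθ _ _ (hw j)) (hθ _ _ (hx _ (hw j)))

end FrameMap

variable {r : ℕ} {w : Fin r → M.carrier} (hw0 : ∀ j, w j ∈ M.gr 0)
  (hgen : Function.Surjective (Fintype.linearCombination (QuadricRing Q b) w))
  (hind : ∀ t : Fin r → k, ∑ j, t j • w j = 0 → ∀ j, t j = 0)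

include hgen in
-- The span over the polynomial subring is stable under x: products x w_j are covered by the choice
-- of J, and x² w_j reduces to w_j and x w_j by the quadratic equation.
theorem frameMap_extendedFamily_surjective (ha : Q (c 0) ≠ 0) (J : Set (Fin r)) [Fintype J]
    (hJ : ∀ j, coordZero Q b c • w j ∈
      Submodule.span k ((fun j => coordZero Q b c • w j) '' J) ⊔ coordSpan c w) :
    Function.Surjective (frameMap c (extendedFamily c w J)) := by
  classical
  have hw : ∀ j, w j ∈ LinearMap.range (frameMap c (extendedFamily c w J)) := fun j =>
    ⟨_, frameMap_single (extendedFamily c w J) (Sum.inl j)⟩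
  have hle : Submodule.span k ((fun j => coordZero Q b c • w j) '' J) ⊔ coordSpan c w ≤
      LinearMap.range (frameMap c (extendedFamily c w J)) := by
    refine sup_le (Submodule.span_le.2 ?_) (Submodule.span_le.2 ?_)
    · rintro _ ⟨j, hj, rfl⟩
      exact ⟨_, frameMap_single (extendedFamily c w J) (Sum.inr ⟨j, hj⟩)⟩
    · rintro _ ⟨⟨i, j⟩, rfl⟩
      obtain ⟨a, h⟩ := hw j
      exact ⟨_, (frameMap_mul _ (MvPolynomial.X i) a).trans (by rw [h])⟩
  refine LinearMap.range_eq_top.1 (frameMap_eq_top_of_coordZero_smul_mem ha hgen _ hw ?_)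
  have h0 := fun j => hle (hJ j)
  rintro (j | j)
  · exact h0 j
  · change coordZero Q b c • coordZero Q b c • w j ∈ _
    rw [smul_smul, ← pow_two, coordZero_sq Q b c ha, neg_smul, add_smul, mul_smul]
    obtain ⟨a, h⟩ := hw j
    obtain ⟨a', h'⟩ := h0 j
    rw [← h, ← frameMap_mul, h, ← h', ← frameMap_mul]
    exact Submodule.neg_mem _ (Submodule.add_mem _ ⟨_, rfl⟩ ⟨_, rfl⟩)

/-- An additive functional which is semilinear over the polynomial subring gives rise to a linear
functional over the coordinate ring. -/
def inducedFunctional (ha : Q (c 0) ≠ 0) (L : M.carrier →+ MvPolynomial (Fin d) k)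
    (hL : ∀ s m, L (coordHom Q b c s • m) = s * L m) :
    M.carrier →ₗ[QuadricRing Q b] QuadricRing Q b where
  -- This formula is forced: if m ↦ A(m) + L(m)x is to be R-linear, the x-coefficient at x·m must be
  -- A(m) − (l/Q(c 0)) L(m), with l the linear coefficient, and this determines A.
  toFun m := coordHom Q b c (L (coordZero Q b c • m) + (Q (c 0))⁻¹ • linCoeff Q c * L m) +
    coordHom Q b c (L m) * coordZero Q b c
  map_add' m m' := by simp only [smul_add, map_add, mul_add]; ring
  map_smul' s m := by
    obtain ⟨α, β, rfl⟩ := exists_eq_coordHom_add Q b c ha s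
    have h1 : L ((coordHom Q b c α + coordHom Q b c β * coordZero Q b c) • m) =
        α * L m + β * L (coordZero Q b c • m) := by
      rw [add_smul, mul_smul, map_add, hL, hL]
    have h2 : coordZero Q b c • coordZero Q b c • m =
        -(coordHom Q b c ((Q (c 0))⁻¹ • constCoeff Q b c) • m +
          coordHom Q b c ((Q (c 0))⁻¹ • linCoeff Q c) • coordZero Q b c • m) := by
      rw [smul_smul, ← pow_two, coordZero_sq Q b c ha, neg_smul, add_smul, mul_smul]
    have h3 : L (coordZero Q b c • (coordHom Q b c α + coordHom Q b c β * coordZero Q b c) • m) =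
        α * L (coordZero Q b c • m) - β * ((Q (c 0))⁻¹ • constCoeff Q b c * L m +
          (Q (c 0))⁻¹ • linCoeff Q c * L (coordZero Q b c • m)) := by
      rw [smul_comm, add_smul, mul_smul, h2, map_add, hL, hL, map_neg, map_add, hL, hL]
      ring
    rw [h1, h3]
    have h4 := coordZero_sq Q b c ha
    simp only [RingHom.id_apply, smul_eq_mul, map_add, map_sub, map_mul]
    linear_combination (-(coordHom Q b c β * coordHom Q b c (L m))) * h4

include hw0 hgen hind in
-- This is where the absence of free summands enters. Otherwise x w_j is a member of a basis of M
-- over the polynomial subring, and the induced functional of its dual coordinate sends w_j to 1,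
-- which splits off a copy of R.
theorem coordZero_smul_mem_coordSpan (ha : Q (c 0) ≠ 0) (hM : IsMCM M) (hM' : NoFreeSummand M)
    (j : Fin r) : coordZero Q b c • w j ∈ coordSpan c w := by
  classical
  by_contra hj
  let g : Fin r → M.carrier ⧸ coordSpan c w := fun j =>
    (coordSpan c w).mkQ (coordZero Q b c • w j)
  have hg : g j ≠ 0 := fun h => hj ((Submodule.Quotient.mk_eq_zero _).1 h)
  -- J contains j, and the classes of x w_i for i ∈ J form a basis of the span of all such classes
  -- modulo `coordSpan`; the extended family is then both generating and independent.
  obtain ⟨J, -, hjJ, hJ, hJi⟩ := exists_linearIndepOn_extension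
    (LinearIndepOn.singleton (R := k) (v := g) hg) (Set.subset_univ {j})
  have hsurj := frameMap_extendedFamily_surjective hgen ha J (fun i => by
    have h1 : g i ∈ Submodule.span k (g '' J) := hJ ⟨i, trivial, rfl⟩
    have h2 : g '' J = (coordSpan c w).mkQ '' ((fun j => coordZero Q b c • w j) '' J) :=
      (Set.image_image _ _ _).symm
    rw [h2, ← Submodule.map_span] at h1
    rwa [← Submodule.mem_comap, Submodule.comap_map_mkQ, sup_comm] at h1)
  have hinj : Function.Injective (frameMap c (extendedFamily c w J)) := by
    rw [injective_iff_map_eq_zero]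
    intro a h
    refine funext fun i => extendedFamily_independent hw0 hgen hind ha hM J (fun t ht => ?_) a h i
    have h2 := Fintype.linearIndependent_iff.1 hJi
    refine h2 t ?_
    have h3 := (Submodule.Quotient.mk_eq_zero (coordSpan c w)).2 ht
    rw [← h3, ← Submodule.mkQ_apply, map_sum]
    rfl
  let Φ := LinearEquiv.ofBijective _ ⟨hinj, hsurj⟩
  have hΦ : ∀ s m, Φ.symm (coordHom Q b c s • m) = fun i => s * Φ.symm m i := by
    intro s m
    rw [LinearEquiv.symm_apply_eq]
    change _ = frameMap c (extendedFamily c w J) _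
    rw [frameMap_mul]
    congr 1
    exact (Φ.apply_symm_apply m).symm
  have hΦs : ∀ i, Φ.symm (extendedFamily c w J i) = Pi.single i 1 := by
    intro i
    rw [LinearEquiv.symm_apply_eq]
    exact (frameMap_single _ i).symm
  let j' : Fin r ⊕ J := Sum.inr ⟨j, hjJ rfl⟩
  let L : M.carrier →+ MvPolynomial (Fin d) k :=
    ((LinearMap.proj j').comp Φ.symm.toLinearMap).toAddMonoidHom
  have hL : ∀ m, L m = Φ.symm m j' := fun m => rfl
  refine hM' ⟨LinearMap.toSpanSingleton _ _ (w j),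
    inducedFunctional ha L fun s m => by rw [hL, hL, hΦ], LinearMap.ext_ring ?_⟩
  rw [LinearMap.comp_apply, LinearMap.toSpanSingleton_apply, one_smul, LinearMap.id_apply]
  change coordHom Q b c (L (coordZero Q b c • w j) + _ * L (w j)) + coordHom Q b c (L (w j)) * _ = 1
  have h1 : L (w j) = 0 := by
    rw [hL]
    have := congrFun (hΦs (Sum.inl j)) j'
    exact this.trans (Pi.single_eq_of_ne (by simp [j']) _)
  have h2 : L (coordZero Q b c • w j) = 1 := by
    rw [hL]
    exact (congrFun (hΦs j') j').trans (Pi.single_eq_same _ _)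
  rw [h1, h2]
  simp

theorem sum_mem_gr (hw0 : ∀ j, w j ∈ M.gr 0) {e : ℤ} {a : Fin r → MvPolynomial (Fin d) k}
    (h : ∀ j, a j ∈ polyGr k (Fin d) e) : frameMap c w a ∈ M.gr e :=
  (frameMap_apply (c := c) w a) ▸ AddSubgroup.sum_mem _ fun j _ => by
    have := M.smul_mem e 0 _ _ (coordHom_mem Q b c (h j)) (hw0 j)
    rwa [add_zero] at this

/-- After the degree-e parts of the coefficients are removed, the remaining sum lies in degree e and
in the span of the other degrees, so it vanishes, and injectivity kills the remaining coefficients.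
-/
theorem sum_mem_iff_of_bijective (hw0 : ∀ j, w j ∈ M.gr 0)
    (h : Function.Injective (frameMap c w)) (e : ℤ) (a : Fin r → MvPolynomial (Fin d) k) :
    ∑ j, coordHom Q b c (a j) • w j ∈ M.gr e ↔ ∀ j, a j ∈ polyGr k (Fin d) e := by
  rw [← frameMap_apply]
  refine ⟨fun ha => ?_, sum_mem_gr hw0⟩
  have key : ∀ a : Fin r → MvPolynomial (Fin d) k, (∀ j, polyComp e (a j) = 0) →
      frameMap c w a ∈ ⨆ f : ℤ, ⨆ _ : f ≠ e, M.gr f := by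
    intro a ha
    have h1 : a = ∑ f ∈ Finset.range (∑ j, (a j).totalDegree + 1),
        fun j => polyComp (f : ℤ) (a j) := by
      funext j
      rw [Finset.sum_apply, sum_polyComp]
      exact Nat.lt_succ_of_le (Finset.single_le_sum (f := fun j => (a j).totalDegree)
        (fun _ _ => Nat.zero_le _) (Finset.mem_univ j))
    rw [h1, map_sum]
    refine sum_mem fun f _ => ?_
    by_cases hf : (f : ℤ) = e
    · have : (fun j => polyComp (f : ℤ) (a j)) = 0 := funext fun j => by rw [hf]; exact ha j
      rw [this, map_zero]
      exact zero_mem _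
    · exact AddSubgroup.mem_iSup_of_mem (f : ℤ) (AddSubgroup.mem_iSup_of_mem hf
        (sum_mem_gr hw0 fun j => polyComp_mem _ _))
  have h2 := key (fun j => a j - polyComp e (a j)) fun j => by
    rw [map_sub, polyComp_of_mem (polyComp_mem e (a j)), sub_self]
  have h3 : frameMap c w (fun j => a j - polyComp e (a j)) = 0 := by
    refine eq_zero_of_mem_gr_of_mem_iSup ?_ h2
    have : (fun j => a j - polyComp e (a j)) = a - fun j => polyComp e (a j) := rfl
    rw [this, map_sub]
    exact sub_mem ha (sum_mem_gr hw0 fun j => polyComp_mem _ _)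
  intro j
  have h4 := congrFun (h (h3.trans (map_zero _).symm)) j
  rw [sub_eq_zero.1 (h4 : a j - polyComp e (a j) = 0)]
  exact polyComp_mem _ _

include hw0 hgen hind in
/-- Degree zero generators which are linearly independent over the ground field form a frame. -/
theorem exists_normalFrame (ha : Q (c 0) ≠ 0) (hM : IsMCM M) (hM' : NoFreeSummand M) :
    ∃ F : NormalFrame c M r, F.w = w := by
  classical
  have h0 := coordZero_smul_mem_coordSpan hw0 hgen hind ha hM hM'
  have hsurj : Function.Surjective (frameMap c w) := by
    intro m
    obtain ⟨a, rfl⟩ := frameMap_extendedFamily_surjective hgen ha ∅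
      (fun j => Submodule.mem_sup_right (h0 j)) m
    refine ⟨fun j => a (Sum.inl j), ?_⟩
    rw [frameMap_apply, frameMap_apply, Fintype.sum_sum_type]
    simp [extendedFamily]
  have hinj : Function.Injective (frameMap c w) := by
    rw [injective_iff_map_eq_zero]
    intro a h
    refine funext fun j => extendedFamily_independent hw0 hgen hind ha hM ∅
      (fun t _ j => isEmptyElim j) (Sum.elim a isEmptyElim) ?_ (Sum.inl j)
    rw [Fintype.sum_sum_type]
    simpa [extendedFamily, frameMap_apply] using h
  have hX : ∀ j, ∃ X : Fin d → Fin r → k, coordZero Q b c • w j =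
      ∑ l, (∑ i, X i l • coordHom Q b c (MvPolynomial.X i)) • w l := by
    intro j
    obtain ⟨X, hX⟩ := (Submodule.mem_span_range_iff_exists_fun k).1 (h0 j)
    refine ⟨fun i l => X (i, l), ?_⟩
    rw [← hX, Fintype.sum_prod_type, Finset.sum_comm]
    simp only [Finset.sum_smul, smul_assoc]
  choose X hX using hX
  -- The columns are chosen to be the relations x w_j − ∑ (linear form) w_l = 0: identity at c 0,
  -- and the negated coefficients of x w_j at the other basis vectors.
  obtain ⟨D, hD⟩ : ∃ D : V →ₗ[k] Matrix (Fin r) (Fin r) k, ∀ v l j, D v l j =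
      c.coord 0 v * (1 : Matrix (Fin r) (Fin r) k) l j - ∑ i, c.coord i.succ v * X j i l := by
    refine ⟨⟨⟨fun v => Matrix.of fun l j => c.coord 0 v * (1 : Matrix (Fin r) (Fin r) k) l j -
      ∑ i, c.coord i.succ v * X j i l, ?_⟩, ?_⟩, fun v l j => rfl⟩
    · intro v v'
      ext l j
      simp only [Matrix.of_apply, Matrix.add_apply, map_add, add_mul, Finset.sum_add_distrib]
      ring
    · intro t v
      ext l j
      simp only [Matrix.of_apply, Matrix.smul_apply, map_smul, smul_eq_mul, RingHom.id_apply,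
        mul_sub, Finset.mul_sum, mul_assoc]
  have hD0 : D (c 0) = 1 := by
    ext l j
    simp [hD]
  refine ⟨⟨w, ⟨hinj, hsurj⟩, sum_mem_iff_of_bijective hw0 hinj, D, hD0, fun j => ?_⟩, rfl⟩
  have h1 : ∀ l, restMat c D l j = -∑ i, X j i l • MvPolynomial.X i := by
    intro l
    rw [restMat, ← Finset.sum_neg_distrib]
    refine Finset.sum_congr rfl fun i _ => ?_
    rw [← neg_smul]
    congr 1
    simp [hD, Finsupp.single_apply, Fin.succ_inj]
  simp only [linMat_eq (Q := Q) (b := b) hD0, add_smul, Finset.sum_add_distrib, ite_smul,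
    zero_smul, Finset.sum_ite_eq', Finset.mem_univ, if_true, hX j, h1, map_neg, map_sum, map_smul,
    neg_smul, Finset.sum_neg_distrib, neg_add_cancel]

include hgen in
theorem exists_normalFrame_of_irrelevant (ha : Q (c 0) ≠ 0) (hw0 : ∀ j, w j ∈ M.gr 0)
    (hmin : ∀ f : Fin r → QuadricRing Q b, ∑ j, f j • w j = 0 → ∀ j, f j ∈ irrelevant Q b)
    (hM : isLinearMCM Q b M) : ∃ F : NormalFrame c M r, F.w = w := by
  refine exists_normalFrame hw0 hgen (fun t ht j => ?_) ha hM.1 hM.2.1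
  have := (mem_irrelevant Q b).1 (hmin (fun j => algebraMap k _ (t j)) (by simpa using ht) j)
  rwa [AlgHom.commutes] at this

variable (c) in
-- The linear presentation already supplies minimal generators: φ has entries of degree one, so
-- every relation has coefficients in the irrelevant ideal and the generators are independent over
-- k.
theorem exists_normalFrame_of_isLinearMCM (ha : Q (c 0) ≠ 0) (hM : isLinearMCM Q b M) :
    ∃ r, Nonempty (NormalFrame c M r) := by
  classical
  obtain ⟨r, φ, π, hφ, hπ, hex, hsurj⟩ := hM.2.2
  have h1 : ∀ f, ∑ j, f j • π (Pi.single j 1) = π f := fun f => by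
    conv_rhs => rw [pi_eq_sum_univ' f]
    rw [map_sum]
    refine Finset.sum_congr rfl fun j _ => ?_
    rw [← map_smul]
  have hsingle : ∀ i j : Fin r, (Pi.single i 1 : Fin r → QuadricRing Q b) j ∈ ringGr Q b 0 := by
    intro i j
    by_cases h : j = i
    · subst h
      rw [Pi.single_eq_same, ← map_one (algebraMap k (QuadricRing Q b))]
      exact algebraMap_mem_ringGr Q b 1
    · rw [Pi.single_eq_of_ne h]; exact Submodule.zero_mem _
  have h1irr : ∀ s ∈ ringGr Q b 1, s ∈ irrelevant Q b := by
    intro s hs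
    obtain ⟨α, hα, β, hβ, rfl⟩ := exists_eq_of_mem_ringGr Q b c ha hs
    rw [mem_irrelevant, map_add, map_mul, vertexEval_coordHom,
      constantCoeff_of_mem_polyGr one_ne_zero hα, coordZero, vertexEval_linForm, mul_zero, add_zero]
  obtain ⟨F, -⟩ := exists_normalFrame_of_irrelevant (c := c) (w := fun j => π (Pi.single j 1))
    (fun m => by
      obtain ⟨f, rfl⟩ := hsurj m
      exact ⟨f, h1 f⟩) ha (fun j => hπ 0 _ (hsingle j)) (fun f hf j => by
      rw [h1] at hf
      obtain ⟨g, rfl⟩ := (hex f).1 hf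
      rw [pi_eq_sum_univ' g, map_sum, Finset.sum_apply]
      refine Ideal.sum_mem _ fun i _ => ?_
      rw [map_smul, Pi.smul_apply, smul_eq_mul]
      refine Ideal.mul_mem_left _ _ (h1irr _ ?_)
      have := hφ 0 (Pi.single i 1) (hsingle i) j
      simp only [zero_add] at this
      convert this using 2) hM
  exact ⟨r, ⟨F⟩⟩

end

end QuadricMCM

/-! ### The quadratic relation for matrices, pointwise and as a polynomial identity. -/

namespace QuadricMCM

noncomputable section

variable {k : Type u} [Field k] {V : Type v} [AddCommGroup V] [Module k V] {n : ℕ}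
  {Q : QuadraticForm k V} {b : Module.Basis (Fin n) k V}
  {d : ℕ} {c : Module.Basis (Fin (d + 1)) k V} {M : GrMod Q b}

section QuadraticRelation

variable {r : ℕ} {D : V →ₗ[k] Matrix (Fin r) (Fin r) k}

/-- The matrix of linear polynomials by which the zeroth coordinate acts, up to sign. -/
def restMatrix (c : Module.Basis (Fin (d + 1)) k V) (D : V →ₗ[k] Matrix (Fin r) (Fin r) k) :
    Matrix (Fin r) (Fin r) (MvPolynomial (Fin d) k) := Matrix.of (restMat c D)

theorem restMatrix_apply (i j : Fin r) : restMatrix c D i j = restMat c D i j := rfl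

theorem restMatrix_eq : restMatrix c D = ∑ s : Fin d,
    (MvPolynomial.X s : MvPolynomial (Fin d) k) • (D (c s.succ)).map MvPolynomial.C := by
  ext1 i j
  simp [restMatrix_apply, restMat, Matrix.sum_apply, MvPolynomial.smul_eq_C_mul, mul_comm]

/-- A quadratic relation satisfied by a linear map from a quadratic space to an algebra. -/
def QuadRel {A : Type*} [Ring A] [Algebra k A] (Q : QuadraticForm k V) (v₀ : V) (D : V →ₗ[k] A) :
    Prop :=
  ∀ v, Q v₀ • (D v * D v) - QuadraticMap.polar Q v₀ v • D v + Q v • 1 = 0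

variable (Q b c D) in
/-- The quadratic relation as an identity of polynomial matrices. -/
def PolyQuadRel : Prop :=
  Q (c 0) • (restMatrix c D * restMatrix c D) - linCoeff Q c • restMatrix c D +
    constCoeff Q b c • 1 = 0

/-- Vanishing of the diagonal is assumed separately so that the pairing of (s, t) with (t, s) also
works in characteristic 2. -/
theorem sum_alternating_smul_eq_zero {A N ι : Type*} [CommRing A] [AddCommGroup N] [Module A N]
    [Fintype ι] (z : ι → A) (B : ι → ι → N) (h : ∀ s, B s s = 0) (h' : ∀ s t, B s t + B t s = 0) :
    ∑ s, ∑ t, (z s * z t) • B s t = 0 := by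
  rw [← Finset.sum_product']
  refine Finset.sum_involution (fun p _ => p.swap) ?_ ?_ ?_ ?_
  · rintro ⟨s, t⟩ -
    simp only [Prod.fst_swap, Prod.snd_swap]
    rw [mul_comm (z t), ← smul_add, h', smul_zero]
  · rintro ⟨s, t⟩ - h0 heq
    obtain rfl : t = s := congrArg Prod.fst heq
    exact h0 (by rw [h, smul_zero])
  · simp
  · simp

theorem QuadRel.polar {A : Type*} [Ring A] [Algebra k A] {D : V →ₗ[k] A} {v₀ : V} (h : QuadRel Q v₀ D) (u v : V) :
    Q v₀ • (D u * D v) + Q v₀ • (D v * D u) - QuadraticMap.polar Q v₀ u • D v -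
      QuadraticMap.polar Q v₀ v • D u + QuadraticMap.polar Q u v • 1 = 0 := by
  have h1 := h (u + v)
  have h2 := h u
  have h3 := h v
  have h4 : Q (u + v) = Q u + Q v + QuadraticMap.polar Q u v := by
    rw [QuadraticMap.polar]; ring
  rw [h4, map_add, QuadraticMap.polar_add_right] at h1
  have h5 := congrArg₂ (· - ·) (congrArg₂ (· - ·) h1 h2) h3
  simp only [sub_zero] at h5
  rw [← h5]
  simp only [add_mul, mul_add, smul_add, add_smul]
  abel

/-- Coefficient by coefficient: the square terms carry the relation at a basis vector, the mixed
terms its polarization. Arguing with coefficients instead of values keeps the proof valid over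
finite fields. -/
theorem polyQuadRel_of_quadRel (h : QuadRel Q (c 0) D) : PolyQuadRel Q b c D := by
  let f : Matrix (Fin r) (Fin r) k →ₐ[k] Matrix (Fin r) (Fin r) (MvPolynomial (Fin d) k) :=
    (Algebra.ofId k (MvPolynomial (Fin d) k)).mapMatrix
  have hf : restMatrix c D = ∑ s : Fin d,
      (MvPolynomial.X s : MvPolynomial (Fin d) k) • f (D (c s.succ)) := restMatrix_eq
  let B : Fin d → Fin d → Matrix (Fin r) (Fin r) (MvPolynomial (Fin d) k) := fun s t =>
    f (Q (c 0) • (D (c s.succ) * D (c t.succ)) -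
      QuadraticMap.polar Q (c 0) (c s.succ) • D (c t.succ) +
        halfPolar Q b (c s.succ) (c t.succ) • 1)
  have hB := sum_alternating_smul_eq_zero
    (fun s : Fin d => (MvPolynomial.X s : MvPolynomial (Fin d) k)) B (fun s => by
      simp only [B, halfPolar_self]
      rw [h, map_zero]) (fun s t => by
      simp only [B]
      rw [← map_add, ← map_zero f]
      congr 1
      rw [← h.polar (c s.succ) (c t.succ), ← halfPolar_add_halfPolar Q b (c s.succ), add_smul]
      abel)
  let X : Fin d → MvPolynomial (Fin d) k := MvPolynomial.X
  have h1 : Q (c 0) • (restMatrix c D * restMatrix c D) = ∑ s : Fin d, ∑ t : Fin d,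
      (X s * X t) • (Q (c 0) • (f (D (c s.succ)) * f (D (c t.succ)))) := by
    simp only [hf, Finset.sum_mul_sum, Finset.smul_sum, smul_mul_smul_comm]
    exact Finset.sum_congr rfl fun s _ => Finset.sum_congr rfl fun t _ => smul_comm _ _ _
  have h2 : linCoeff Q c • restMatrix c D = ∑ s : Fin d, ∑ t : Fin d,
      (X s * X t) • (QuadraticMap.polar Q (c 0) (c s.succ) • f (D (c t.succ))) := by
    rw [hf, linCoeff, Finset.sum_smul]
    simp only [Finset.smul_sum]
    exact Finset.sum_congr rfl fun s _ => Finset.sum_congr rfl fun t _ => by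
      rw [smul_assoc, smul_smul, smul_comm]
  have h3 : constCoeff Q b c • (1 : Matrix (Fin r) (Fin r) (MvPolynomial (Fin d) k)) =
      ∑ s : Fin d, ∑ t : Fin d,
        (X s * X t) • (halfPolar Q b (c s.succ) (c t.succ) •
          (1 : Matrix (Fin r) (Fin r) (MvPolynomial (Fin d) k))) := by
    simp only [constCoeff, Finset.sum_smul]
    exact Finset.sum_congr rfl fun s _ => Finset.sum_congr rfl fun t _ => by
      rw [smul_assoc, smul_comm]
  rw [PolyQuadRel, ← hB, h1, h2, h3, ← Finset.sum_sub_distrib, ← Finset.sum_add_distrib]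
  refine Finset.sum_congr rfl fun s _ => ?_
  rw [← Finset.sum_sub_distrib, ← Finset.sum_add_distrib]
  refine Finset.sum_congr rfl fun t _ => ?_
  rw [← smul_sub, ← smul_add]
  simp only [B, map_add, map_sub, map_smul, map_mul, map_one]
  rfl

/-- Evaluation gives the relation at v', the part of v without c 0. Adding a multiple t of c 0
shifts D by t and changes the left side of the relation not at all. -/
theorem quadRel_of_polyQuadRel (hD : D (c 0) = 1) (h : PolyQuadRel Q b c D) :
    QuadRel Q (c 0) D := by
  intro v
  let z : Fin d → k := fun s => c.coord s.succ v
  let v' : V := ∑ s : Fin d, z s • c s.succ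
  have hv : v = c.coord 0 v • c 0 + v' := by
    conv_lhs => rw [← c.sum_repr v, Fin.sum_univ_succ]
    rfl
  have h1 : (restMatrix c D).map (MvPolynomial.eval z) = D v' := by
    ext i j
    simp only [Matrix.map_apply, restMatrix_apply, restMat, map_sum, MvPolynomial.smul_eval,
      MvPolynomial.eval_X, v', map_smul, Matrix.sum_apply, Matrix.smul_apply, smul_eq_mul]
    exact Finset.sum_congr rfl fun _ _ => mul_comm _ _
  have h2 : MvPolynomial.eval z (linCoeff Q c) = QuadraticMap.polar Q (c 0) v' := by
    have : QuadraticMap.polar Q (c 0) v' = QuadraticMap.polarBilin Q (c 0) v' := rfl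
    rw [this]
    simp only [linCoeff, v', map_sum, map_smul, MvPolynomial.smul_eval, MvPolynomial.eval_X,
      QuadraticMap.polarBilin_apply_apply, smul_eq_mul]
    exact Finset.sum_congr rfl fun _ _ => mul_comm _ _
  have h3 : MvPolynomial.eval z (constCoeff Q b c) = Q v' := by
    rw [← halfPolar_self Q b]
    simp only [constCoeff, v', map_sum, map_smul, MvPolynomial.smul_eval, MvPolynomial.eval_X,
      map_mul, LinearMap.sum_apply, LinearMap.smul_apply, smul_eq_mul, Finset.mul_sum]
    rw [Finset.sum_comm]
    exact Finset.sum_congr rfl fun _ _ => Finset.sum_congr rfl fun _ _ => by ring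
  have h4 := congrArg (fun N => N.map (MvPolynomial.eval z)) h
  have h5 : Q (c 0) • (D v' * D v') - QuadraticMap.polar Q (c 0) v' • D v' + Q v' • 1 = 0 := by
    rw [← h1, ← h2, ← h3]
    have h6 : ((1 : Matrix (Fin r) (Fin r) (MvPolynomial (Fin d) k)).map (MvPolynomial.eval z)) =
        1 := Matrix.map_one _ (map_zero _) (map_one _)
    rw [← Matrix.map_mul, ← h6]
    ext i j
    have h7 := congrFun (congrFun h4 i) j
    simpa only [Matrix.map_apply, Matrix.add_apply, Matrix.sub_apply, Matrix.smul_apply, map_add,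
      map_sub, smul_eq_mul, map_mul, MvPolynomial.smul_eval, Matrix.zero_apply, map_zero] using h7
  have hp : QuadraticMap.polar Q (c 0) v =
      2 * (c.coord 0 v * Q (c 0)) + QuadraticMap.polar Q (c 0) v' := by
    conv_lhs => rw [hv]
    rw [QuadraticMap.polar_add_right, QuadraticMap.polar_smul_right, QuadraticMap.polar_self]
    simp only [nsmul_eq_mul, smul_eq_mul]
    push_cast
    ring
  have hq : Q v = c.coord 0 v * c.coord 0 v * Q (c 0) + Q v' +
      c.coord 0 v * QuadraticMap.polar Q (c 0) v' := by
    conv_lhs => rw [hv]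
    rw [QuadraticMap.map_add Q, QuadraticMap.map_smul, QuadraticMap.polar_smul_left, smul_eq_mul,
      smul_eq_mul]
  have hDv : D v = c.coord 0 v • 1 + D v' := by
    conv_lhs => rw [hv]
    rw [map_add, map_smul, hD]
  rw [hp, hq, hDv, ← h5]
  simp only [add_mul, mul_add, smul_add, add_smul, smul_mul_assoc, mul_smul_comm, one_mul, mul_one,
    smul_smul]
  module

end QuadraticRelation

end

end QuadricMCM

/-! ### Modules from matrices, and syzygies as conjugate matrices. -/

namespace QuadricMCM

noncomputable section

variable {k : Type u} [Field k] {V : Type v} [AddCommGroup V] [Module k V] {n : ℕ}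
  {Q : QuadraticForm k V} {b : Module.Basis (Fin n) k V}
  {d : ℕ} {c : Module.Basis (Fin (d + 1)) k V} {M : GrMod Q b}

namespace NormalFrame

variable {r : ℕ} (F : NormalFrame c M r)

theorem frameMap_injective : Function.Injective (frameMap c F.w) := F.bijective.1

theorem coordZero_smul_frameMap (a : Fin r → MvPolynomial (Fin d) k) :
    coordZero Q b c • frameMap c F.w a = -frameMap c F.w ((restMatrix c F.mat).mulVec a) := by
  have h := F.sum_linMat_mul_smul fun j => coordHom Q b c (a j)
  simp only [sum_linMat_mul F.mat_zero, add_smul, Finset.sum_add_distrib] at h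
  rw [eq_neg_iff_add_eq_zero, ← h, add_comm, frameMap_apply, frameMap_apply, Finset.smul_sum]
  congr 1
  exact Finset.sum_congr rfl fun i _ => by rw [smul_smul, mul_comm]

/-- The zeroth coordinate acts on the frame as minus the linear matrix, so the equation of the
quadric, applied to M, is this matrix identity. -/
theorem polyQuadRel : PolyQuadRel Q b c F.mat := by
  have key : ∀ a, (Q (c 0) • (restMatrix c F.mat * restMatrix c F.mat) -
      linCoeff Q c • restMatrix c F.mat + constCoeff Q b c • 1).mulVec a = 0 := by
    intro a
    apply F.frameMap_injective
    have h1 := congrArg (fun s => s • frameMap c F.w a) (quadric_relation Q b c)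
    simp only [add_smul, smul_assoc, pow_two, mul_smul, zero_smul, F.coordZero_smul_frameMap,
      smul_neg, neg_neg, ← frameMap_mul] at h1
    rw [map_zero (frameMap c F.w), ← h1, ← map_smul, ← map_neg, ← map_add, ← map_add]
    congr 1
    simp only [Matrix.add_mulVec, Matrix.sub_mulVec, Matrix.smul_mulVec, Matrix.mulVec_mulVec,
      Matrix.one_mulVec]
    rw [sub_eq_add_neg]
    rfl
  exact Matrix.ext_of_mulVec_single fun j => by rw [key, Matrix.zero_mulVec]

theorem quadRel : QuadRel Q (c 0) F.mat := quadRel_of_polyQuadRel F.mat_zero F.polyQuadRel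

end NormalFrame

section Construction

variable {r : ℕ} (D : V →ₗ[k] Matrix (Fin r) (Fin r) k)

/-- The free module over the polynomial subring on which the zeroth coordinate acts by a matrix of
linear polynomials. -/
def matAction (D : V →ₗ[k] Matrix (Fin r) (Fin r) k) (h : PolyQuadRel Q b c D) :
    QuadricRing Q b →+* Module.End (MvPolynomial (Fin d) k) (Fin r → MvPolynomial (Fin d) k) :=
  (Ideal.Quotient.lift (Ideal.span {quadricPolynomial Q b c})
    (Polynomial.aeval (-(restMatrix c D).mulVecLin)).toRingHom (by
      intro a ha
      obtain ⟨a, rfl⟩ := Ideal.mem_span_singleton'.1 ha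
      have : Polynomial.aeval (-(restMatrix c D).mulVecLin) (quadricPolynomial Q b c) = 0 := by
        refine LinearMap.ext fun g => ?_
        have h1 := congrArg (fun N => N.mulVec g) h
        simp only [Matrix.add_mulVec, Matrix.sub_mulVec, Matrix.smul_mulVec,
          Matrix.one_mulVec, Matrix.zero_mulVec] at h1
        rw [LinearMap.zero_apply, ← h1]
        simp only [quadricPolynomial, map_add, map_mul, Polynomial.aeval_C,
          Polynomial.aeval_X, LinearMap.add_apply, Module.End.mul_apply, pow_two,
          Module.algebraMap_end_apply, LinearMap.neg_apply, map_neg, Matrix.mulVecLin_apply,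
          neg_neg, Matrix.mulVec_mulVec, sub_eq_add_neg]
        congr 2
        ext1 i
        simp [MvPolynomial.smul_eq_C_mul]
      change Polynomial.aeval _ (a * _) = 0
      rw [map_mul, this, mul_zero])).comp (toPolyQuot Q b c : QuadricRing Q b →+* _)

variable {D}

theorem matAction_coordHom (h : PolyQuadRel Q b c D) (s : MvPolynomial (Fin d) k)
    (g : Fin r → MvPolynomial (Fin d) k) : matAction D h (coordHom Q b c s) g = s • g := by
  rw [matAction, RingHom.comp_apply]
  erw [toPolyQuot_coordHom, Ideal.Quotient.lift_mk]
  change (Polynomial.aeval (-(restMatrix c D).mulVecLin) _ :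
    Module.End (MvPolynomial (Fin d) k) (Fin r → MvPolynomial (Fin d) k)) g = _
  rw [Polynomial.aeval_C]
  rfl

theorem matAction_coordZero (h : PolyQuadRel Q b c D) (g : Fin r → MvPolynomial (Fin d) k) :
    matAction D h (coordZero Q b c) g = -(restMatrix c D).mulVec g := by
  rw [matAction, RingHom.comp_apply]
  erw [toPolyQuot_coordZero, Ideal.Quotient.lift_mk]
  change (Polynomial.aeval (-(restMatrix c D).mulVecLin) _ :
    Module.End (MvPolynomial (Fin d) k) (Fin r → MvPolynomial (Fin d) k)) g = _
  rw [Polynomial.aeval_X]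
  rfl

theorem restMatrix_mulVec_mem {e : ℤ} {g : Fin r → MvPolynomial (Fin d) k}
    (hg : ∀ j, g j ∈ polyGr k (Fin d) e) (i : Fin r) :
    (restMatrix c D).mulVec g i ∈ polyGr k (Fin d) (e + 1) := by
  rw [add_comm, Matrix.mulVec, dotProduct]
  exact Submodule.sum_mem _ fun j _ => polyGr_mul (restMat_mem i j) (hg j)

/-- The graded module presented by a matrix of linear forms. -/
def matMod (ha : Q (c 0) ≠ 0) (h : PolyQuadRel Q b c D) : GrMod Q b :=
  letI : Module (QuadricRing Q b) (Fin r → MvPolynomial (Fin d) k) :=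
    Module.compHom _ (matAction D h)
  { carrier := Fin r → MvPolynomial (Fin d) k
    gr := fun e => AddSubgroup.pi Set.univ fun _ => (polyGr k (Fin d) e).toAddSubgroup
    isInternal := isInternal_of_polyGr _ (AddMonoidHom.id _) Function.bijective_id fun e a => by
      simp [AddSubgroup.mem_pi]
    smul_mem := fun e f s m hs hm => by
      simp only [AddSubgroup.mem_pi, Set.mem_univ, true_imp_iff, Submodule.mem_toAddSubgroup]
        at hm ⊢
      obtain ⟨α, hα, β, hβ, rfl⟩ := exists_eq_of_mem_ringGr Q b c ha hs
      intro j
      change matAction D h _ m j ∈ _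
      rw [map_add, map_mul, LinearMap.add_apply, Module.End.mul_apply, matAction_coordHom,
        matAction_coordHom, matAction_coordZero]
      refine Submodule.add_mem _ (polyGr_mul hα (hm j)) ?_
      have := polyGr_mul hβ (Submodule.neg_mem _ (restMatrix_mulVec_mem (c := c) (D := D) hm j))
      rw [show e - 1 + (f + 1) = e + f by ring] at this
      exact this }

/-- The standard basis is a frame by construction, so every solution of the relation is realized by
a linear MCM module. -/
theorem exists_matMod_frame (ha : Q (c 0) ≠ 0) (hD : D (c 0) = 1) (h : PolyQuadRel Q b c D) :
    ∃ F : NormalFrame c (matMod ha h) r, F.mat = D := by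
  let w : Fin r → (matMod ha h).carrier := fun j =>
    (Pi.single j 1 : Fin r → MvPolynomial (Fin d) k)
  have h1 : ∀ a : Fin r → MvPolynomial (Fin d) k, ∑ j, coordHom Q b c (a j) • w j = a := by
    intro a
    change ∑ j, matAction D h (coordHom Q b c (a j)) (Pi.single j 1) = a
    simp only [matAction_coordHom]
    exact (pi_eq_sum_univ' a).symm
  refine ⟨⟨w, ?_, fun e a => ?_, D, hD, fun j => ?_⟩, rfl⟩
  · simp only [h1]
    exact Function.bijective_id
  · rw [h1]
    exact ⟨fun h j => h j trivial, fun h j _ => h j⟩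
  · simp only [linMat_eq (Q := Q) (b := b) hD, add_smul, Finset.sum_add_distrib, ite_smul,
      zero_smul, Finset.sum_ite_eq', Finset.mem_univ, if_true, h1]
    have h2 : coordZero Q b c • w j = -(restMatrix c D).mulVec (Pi.single j 1) :=
      matAction_coordZero h _
    rw [h2]
    change (fun i => restMat c D i j) + -(restMatrix c D).mulVec (Pi.single j 1) = 0
    rw [Matrix.mulVec_single_one, ← sub_eq_add_neg, sub_eq_zero]
    rfl

end Construction

section Syzygy

/-- The family of matrices attached to the first syzygy module. -/
def syzMat {r : ℕ} (Q : QuadraticForm k V) (v₀ : V) (D : V →ₗ[k] Matrix (Fin r) (Fin r) k) :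
    V →ₗ[k] Matrix (Fin r) (Fin r) k :=
  (Q v₀)⁻¹ • (QuadraticMap.polarBilin Q v₀).smulRight 1 - D

theorem syzMat_apply {r : ℕ} (v₀ : V) (D : V →ₗ[k] Matrix (Fin r) (Fin r) k) (v : V) :
    syzMat Q v₀ D v = (Q v₀)⁻¹ • QuadraticMap.polar Q v₀ v • 1 - D v := rfl

theorem syzMat_zero {r : ℕ} {v₀ : V} (ha : Q v₀ ≠ 0) {D : V →ₗ[k] Matrix (Fin r) (Fin r) k}
    (hD : D v₀ = 1) : syzMat Q v₀ D v₀ = 1 := by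
  rw [syzMat_apply, hD, QuadraticMap.polar_self, smul_smul, nsmul_eq_mul, mul_left_comm,
    inv_mul_cancel₀ ha]
  module

variable {r : ℕ} {D : V →ₗ[k] Matrix (Fin r) (Fin r) k}

theorem restMatrix_syzMat : restMatrix c (syzMat Q (c 0) D) =
    ((Q (c 0))⁻¹ • linCoeff Q c) • 1 - restMatrix c D := by
  ext1 i j
  simp only [restMatrix_apply, restMat, syzMat_apply, Matrix.sub_apply, Matrix.smul_apply,
    Matrix.one_apply, sub_smul, Finset.sum_sub_distrib, linCoeff, Finset.smul_sum]
  congr 1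
  by_cases h : i = j
  · simp [h, mul_smul]
  · simp [h]

theorem linMat_mulVec (hD : D (c 0) = 1) (a : Fin r → MvPolynomial (Fin d) k) (i : Fin r) :
    ∑ j, linMat Q b D i j * coordHom Q b c (a j) =
      coordHom Q b c ((restMatrix c D).mulVec a i) + coordHom Q b c (a i) * coordZero Q b c :=
  sum_linMat_mul hD i a

/-- N and −x are both roots of t² − lt + q, and the second factor is the conjugate of the first.
This is the matrix factorization of the quadric, read modulo the quadric. -/
theorem add_smul_mul_eq_zero {R A : Type*} [CommRing R] [Ring A] [Algebra R A] {N : A} {x l q : R}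
    (hx : x * x = -(q + l * x)) (hN : N * N - l • N + q • 1 = 0) :
    (N + x • 1) * (l • 1 - N + x • 1) = 0 := by
  have h : N * N = l • N - q • 1 := by
    rw [← sub_eq_zero, ← hN]; abel
  simp only [add_mul, mul_add, mul_sub, smul_mul_assoc, mul_smul_comm, one_mul, mul_one, smul_smul,
    smul_add, hx, h]
  module

theorem linMat_mul_syzMat (ha : Q (c 0) ≠ 0) (hD : D (c 0) = 1) (h : PolyQuadRel Q b c D) :
    linMat Q b D * linMat Q b (syzMat Q (c 0) D) = 0 := by
  let f : Matrix (Fin r) (Fin r) (MvPolynomial (Fin d) k) →ₐ[k]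
      Matrix (Fin r) (Fin r) (QuadricRing Q b) := (coordHom Q b c).mapMatrix
  have key : ∀ {D : V →ₗ[k] Matrix (Fin r) (Fin r) k}, D (c 0) = 1 →
      linMat Q b D = f (restMatrix c D) + coordZero Q b c • 1 := by
    intro D hD
    ext1 i j
    rw [linMat_eq hD, Matrix.add_apply, Matrix.smul_apply, Matrix.one_apply, smul_ite, smul_zero,
      smul_eq_mul, mul_one]
    rfl
  have hs : ∀ (s : MvPolynomial (Fin d) k) N, f (s • N) = coordHom Q b c s • f N := by
    intro s N
    ext i j
    simp [f]
  rw [key hD, key (syzMat_zero ha hD), restMatrix_syzMat, map_sub, hs, map_one]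
  have h1 := congrArg f h
  rw [map_add, map_sub, map_smul f, hs, hs, map_mul, map_one, map_zero f] at h1
  have h2 := congrArg ((Q (c 0))⁻¹ • ·) h1
  simp only [smul_add, smul_sub, inv_smul_smul₀ ha, smul_zero] at h2
  have h3 := coordZero_sq Q b c ha
  refine add_smul_mul_eq_zero (q := coordHom Q b c ((Q (c 0))⁻¹ • constCoeff Q b c)) ?_ ?_
  · rw [← pow_two, h3]
  · rw [map_smul (coordHom Q b c), map_smul (coordHom Q b c), smul_assoc, smul_assoc]
    exact h2

theorem FirstSyzygy.π_apply {N : GrMod Q b} (σ : FirstSyzygy M N)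
    (f : Fin σ.rank → QuadricRing Q b) : σ.π f = ∑ j, f j • σ.π (Pi.single j 1) := by
  conv_lhs => rw [pi_eq_sum_univ' f]
  rw [map_sum]
  exact Finset.sum_congr rfl fun j _ => map_smul _ _ _

/-- The columns of the presentation matrix are a basis of the syzygies over the polynomial subring,
and the conjugate matrix supplies the relations between them. -/
theorem NormalFrame.exists_syzygy_frame (ha : Q (c 0) ≠ 0) {N : GrMod Q b} (σ : FirstSyzygy M N)
    (F : NormalFrame c M σ.rank) (hF : ∀ j, F.w j = σ.π (Pi.single j 1)) :
    ∃ G : NormalFrame c N σ.rank, G.mat = syzMat Q (c 0) F.mat ∧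
      ∀ i j, σ.ι (G.w j) i = linMat Q b F.mat i j := by
  have h1 : ∀ j, ∃ x, σ.ι x = fun i => linMat Q b F.mat i j := fun j =>
    (σ.exact _).1 (by rw [σ.π_apply]; simp only [← hF]; exact F.rel j)
  choose w hw using h1
  have hι : ∀ a : Fin σ.rank → QuadricRing Q b, ∀ i,
      σ.ι (∑ j, a j • w j) i = ∑ j, linMat Q b F.mat i j * a j := by
    intro a i
    rw [map_sum, Finset.sum_apply]
    refine Finset.sum_congr rfl fun j _ => ?_
    rw [map_smul, hw, Pi.smul_apply, smul_eq_mul, mul_comm]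
  refine ⟨⟨w, ⟨?_, ?_⟩, ?_, syzMat Q (c 0) F.mat, syzMat_zero ha F.mat_zero, ?_⟩, rfl,
    fun i j => congrFun (hw j) i⟩
  · intro a a' h
    funext i
    have h2 := congrFun (congrArg σ.ι h) i
    simp only [hι, linMat_mulVec F.mat_zero] at h2
    -- The zeroth coordinate occurs in row i with coefficient a_i, so a is recovered from the
    -- syzygy.
    exact (coordHom_add_inj Q b c ha h2).2
  · intro x
    obtain ⟨β, hβ⟩ := F.exists_eq_sum_linMat_mul ha (f := σ.ι x) (by
      simp only [hF]
      rw [← σ.π_apply]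
      exact (σ.exact _).2 ⟨x, rfl⟩)
    refine ⟨β, σ.ι_injective (funext fun i => ?_)⟩
    simp only [hι]
    exact (hβ i).symm
  · intro e a
    rw [σ.mem_gr_iff]
    simp only [hι, linMat_mulVec F.mat_zero, mem_ringGr_iff Q b c ha, add_sub_cancel_right]
    -- The shift by one in the grading of the syzygy matches the degree of the zeroth coordinate,
    -- whose coefficients therefore have degree e.
    exact ⟨fun h j => (h j).2, fun h j => ⟨restMatrix_mulVec_mem h j, h j⟩⟩
  · intro j
    refine σ.ι_injective (funext fun i => ?_)
    rw [hι, map_zero σ.ι, Pi.zero_apply]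
    have := congrFun (congrFun (linMat_mul_syzMat (b := b) ha F.mat_zero F.polyQuadRel) i) j
    rwa [Matrix.mul_apply] at this

variable {r : ℕ} (F : NormalFrame c M r)

/-- The first syzygy module of a graded module with a frame. -/
def NormalFrame.syz (ha : Q (c 0) ≠ 0) : GrMod Q b where
  carrier := LinearMap.ker (Fintype.linearCombination (QuadricRing Q b) F.w)
  gr e :=
    { carrier := {s | ∀ j, s.1 j ∈ ringGr Q b (e + 1)}
      add_mem' := fun hs ht j => Submodule.add_mem _ (hs j) (ht j)
      zero_mem' := fun j => Submodule.zero_mem _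
      neg_mem' := fun hs j => Submodule.neg_mem _ (hs j) }
  isInternal := by
    let φ : (Fin r → MvPolynomial (Fin d) k) →+
        LinearMap.ker (Fintype.linearCombination (QuadricRing Q b) F.w) :=
      { toFun := fun a => ⟨fun i => ∑ j, linMat Q b F.mat i j * coordHom Q b c (a j), by
          rw [LinearMap.mem_ker, Fintype.linearCombination_apply]
          exact F.sum_linMat_mul_smul _⟩
        map_zero' := by ext; simp
        map_add' := fun a a' => by ext; simp [mul_add, Finset.sum_add_distrib] }
    have hφ : ∀ a i, (φ a).1 i = coordHom Q b c ((restMatrix c F.mat).mulVec a i) +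
      coordHom Q b c (a i) * coordZero Q b c := fun a i => linMat_mulVec F.mat_zero a i
    refine isInternal_of_polyGr _ φ ⟨fun a a' h => funext fun i => ?_, fun x => ?_⟩ fun e a => ?_
    · have h2 := congrFun (congrArg Subtype.val h) i
      rw [hφ, hφ] at h2
      exact (coordHom_add_inj Q b c ha h2).2
    · obtain ⟨β, hβ⟩ := F.exists_eq_sum_linMat_mul ha (f := x.1)
        ((Fintype.linearCombination_apply _ _ _).symm.trans x.2)
      exact ⟨β, Subtype.ext (funext fun i => (hβ i).symm)⟩
    · change (∀ j, (φ a).1 j ∈ ringGr Q b (e + 1)) ↔ _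
      simp only [hφ, mem_ringGr_iff Q b c ha, add_sub_cancel_right]
      exact ⟨fun h j => (h j).2, fun h j => ⟨restMatrix_mulVec_mem h j, h j⟩⟩
  smul_mem e f s m hs hm j := by
    rw [add_assoc]
    exact ringGr_mul Q b hs (hm j)

theorem NormalFrame.nonempty_firstSyzygy (ha : Q (c 0) ≠ 0) :
    Nonempty (FirstSyzygy M (F.syz ha)) :=
  ⟨{ rank := r
     π := Fintype.linearCombination (QuadricRing Q b) F.w
     ι := Submodule.subtype _
     π_surjective := F.surjective
     ι_injective := Subtype.val_injective
     exact := fun f => by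
      rw [← LinearMap.mem_ker]
      exact ⟨fun h => ⟨⟨f, h⟩, rfl⟩, by rintro ⟨x, rfl⟩; exact x.2⟩
     minimal := fun s j => by
      obtain ⟨β, hβ⟩ := F.exists_eq_sum_linMat_mul ha (f := s.1)
        ((Fintype.linearCombination_apply _ _ _).symm.trans s.2)
      change s.1 j ∈ _
      rw [hβ]
      exact Ideal.sum_mem _ fun i _ => Ideal.mul_mem_right _ _ (linForm_mem_irrelevant Q b _)
     π_mem := fun e f hf => by
      rw [Fintype.linearCombination_apply]
      refine AddSubgroup.sum_mem _ fun j _ => ?_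
      have := M.smul_mem e 0 _ _ (hf j) (F.w_mem j)
      rwa [add_zero] at this
     mem_gr_iff := fun e s => Iff.rfl }⟩

theorem FirstSyzygy.exists_frame (ha : Q (c 0) ≠ 0) (hM : isLinearMCM Q b M) {N : GrMod Q b}
    (σ : FirstSyzygy M N) :
    ∃ F : NormalFrame c M σ.rank, ∀ j, F.w j = σ.π (Pi.single j 1) := by
  obtain ⟨F, hF⟩ := exists_normalFrame_of_irrelevant (c := c)
    (w := fun j => σ.π (Pi.single j 1)) (fun m => by
      obtain ⟨f, rfl⟩ := σ.π_surjective m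
      exact ⟨f, (σ.π_apply f).symm⟩) ha (fun j => σ.π_mem 0 _ fun l => by
        by_cases h : l = j
        · subst h
          rw [Pi.single_eq_same, ← map_one (algebraMap k (QuadricRing Q b))]
          exact algebraMap_mem_ringGr Q b 1
        · rw [Pi.single_eq_of_ne h]; exact Submodule.zero_mem _) (fun f hf j => by
      rw [← σ.π_apply] at hf
      obtain ⟨s, rfl⟩ := (σ.exact f).1 hf
      exact σ.minimal s j) hM
  exact ⟨F, fun j => congrFun hF j⟩

end Syzygy

end

end QuadricMCM

/-! ### Fibers at the vertex and the operators on them. -/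

namespace QuadricMCM

noncomputable section

variable {k : Type u} [Field k] {V : Type v} [AddCommGroup V] [Module k V] {n : ℕ}
  {Q : QuadraticForm k V} {b : Module.Basis (Fin n) k V}
  {d : ℕ} {c : Module.Basis (Fin (d + 1)) k V} {M N : GrMod Q b}

namespace Fiber

theorem mk_add (x y : M.carrier) : mk (x + y) = mk x + mk y :=
  TensorProduct.tmul_add _ _ _

theorem mk_zero : mk (0 : M.carrier) = 0 := TensorProduct.tmul_zero _ _

theorem mk_sum {ι : Type*} (s : Finset ι) (x : ι → M.carrier) :
    mk (∑ i ∈ s, x i) = ∑ i ∈ s, mk (x i) := TensorProduct.tmul_sum _ _ _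

theorem mk_smul (t : k) (x : M.carrier) : mk (t • x) = t • mk x := by
  change (1 : ResField Q b) ⊗ₜ[QuadricRing Q b] (algebraMap k (QuadricRing Q b) t • x) =
    (t • (1 : ResField Q b)) ⊗ₜ[QuadricRing Q b] x
  rw [← TensorProduct.smul_tmul]
  congr 1
  rw [algebraMap_smul]

theorem mk_smul_ring (s : QuadricRing Q b) (x : M.carrier) :
    mk (s • x) = vertexEval Q b s • mk x := by
  have h : (s - algebraMap k _ (vertexEval Q b s)) • (1 : ResField Q b) = 0 := by
    rw [Algebra.smul_def, mul_one]
    exact Ideal.Quotient.eq_zero_iff_mem.2 (sub_vertexEval_mem Q b s)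
  have h1 : mk ((s - algebraMap k _ (vertexEval Q b s)) • x) = 0 := by
    change (1 : ResField Q b) ⊗ₜ[QuadricRing Q b] (_ • x) = 0
    rw [← TensorProduct.smul_tmul, h, TensorProduct.zero_tmul]
  rw [← mk_smul, ← algebraMap_smul (QuadricRing Q b) (vertexEval Q b s) x]
  conv_lhs => rw [← sub_add_cancel s (algebraMap k _ (vertexEval Q b s)), add_smul, mk_add, h1,
    zero_add]

theorem mk_surjective : Function.Surjective (mk : M.carrier → Fiber M) := by
  intro x
  induction x using TensorProduct.induction_on with
  | zero => exact ⟨0, mk_zero⟩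
  | tmul s x =>
    obtain ⟨s, rfl⟩ := Ideal.Quotient.mk_surjective s
    refine ⟨s • x, ?_⟩
    change (1 : ResField Q b) ⊗ₜ[QuadricRing Q b] (s • x) = _
    rw [← TensorProduct.smul_tmul, Algebra.smul_def, mul_one]
    rfl
  | add x y hx hy =>
    obtain ⟨x', rfl⟩ := hx
    obtain ⟨y', rfl⟩ := hy
    exact ⟨x' + y', mk_add _ _⟩

theorem mem_of_mk_eq_zero {x : M.carrier} (h : mk x = 0) :
    x ∈ irrelevant Q b • (⊤ : Submodule (QuadricRing Q b) M.carrier) := by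
  have h1 := congrArg (TensorProduct.quotTensorEquivQuotSMul M.carrier (irrelevant Q b)) h
  erw [TensorProduct.quotTensorEquivQuotSMul_mk_tmul _ 1 x, map_zero, one_smul] at h1
  exact (Submodule.Quotient.mk_eq_zero _).1 h1

theorem map_mk (f : M ⟶ N) (x : M.carrier) : map f (mk x) = mk (GrMod.Hom.toLin f x) := rfl

end Fiber

namespace NormalFrame

variable {r : ℕ} (F : NormalFrame c M r) (ha : Q (c 0) ≠ 0)

include F ha in
-- The zeroth coordinate contributes nothing new by `coordZero_smul_mem`, so k ⊗ M is M modulo the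
-- polynomial variables, and a frame reduces to a k-basis.
theorem irrelevant_smul_le : irrelevant Q b • (⊤ : Submodule (QuadricRing Q b) M.carrier) ≤
    Ideal.ofList (coordList Q b c) • ⊤ := by
  refine Submodule.smul_le.2 fun s hs m _ => ?_
  obtain ⟨α, β, rfl⟩ := exists_eq_coordHom_add Q b c ha s
  rw [mem_irrelevant, map_add, map_mul, vertexEval_coordHom, coordZero, vertexEval_linForm,
    mul_zero, add_zero] at hs
  rw [add_smul, mul_smul]
  refine Submodule.add_mem _ (Submodule.smul_mem_smul ?_ trivial)
    (Submodule.smul_mem _ _ (F.coordZero_smul_mem m))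
  have := map_sub_constantCoeff_mem
    (coordHom Q b c : MvPolynomial (Fin d) k →+* QuadricRing Q b) α
  rwa [hs, map_zero, map_zero, sub_zero] at this

/-- The basis of the fiber given by a frame. -/
def basis : Module.Basis (Fin r) k (Fiber M) :=
  Module.Basis.mk (v := fun j => Fiber.mk (F.w j)) (by
    rw [Fintype.linearIndependent_iff]
    intro t ht j
    simp only [← Fiber.mk_smul, ← Fiber.mk_sum] at ht
    have h1 := F.irrelevant_smul_le ha (Fiber.mem_of_mk_eq_zero ht)
    have h2 : ∑ j, t j • F.w j = ∑ j, coordHom Q b c (MvPolynomial.C (t j)) • F.w j :=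
      Finset.sum_congr rfl fun j _ => by
        have : coordHom Q b c (MvPolynomial.C (t j)) = algebraMap k _ (t j) :=
          (coordHom Q b c).commutes _
        rw [this, algebraMap_smul]
    rw [h2] at h1
    simpa using constantCoeff_eq_zero_of_mem_smul_top F.bijective' h1 j) (by
    rintro x -
    obtain ⟨x, rfl⟩ := Fiber.mk_surjective x
    obtain ⟨f, rfl⟩ := F.surjective x
    rw [Fintype.linearCombination_apply, Fiber.mk_sum]
    refine Submodule.sum_mem _ fun j _ => ?_
    rw [Fiber.mk_smul_ring]
    exact Submodule.smul_mem _ _ (Submodule.subset_span ⟨j, rfl⟩))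

theorem basis_apply (j : Fin r) : F.basis ha j = Fiber.mk (F.w j) :=
  Module.Basis.mk_apply _ _ _

/-- The endomorphisms of the fiber given by the presentation matrix. -/
def fiberEnd : V →ₗ[k] Module.End k (Fiber M) :=
  (Matrix.toLinAlgEquiv (F.basis ha)).toLinearMap ∘ₗ F.mat

theorem fiberEnd_apply (v : V) :
    F.fiberEnd ha v = Matrix.toLinAlgEquiv (F.basis ha) (F.mat v) := rfl

theorem fiberEnd_mk (v : V) (j : Fin r) :
    F.fiberEnd ha v (Fiber.mk (F.w j)) = ∑ i, F.mat v i j • Fiber.mk (F.w i) := by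
  rw [fiberEnd_apply, ← F.basis_apply ha, Matrix.toLinAlgEquiv_self]
  simp only [basis_apply]

theorem fiberEnd_zero : F.fiberEnd ha (c 0) = 1 := by
  rw [fiberEnd_apply, F.mat_zero, map_one]

theorem quadRel_fiberEnd : QuadRel Q (c 0) (F.fiberEnd ha) := by
  intro v
  have h := congrArg (Matrix.toLinAlgEquiv (F.basis ha)) (F.quadRel v)
  simp only [map_add, map_sub, map_smul, map_mul, map_one, map_zero] at h
  exact h

variable {r' : ℕ} (G : NormalFrame c N r')

include ha in
/-- A morphism is given by a constant matrix in terms of frames. -/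
theorem exists_matrix (f : M ⟶ N) : ∃ P : Matrix (Fin r') (Fin r) k,
    (∀ j, GrMod.Hom.toLin f (F.w j) = ∑ i, P i j • G.w i) ∧
      ∀ v, P * F.mat v = G.mat v * P := by
  have h1 : ∀ j, ∃ p : Fin r' → k, GrMod.Hom.toLin f (F.w j) = ∑ i, p i • G.w i := by
    intro j
    obtain ⟨a, h⟩ := G.bijective.2 (GrMod.Hom.toLin f (F.w j))
    change ∑ j, coordHom Q b c (a j) • G.w j = _ at h
    have h0 : ∀ i, a i ∈ polyGr k (Fin d) 0 := (G.sum_mem_iff 0 a).1 (by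
      rw [h]
      exact f.map_mem 0 _ (F.w_mem j))
    refine ⟨fun i => MvPolynomial.constantCoeff (a i), ?_⟩
    rw [← h]
    refine Finset.sum_congr rfl fun i _ => ?_
    rw [← algebraMap_smul (QuadricRing Q b) (MvPolynomial.constantCoeff (a i))]
    conv_lhs => rw [polyGr_zero (h0 i)]
    congr 1
    exact (coordHom Q b c).commutes _
  choose p hp using h1
  refine ⟨Matrix.of fun i j => p j i, hp, fun v => ?_⟩
  ext i j
  let g : Fin r' → Module.Dual k V := fun i => ∑ l, p l i • matEntry F.mat l j
  let g' : Fin r' → Module.Dual k V := fun i => ∑ l, p j l • matEntry G.mat i l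
  -- Apply f to the jth relation of F: the outcome is a relation between the vectors of G with
  -- linear coefficients, hence the combination of columns of G given by its values at c 0, which
  -- are the entries of the constant matrix.
  have h2 : ∑ i, linForm Q b (g i) • G.w i = 0 := by
    have h3 := congrArg (GrMod.Hom.toLin f) (F.rel j)
    rw [map_sum, map_zero] at h3
    rw [← h3]
    simp only [map_smul, hp, g, map_sum, Finset.sum_smul, Finset.smul_sum, linMat_apply]
    rw [Finset.sum_comm]
    refine Finset.sum_congr rfl fun l _ => Finset.sum_congr rfl fun i _ => ?_
    rw [smul_assoc, smul_comm]
  have h4 := G.eq_sum_linMat_mul (fun i => linForm_eq_add Q b c (g i)) h2 i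
  have h5 : ∀ l, g l (c 0) = p j l := by
    intro l
    simp [g, matEntry_apply, F.mat_zero, Matrix.one_apply]
  have h6 : linForm Q b (g i) = linForm Q b (g' i) := by
    rw [h4]
    simp only [h5, g', map_sum, linMat_apply, map_smul]
    refine Finset.sum_congr rfl fun l _ => ?_
    rw [Algebra.smul_def, mul_comm]
    congr 1
    exact (coordHom Q b c).commutes _
  have h7 := LinearMap.congr_fun (linForm_injective Q b c ha h6) v
  simpa [g, g', matEntry_apply, Matrix.mul_apply, mul_comm] using h7

theorem map_fiberEnd (f : M ⟶ N) (v : V) (x : Fiber M) :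
    Fiber.map f (F.fiberEnd ha v x) = G.fiberEnd ha v (Fiber.map f x) := by
  obtain ⟨P, hP, hPD⟩ := F.exists_matrix ha G f
  have hmk : ∀ j, Fiber.map f (Fiber.mk (F.w j)) = ∑ i, P i j • Fiber.mk (G.w i) := by
    intro j
    rw [Fiber.map_mk, hP, Fiber.mk_sum]
    simp only [Fiber.mk_smul]
  have h : (Fiber.map f).comp (F.fiberEnd ha v) = (G.fiberEnd ha v).comp (Fiber.map f) := by
    refine (F.basis ha).ext fun j => ?_
    simp only [LinearMap.comp_apply, basis_apply, fiberEnd_mk, map_sum, map_smul, hmk,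
      Finset.smul_sum, smul_smul]
    rw [Finset.sum_comm]
    conv_rhs => rw [Finset.sum_comm]
    refine Finset.sum_congr rfl fun i _ => ?_
    rw [← Finset.sum_smul, ← Finset.sum_smul]
    congr 1
    have h1 := congrFun (congrFun (hPD v) i) j
    simp only [Matrix.mul_apply] at h1
    simpa only [mul_comm] using h1
  exact LinearMap.congr_fun h x

end NormalFrame

end

end QuadricMCM

/-! ### Representations of the even Clifford algebra. -/

namespace QuadricMCM

noncomputable section

variable {k : Type u} [Field k] {V : Type v} [AddCommGroup V] [Module k V] {n : ℕ}
  {Q : QuadraticForm k V} {b : Module.Basis (Fin n) k V}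
  {d : ℕ} {c : Module.Basis (Fin (d + 1)) k V} {M N : GrMod Q b}

section EvenClifford

variable {A : Type*} [Ring A] [Algebra k A] {v₀ : V} {T : V →ₗ[k] A}

/-- T v stands for v v₀ / Q(v₀); the second factor then stands for v₀ v, and the product is v² =
Q(v). -/
theorem QuadRel.mul_polar_sub (h : QuadRel Q v₀ T) (v : V) :
    T v * (QuadraticMap.polar Q v₀ v • 1 - Q v₀ • T v) = algebraMap k A (Q v) := by
  rw [← sub_eq_zero, ← neg_eq_zero, ← h v, Algebra.algebraMap_eq_smul_one]
  simp only [mul_sub, mul_smul_comm, mul_one]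
  abel

theorem QuadRel.polar_sub_mul (h : QuadRel Q v₀ T) (v : V) :
    (QuadraticMap.polar Q v₀ v • 1 - Q v₀ • T v) * T v = algebraMap k A (Q v) := by
  rw [← h.mul_polar_sub]
  simp only [sub_mul, mul_sub, smul_mul_assoc, mul_smul_comm, one_mul, mul_one]

/-- The bilinear map on vectors attached to a solution of the quadratic relation. -/
def QuadRel.evenHom (h : QuadRel Q v₀ T) : CliffordAlgebra.EvenHom Q A where
  -- This models the product u v as (u v₀ / Q(v₀)) · (v₀ v).
  bilin := LinearMap.mk₂ k (fun u v => T u * (QuadraticMap.polar Q v₀ v • 1 - Q v₀ • T v))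
    (fun _ _ _ => by rw [map_add, add_mul])
    (fun _ _ _ => by rw [map_smul, smul_mul_assoc])
    (fun _ _ _ => by
      rw [← mul_add, map_add, QuadraticMap.polar_add_right]
      congr 1
      module)
    (fun t _ v => by
      rw [← mul_smul_comm, map_smul, QuadraticMap.polar_smul_right, smul_eq_mul]
      congr 1
      module)
  contract v := h.mul_polar_sub v
  contract_mid u v w := by
    simp only [LinearMap.mk₂_apply]
    rw [mul_assoc, ← mul_assoc _ (T v), h.polar_sub_mul, Algebra.left_comm, ← Algebra.smul_def]

/-- The action of the even Clifford algebra attached to a solution of the quadratic relation. -/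
def QuadRel.evenLift (h : QuadRel Q v₀ T) : CliffordAlgebra.even Q →ₐ[k] A :=
  CliffordAlgebra.even.lift Q h.evenHom

theorem QuadRel.evenLift_ι (h : QuadRel Q v₀ T) (u v : V) :
    h.evenLift ((CliffordAlgebra.even.ι Q).bilin u v) =
      T u * (QuadraticMap.polar Q v₀ v • 1 - Q v₀ • T v) :=
  CliffordAlgebra.even.lift_ι _ _ _ _

theorem QuadRel.evenLift_ι_self (h : QuadRel Q v₀ T) (hT : T v₀ = 1) (u : V) :
    h.evenLift ((CliffordAlgebra.even.ι Q).bilin u v₀) = Q v₀ • T u := by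
  rw [h.evenLift_ι, hT, QuadraticMap.polar_self, ← sub_smul, two_nsmul, add_sub_cancel_right,
    mul_smul_comm, mul_one]

variable {X Y : Type*} [AddCommGroup X] [Module k X] [AddCommGroup Y] [Module k Y]

theorem map_even_of_map_bilin (f : X →ₗ[k] Y) (φ : CliffordAlgebra.even Q →ₐ[k] Module.End k X)
    (ψ : CliffordAlgebra.even Q →ₐ[k] Module.End k Y)
    (h : ∀ u v x, f (φ ((CliffordAlgebra.even.ι Q).bilin u v) x) =
      ψ ((CliffordAlgebra.even.ι Q).bilin u v) (f x)) (a : CliffordAlgebra.even Q) (x : X) :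
    f (φ a x) = ψ a (f x) := by
  obtain ⟨a, ha⟩ := a
  induction a, ha using CliffordAlgebra.even_induction generalizing x with
  | algebraMap r =>
    have h1 := φ.commutes r
    have h2 := ψ.commutes r
    erw [h1, h2]
    simp
  | add y z hy hz ihy ihz =>
    have h1 := map_add φ ⟨y, hy⟩ ⟨z, hz⟩
    have h2 := map_add ψ ⟨y, hy⟩ ⟨z, hz⟩
    erw [h1, h2]
    simp only [LinearMap.add_apply, map_add]
    rw [ihy, ihz]
  | ι_mul_ι_mul u v y hy ih =>
    have h1 := map_mul φ ((CliffordAlgebra.even.ι Q).bilin u v) ⟨y, hy⟩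
    have h2 := map_mul ψ ((CliffordAlgebra.even.ι Q).bilin u v) ⟨y, hy⟩
    erw [h1, h2]
    simp only [Module.End.mul_apply]
    rw [h, ih]

theorem QuadRel.map_evenLift {T : V →ₗ[k] Module.End k X} {T' : V →ₗ[k] Module.End k Y}
    (h : QuadRel Q v₀ T) (h' : QuadRel Q v₀ T') (f : X →ₗ[k] Y)
    (hf : ∀ v x, f (T v x) = T' v (f x)) (a : CliffordAlgebra.even Q) (x : X) :
    f (h.evenLift a x) = h'.evenLift a (f x) := by
  refine map_even_of_map_bilin f _ _ (fun u v x => ?_) a x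
  rw [h.evenLift_ι, h'.evenLift_ι]
  simp [hf]

end EvenClifford

section Finiteness

variable (Q)

/-- The span of the ordered products of the vectors of a list in the Clifford algebra. -/
def orderedSpan : List V → Submodule k (CliffordAlgebra Q)
  | [] => 1
  | v :: l => orderedSpan l ⊔ (orderedSpan l).map (LinearMap.mulLeft k (CliffordAlgebra.ι Q v))

theorem orderedSpan_fg (l : List V) : (orderedSpan Q l).FG := by
  induction l with
  | nil => exact ⟨{1}, by rw [Finset.coe_singleton]; exact Submodule.one_eq_span.symm⟩
  | cons v l ih => exact ih.sup (ih.map _)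

theorem one_mem_orderedSpan (l : List V) : 1 ∈ orderedSpan Q l := by
  induction l with
  | nil => exact Submodule.one_le.1 le_rfl
  | cons v l ih => exact Submodule.mem_sup_left ih

/-- Move w past the first vector of the list by anticommutation up to a scalar, and collapse the
square of that vector. The point is finite dimension of the Clifford algebra. -/
theorem ι_mul_mem_orderedSpan (l : List V) {w : V} (hw : w ∈ Submodule.span k {x | x ∈ l})
    {x : CliffordAlgebra Q} (hx : x ∈ orderedSpan Q l) :
    CliffordAlgebra.ι Q w * x ∈ orderedSpan Q l := by
  induction l generalizing w x with
  | nil =>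
    have : w = 0 := by simpa using hw
    rw [this, map_zero, zero_mul]
    exact Submodule.zero_mem _
  | cons v l ih =>
    have hset : {x | x ∈ v :: l} = insert v {x | x ∈ l} := by ext; simp
    rw [hset, Submodule.mem_span_insert] at hw
    obtain ⟨t, w, hw, rfl⟩ := hw
    obtain ⟨y, hy, _, ⟨z, hz, rfl⟩, rfl⟩ := Submodule.mem_sup.1 hx
    have hv : ∀ u ∈ orderedSpan Q l, CliffordAlgebra.ι Q v * u ∈ orderedSpan Q (v :: l) :=
      fun u hu => Submodule.mem_sup_right ⟨u, hu, rfl⟩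
    rw [map_add, map_smul, add_mul, smul_mul_assoc, LinearMap.mulLeft_apply]
    refine Submodule.add_mem _ (Submodule.smul_mem _ _ ?_) ?_
    · rw [mul_add, ← mul_assoc, CliffordAlgebra.ι_sq_scalar, ← Algebra.smul_def]
      exact Submodule.add_mem _ (hv y hy) (Submodule.mem_sup_left (Submodule.smul_mem _ _ hz))
    · have h1 : CliffordAlgebra.ι Q w * CliffordAlgebra.ι Q v =
          algebraMap k _ (QuadraticMap.polar Q w v) - CliffordAlgebra.ι Q v * CliffordAlgebra.ι Q w := by
        rw [eq_sub_iff_add_eq, CliffordAlgebra.ι_mul_ι_add_swap]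
      rw [mul_add, ← mul_assoc, h1, sub_mul, ← Algebra.smul_def, mul_assoc]
      exact Submodule.add_mem _ (Submodule.mem_sup_left (ih hw hy))
        (Submodule.sub_mem _ (Submodule.mem_sup_left (Submodule.smul_mem _ _ hz))
          (hv _ (ih hw hz)))

include b in
theorem finite_cliffordAlgebra : Module.Finite k (CliffordAlgebra Q) := by
  let l := List.ofFn b
  have hl : Submodule.span k {x | x ∈ l} = ⊤ := by
    rw [← b.span_eq]
    congr 1
    ext x
    simp [l, List.mem_ofFn]
  refine ⟨?_⟩
  convert orderedSpan_fg Q l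
  refine (eq_top_iff.2 fun x _ => ?_).symm
  induction x using CliffordAlgebra.left_induction with
  | algebraMap r =>
    rw [Algebra.algebraMap_eq_smul_one]
    exact Submodule.smul_mem _ _ (one_mem_orderedSpan Q l)
  | add x y hx hy => exact Submodule.add_mem _ (hx trivial) (hy trivial)
  | ι_mul x m hx => exact ι_mul_mem_orderedSpan Q l (hl ▸ trivial) (hx trivial)

end Finiteness

section Action

variable {r : ℕ} (ha : Q (c 0) ≠ 0)

/-- The action of the even Clifford algebra on the fiber of a module with a frame. -/
def NormalFrame.act (F : NormalFrame c M r) :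
    CliffordAlgebra.even Q →ₐ[k] Module.End k (Fiber M) :=
  (F.quadRel_fiberEnd ha).evenLift

theorem NormalFrame.map_act (F : NormalFrame c M r) {r' : ℕ} (G : NormalFrame c N r') (f : M ⟶ N)
    (a : CliffordAlgebra.even Q) (x : Fiber M) :
    Fiber.map f (F.act ha a x) = G.act ha a (Fiber.map f x) :=
  (F.quadRel_fiberEnd ha).map_evenLift (G.quadRel_fiberEnd ha) _ (F.map_fiberEnd ha G f) a x

/-- Naturality for the identity morphism, seen through two frames, shows that the action does not
depend on the frame. -/
theorem NormalFrame.act_eq (F : NormalFrame c M r) {r' : ℕ} (G : NormalFrame c M r')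
    (a : CliffordAlgebra.even Q) (x : Fiber M) : F.act ha a x = G.act ha a x := by
  simpa only [Fiber.map_id] using F.map_act ha G (𝟙 M) a x

/-- A frame of a linear maximal Cohen-Macaulay module. -/
def someFrame (M : LinMCM Q b) :
    NormalFrame c M.obj (exists_normalFrame_of_isLinearMCM c ha M.property).choose :=
  (exists_normalFrame_of_isLinearMCM c ha M.property).choose_spec.some

variable (b) in
/-- The action of the even Clifford algebra on the fibers of linear maximal Cohen-Macaulay
modules. -/
def evenAction : EvenAction Q b where
  act M := (someFrame ha M).act ha
  naturality f a x := (someFrame ha _).map_act ha (someFrame ha _) f.hom a x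

end Action

end

end QuadricMCM

/-! ### The equivalence with finitely generated modules over the even Clifford algebra. -/

namespace QuadricMCM

noncomputable section

variable {k : Type u} [Field k] {V : Type v} [AddCommGroup V] [Module k V] {n : ℕ}
  {Q : QuadraticForm k V} {b : Module.Basis (Fin n) k V}
  {d : ℕ} {c : Module.Basis (Fin (d + 1)) k V} {M N : GrMod Q b}

namespace NormalFrame

variable {r : ℕ} (F : NormalFrame c M r) {r' : ℕ} (G : NormalFrame c N r') (ha : Q (c 0) ≠ 0)

include ha in
/-- A constant matrix which intertwines the presentation matrices gives a morphism. -/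
theorem exists_hom {P : Matrix (Fin r') (Fin r) k} (hP : ∀ v, P * F.mat v = G.mat v * P) :
    ∃ f : M ⟶ N, ∀ j, GrMod.Hom.toLin f (F.w j) = ∑ i, P i j • G.w i := by
  let R := QuadricRing Q b
  let π := Fintype.linearCombination R F.w
  let g := Fintype.linearCombination R fun j => ∑ i, P i j • G.w i
  have hg : ∀ f, g f = ∑ i, (∑ j, P i j • f j) • G.w i := by
    intro f
    rw [Fintype.linearCombination_apply]
    simp only [Finset.smul_sum, Finset.sum_smul]
    rw [Finset.sum_comm]
    refine Finset.sum_congr rfl fun i _ => Finset.sum_congr rfl fun j _ => ?_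
    rw [smul_assoc, smul_comm]
  have hker : LinearMap.ker π ≤ LinearMap.ker g := by
    intro f hf
    rw [LinearMap.mem_ker, Fintype.linearCombination_apply] at hf
    obtain ⟨β, hβ⟩ := F.exists_eq_sum_linMat_mul ha hf
    rw [LinearMap.mem_ker, hg, ← G.sum_linMat_mul_smul fun i => ∑ j, P i j • coordHom Q b c (β j)]
    refine Finset.sum_congr rfl fun i _ => ?_
    congr 1
    -- Since P intertwines the matrices, it maps each column of relations of F to a combination of
    -- columns of relations of G, so the map of free modules descends.
    have h1 : ∀ j, ∑ l, P i l • linMat Q b F.mat l j = ∑ l, P l j • linMat Q b G.mat i l := by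
      intro j
      simp only [linMat_apply, ← map_smul, ← map_sum]
      congr 1
      ext v
      have := congrFun (congrFun (hP v) i) j
      simpa [Matrix.mul_apply, matEntry_apply, mul_comm] using this
    simp only [hβ, Finset.smul_sum, Finset.mul_sum]
    rw [Finset.sum_comm]
    conv_rhs => rw [Finset.sum_comm]
    refine Finset.sum_congr rfl fun j _ => ?_
    have h2 := congrArg (· * coordHom Q b c (β j)) (h1 j)
    simpa only [Finset.sum_mul, smul_mul_assoc, mul_smul_comm] using h2
  let e := LinearMap.quotKerEquivOfSurjective π F.surjective
  let f : M.carrier →ₗ[R] N.carrier := (LinearMap.ker π).liftQ g hker ∘ₗ e.symm.toLinearMap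
  have hf : ∀ x, f (π x) = g x := by
    intro x
    have : e.symm (π x) = Submodule.Quotient.mk x := by
      rw [LinearEquiv.symm_apply_eq]; rfl
    change (LinearMap.ker π).liftQ g hker (e.symm (π x)) = _
    rw [this]
    rfl
  have hfw : ∀ j, f (F.w j) = ∑ i, P i j • G.w i := by
    intro j
    have h1 := hf (Pi.single j 1)
    simpa [π, g, Fintype.linearCombination_apply_single] using h1
  refine ⟨⟨f, fun e m hm => ?_⟩, hfw⟩
  obtain ⟨a, rfl⟩ := F.bijective.2 m
  have h1 := (F.sum_mem_iff e a).1 hm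
  rw [map_sum]
  refine sum_mem fun j _ => ?_
  rw [map_smul, hfw]
  have := N.smul_mem e 0 _ _ (coordHom_mem Q b c (h1 j))
    (sum_mem (t := Finset.univ) fun i _ => N.smul_mem_gr (P i j) (G.w_mem i))
  rwa [add_zero] at this

theorem hom_ext {f g : M ⟶ N}
    (h : ∀ j, GrMod.Hom.toLin f (F.w j) = GrMod.Hom.toLin g (F.w j)) : f = g := by
  refine GrMod.Hom.ext (LinearMap.ext fun m => ?_)
  obtain ⟨a, rfl⟩ := F.bijective.2 m
  simp only [map_sum, map_smul, h]

include F G ha in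
-- A morphism of degree zero has constant coefficients in terms of frames, and the fiber retains the
-- constants.
theorem fiberMap_injective {f g : M ⟶ N} (h : ∀ x, Fiber.map f x = Fiber.map g x) : f = g := by
  obtain ⟨P, hP, -⟩ := F.exists_matrix ha G f
  obtain ⟨P', hP', -⟩ := F.exists_matrix ha G g
  refine F.hom_ext fun j => ?_
  have h1 := h (Fiber.mk (F.w j))
  simp only [Fiber.map_mk, hP, hP', Fiber.mk_sum, Fiber.mk_smul, ← G.basis_apply ha] at h1
  rw [hP, hP']
  refine Finset.sum_congr rfl fun i _ => ?_
  have h2 := congrArg (fun x => (G.basis ha).repr x i) h1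
  simp only [map_sum, map_smul, Module.Basis.repr_self, Finsupp.finsetSum_apply,
    Finsupp.smul_apply, Finsupp.single_apply, smul_eq_mul, mul_ite, mul_one, mul_zero,
    Finset.sum_ite_eq', Finset.mem_univ, if_true] at h2
  rw [h2]

theorem exists_fiberMap_eq (φ : Fiber M →ₗ[k] Fiber N)
    (hφ : ∀ v x, φ (F.fiberEnd ha v x) = G.fiberEnd ha v (φ x)) :
    ∃ f : M ⟶ N, ∀ x, Fiber.map f x = φ x := by
  have h1 : ∀ v, LinearMap.toMatrix (F.basis ha) (G.basis ha) φ * F.mat v =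
      G.mat v * LinearMap.toMatrix (F.basis ha) (G.basis ha) φ := by
    intro v
    have h2 : LinearMap.toMatrix (F.basis ha) (F.basis ha) (F.fiberEnd ha v) = F.mat v :=
      LinearMap.toMatrixAlgEquiv_toLinAlgEquiv (F.basis ha) _
    have h3 : LinearMap.toMatrix (G.basis ha) (G.basis ha) (G.fiberEnd ha v) = G.mat v :=
      LinearMap.toMatrixAlgEquiv_toLinAlgEquiv (G.basis ha) _
    rw [← h2, ← h3, ← LinearMap.toMatrix_comp, ← LinearMap.toMatrix_comp]
    congr 1
    exact LinearMap.ext (hφ v)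
  obtain ⟨f, hf⟩ := F.exists_hom G ha h1
  refine ⟨f, LinearMap.congr_fun ((F.basis ha).ext fun j => ?_)⟩
  conv_rhs => rw [← (G.basis ha).sum_repr (φ (F.basis ha j))]
  rw [F.basis_apply, Fiber.map_mk, hf, Fiber.mk_sum]
  refine Finset.sum_congr rfl fun i _ => ?_
  rw [Fiber.mk_smul, LinearMap.toMatrix_apply, G.basis_apply, F.basis_apply]

/-- The operators are recovered from the action of v v₀, so a map linear over the even Clifford
algebra commutes with them and lifts to a morphism. -/
theorem fiberEnd_eq_act (v : V) (x : Fiber M) : F.fiberEnd ha v x =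
    (Q (c 0))⁻¹ • F.act ha ((CliffordAlgebra.even.ι Q).bilin v (c 0)) x := by
  rw [act, QuadRel.evenLift_ι_self _ (F.fiberEnd_zero ha), LinearMap.smul_apply,
    inv_smul_smul₀ ha]

end NormalFrame

section Equivalence

variable (ha : Q (c 0) ≠ 0)

theorem faithful_functor : (evenAction b ha).functor.Faithful where
  map_injective {M N f g} h := by
    refine ObjectProperty.hom_ext _ ((someFrame ha M).fiberMap_injective (someFrame ha N) ha
      fun x => ?_)
    exact congrArg (fun h => h.hom.hom x) h

theorem full_functor : (evenAction b ha).functor.Full where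
  map_surjective {M N} φ := by
    have hsmul : ∀ (a : CliffordAlgebra.even Q) (x : Fiber M.obj),
        φ.hom.hom ((evenAction b ha).act M a x) =
          ((evenAction b ha).act N a (φ.hom.hom x : Fiber N.obj) : Fiber N.obj) := fun a x =>
      φ.hom.hom.map_smul a x
    let φ' : Fiber M.obj →ₗ[k] Fiber N.obj :=
      { toFun := fun x => φ.hom.hom x
        map_add' := fun x y => map_add φ.hom.hom x y
        map_smul' := fun t x => by
          have h := hsmul (algebraMap k _ t) x
          rwa [AlgHom.commutes, AlgHom.commutes] at h }
    obtain ⟨f, hf⟩ := (someFrame ha M).exists_fiberMap_eq (someFrame ha N) ha φ' (fun v x => by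
      rw [NormalFrame.fiberEnd_eq_act, NormalFrame.fiberEnd_eq_act, map_smul]
      congr 1
      exact hsmul _ x)
    refine ⟨ObjectProperty.homMk f, ?_⟩
    refine ObjectProperty.hom_ext _ (ModuleCat.hom_ext (LinearMap.ext fun x => ?_))
    exact hf x

theorem even_mul_self (v₀ v : V) :
    (CliffordAlgebra.even.ι Q).bilin v v₀ * (CliffordAlgebra.even.ι Q).bilin v v₀ =
      QuadraticMap.polar Q v₀ v • (CliffordAlgebra.even.ι Q).bilin v v₀ -
        (Q v₀ * Q v) • (1 : CliffordAlgebra.even Q) := by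
  refine Subtype.ext ?_
  change CliffordAlgebra.ι Q v * CliffordAlgebra.ι Q v₀ *
    (CliffordAlgebra.ι Q v * CliffordAlgebra.ι Q v₀) =
      QuadraticMap.polar Q v₀ v • (CliffordAlgebra.ι Q v * CliffordAlgebra.ι Q v₀) -
        (Q v₀ * Q v) • (1 : CliffordAlgebra Q)
  have h1 : CliffordAlgebra.ι Q v₀ * CliffordAlgebra.ι Q v =
      QuadraticMap.polar Q v₀ v • 1 - CliffordAlgebra.ι Q v * CliffordAlgebra.ι Q v₀ := by
    rw [eq_sub_iff_add_eq, CliffordAlgebra.ι_mul_ι_add_swap, Algebra.algebraMap_eq_smul_one]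
  rw [mul_assoc, ← mul_assoc (CliffordAlgebra.ι Q v₀), h1, sub_mul, mul_assoc,
    CliffordAlgebra.ι_sq_scalar, mul_sub, ← mul_assoc _ _ (algebraMap k _ _),
    CliffordAlgebra.ι_sq_scalar, ← map_mul, Algebra.algebraMap_eq_smul_one (Q v * Q v₀),
    mul_comm (Q v), smul_mul_assoc, one_mul, mul_smul_comm]

/-- The second factor is v₀ v, and v₀² is a scalar; so the elements u v₀ generate the even Clifford
algebra. -/
theorem even_mul_polar_sub (v₀ u v : V) :
    (CliffordAlgebra.even.ι Q).bilin u v₀ * (QuadraticMap.polar Q v₀ v • 1 -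
      (CliffordAlgebra.even.ι Q).bilin v v₀) = Q v₀ • (CliffordAlgebra.even.ι Q).bilin u v := by
  refine Subtype.ext ?_
  change CliffordAlgebra.ι Q u * CliffordAlgebra.ι Q v₀ *
    (QuadraticMap.polar Q v₀ v • 1 - CliffordAlgebra.ι Q v * CliffordAlgebra.ι Q v₀) =
      Q v₀ • (CliffordAlgebra.ι Q u * CliffordAlgebra.ι Q v)
  have h1 : QuadraticMap.polar Q v₀ v • 1 - CliffordAlgebra.ι Q v * CliffordAlgebra.ι Q v₀ =
      CliffordAlgebra.ι Q v₀ * CliffordAlgebra.ι Q v := by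
    rw [sub_eq_iff_eq_add, CliffordAlgebra.ι_mul_ι_add_swap, Algebra.algebraMap_eq_smul_one]
  rw [h1, mul_assoc, ← mul_assoc (CliffordAlgebra.ι Q v₀), CliffordAlgebra.ι_sq_scalar,
    ← Algebra.smul_def, mul_smul_comm]

section Restriction

variable {A : Type*} [Ring A] [Algebra k A] (φ : CliffordAlgebra.even Q →ₐ[k] A)

/-- The solution of the quadratic relation attached to a representation of the even Clifford
algebra. -/
def evenRestrict (v₀ : V) : V →ₗ[k] A :=
  (Q v₀)⁻¹ • φ.toLinearMap ∘ₗ (CliffordAlgebra.even.ι Q).bilin.flip v₀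

theorem evenRestrict_apply (v₀ v : V) :
    evenRestrict φ v₀ v = (Q v₀)⁻¹ • φ ((CliffordAlgebra.even.ι Q).bilin v v₀) := rfl

variable {v₀ : V} (h₀ : Q v₀ ≠ 0)

include h₀ in
theorem evenRestrict_self : evenRestrict φ v₀ v₀ = 1 := by
  rw [evenRestrict_apply, (CliffordAlgebra.even.ι Q).contract, AlgHom.commutes,
    Algebra.algebraMap_eq_smul_one, smul_smul, inv_mul_cancel₀ h₀, one_smul]

include h₀ in
theorem quadRel_evenRestrict : QuadRel Q v₀ (evenRestrict φ v₀) := by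
  intro v
  rw [evenRestrict_apply, smul_mul_smul_comm, ← map_mul, even_mul_self, map_sub, map_smul, map_smul,
    map_one, smul_smul, smul_sub, smul_smul, smul_smul, smul_smul]
  have h1 : Q v₀ * ((Q v₀)⁻¹ * (Q v₀)⁻¹) = (Q v₀)⁻¹ := by field_simp
  have h2 : (Q v₀)⁻¹ * (Q v₀ * Q v) = Q v := by field_simp
  rw [h1, h2, mul_comm]
  abel

theorem evenLift_evenRestrict : (quadRel_evenRestrict φ h₀).evenLift = φ := by
  refine CliffordAlgebra.even.algHom_ext Q (CliffordAlgebra.EvenHom.ext (LinearMap.ext₂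
    fun u v => ?_))
  change (quadRel_evenRestrict φ h₀).evenLift _ = φ _
  rw [QuadRel.evenLift_ι, evenRestrict_apply, evenRestrict_apply, smul_inv_smul₀ h₀,
    smul_mul_assoc, ← map_one φ, ← map_smul, ← map_sub, ← map_mul, even_mul_polar_sub, map_smul,
    inv_smul_smul₀ h₀]

end Restriction

include ha in
-- A representation restricts to a solution T v = v v₀ / Q(v₀) of the quadratic relation. Its
-- matrices define a module, and lifting the solution back returns the given representation by
-- `evenLift_evenRestrict`.
theorem exists_fiber_equiv (W : Type u) [AddCommGroup W] [Module k W] [Module.Finite k W]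
    (φ : CliffordAlgebra.even Q →ₐ[k] Module.End k W) :
    ∃ (M : LinMCM Q b) (e : Fiber M.obj ≃ₗ[k] W), ∀ a x,
      e ((evenAction b ha).act M a x) = φ a (e x) := by
  let w := Module.finBasis k W
  let T := evenRestrict φ (c 0)
  let D := (LinearMap.toMatrixAlgEquiv w).toLinearMap ∘ₗ T
  have hT : QuadRel Q (c 0) T := quadRel_evenRestrict φ ha
  have hD : QuadRel Q (c 0) D := by
    intro v
    have h := congrArg (LinearMap.toMatrixAlgEquiv w) (hT v)
    simp only [map_add, map_sub, map_smul, map_mul, map_one, map_zero] at h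
    exact h
  have hD0 : D (c 0) = 1 := by
    change LinearMap.toMatrixAlgEquiv w (T (c 0)) = 1
    rw [evenRestrict_self φ ha, map_one]
  obtain ⟨F, hF⟩ := exists_matMod_frame (b := b) ha hD0 (polyQuadRel_of_quadRel hD)
  let M : LinMCM Q b := ⟨_, F.isLinearMCM ha⟩
  let e := (F.basis ha).equiv w (Equiv.refl _)
  have he : ∀ v x, e (F.fiberEnd ha v x) = T v (e x) := by
    intro v
    refine LinearMap.congr_fun (f := e.toLinearMap ∘ₗ F.fiberEnd ha v) (g := T v ∘ₗ e.toLinearMap)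
      ((F.basis ha).ext fun j => ?_)
    have hj : ∀ j, e (F.basis ha j) = w j := fun j => Module.Basis.equiv_apply _ _ _ _
    have h2 : T v = Matrix.toLinAlgEquiv w (D v) :=
      ((LinearMap.toMatrixAlgEquiv w).symm_apply_apply (T v)).symm
    simp only [LinearMap.comp_apply, LinearEquiv.coe_coe, hj]
    rw [h2, Matrix.toLinAlgEquiv_self, NormalFrame.fiberEnd_apply, Matrix.toLinAlgEquiv_self,
      map_sum]
    simp only [map_smul, hj, hF]
  refine ⟨M, e, fun a x => ?_⟩
  have h1 : (evenAction b ha).act M a x = F.act ha a x :=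
    (someFrame ha M).act_eq ha F a x
  rw [h1]
  conv_rhs => rw [← evenLift_evenRestrict φ ha]
  exact (F.quadRel_fiberEnd ha).map_evenLift _ e.toLinearMap he a x

theorem essSurj_functor : (evenAction b ha).functor.EssSurj where
  mem_essImage W := by
    -- The k-structure comes from the scalars of the Clifford algebra; W is finite-dimensional
    -- because that algebra is, so it has a finite basis in which to write matrices.
    let _ : Module k W.obj := Module.compHom W.obj (algebraMap k (CliffordAlgebra.even Q))
    have : IsScalarTower k (CliffordAlgebra.even Q) W.obj :=
      IsScalarTower.of_algebraMap_smul fun _ _ => rfl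
    have : Module.Finite (CliffordAlgebra.even Q) W.obj := W.property
    have := finite_cliffordAlgebra (b := b) Q
    have : Module.Finite k (CliffordAlgebra.even Q) :=
      Module.Finite.of_injective (CliffordAlgebra.even Q).val.toLinearMap Subtype.val_injective
    have : Module.Finite k W.obj := Module.Finite.trans (CliffordAlgebra.even Q) W.obj
    obtain ⟨M, e, he⟩ := exists_fiber_equiv (b := b) ha W.obj
      (Algebra.lsmul k k W.obj : CliffordAlgebra.even Q →ₐ[k] Module.End k W.obj)
    let e' : (evenAction b ha).functor.obj M ≃ₗ[CliffordAlgebra.even Q] W.obj :=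
      { e.toAddEquiv with map_smul' := he }
    exact ⟨M, ⟨ObjectProperty.isoMk _ e'.toModuleIso⟩⟩

theorem isEquivalence_functor : (evenAction b ha).functor.IsEquivalence :=
  { faithful := faithful_functor ha
    full := full_functor ha
    essSurj := essSurj_functor ha }

end Equivalence

end

end QuadricMCM

/-! ### The tensor product with the odd part, using an invertible vector. -/

namespace QuadricMCM

noncomputable section

variable {k : Type u} [Field k] {V : Type v} [AddCommGroup V] [Module k V] {n : ℕ}
  {Q : QuadraticForm k V} {b : Module.Basis (Fin n) k V}

section OddTensor

/-- Right multiplication of an odd element of the Clifford algebra by a vector. -/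
def oddMulι (v₀ : V) (x : CliffordAlgebra.evenOdd Q 1) : CliffordAlgebra.even Q :=
  ⟨x.1 * CliffordAlgebra.ι Q v₀,
    SetLike.mul_mem_graded (A := CliffordAlgebra.evenOdd Q) (i := 1) (j := 1) x.2
      (CliffordAlgebra.ι_mem_evenOdd_one Q v₀)⟩

/-- Left multiplication of an odd element of the Clifford algebra by a vector. -/
def ιMulOdd (v₀ : V) (x : CliffordAlgebra.evenOdd Q 1) : CliffordAlgebra.even Q :=
  ⟨CliffordAlgebra.ι Q v₀ * x.1,
    SetLike.mul_mem_graded (A := CliffordAlgebra.evenOdd Q) (i := 1) (j := 1)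
      (CliffordAlgebra.ι_mem_evenOdd_one Q v₀) x.2⟩

variable (Q) in
/-- The inverse of an anisotropic vector, as an odd element of the Clifford algebra. -/
def oddInv (v₀ : V) : CliffordAlgebra.evenOdd Q 1 :=
  (Q v₀)⁻¹ • ⟨CliffordAlgebra.ι Q v₀, CliffordAlgebra.ι_mem_evenOdd_one Q v₀⟩

variable {v₀ : V} (h₀ : Q v₀ ≠ 0)

include h₀ in
theorem oddMulι_oddInv : oddMulι v₀ (oddInv Q v₀) = 1 := by
  refine Subtype.ext ?_
  change (Q v₀)⁻¹ • CliffordAlgebra.ι Q v₀ * CliffordAlgebra.ι Q v₀ = 1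
  rw [smul_mul_assoc, CliffordAlgebra.ι_sq_scalar, Algebra.algebraMap_eq_smul_one, smul_smul,
    inv_mul_cancel₀ h₀, one_smul]

include h₀ in
theorem oddMulEven_oddInv (x : CliffordAlgebra.evenOdd Q 1) :
    oddMulEven (oddInv Q v₀) (ιMulOdd v₀ x) = x := by
  refine Subtype.ext ?_
  change (Q v₀)⁻¹ • CliffordAlgebra.ι Q v₀ * (CliffordAlgebra.ι Q v₀ * x.1) = x.1
  rw [smul_mul_assoc, ← mul_assoc, CliffordAlgebra.ι_sq_scalar, ← Algebra.smul_def, smul_smul,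
    inv_mul_cancel₀ h₀, one_smul]

include h₀ in
theorem oddMulι_mul_oddInv (x : CliffordAlgebra.evenOdd Q 1) :
    (oddMulι v₀ x : CliffordAlgebra Q) * (oddInv Q v₀ : CliffordAlgebra Q) = x := by
  change x.1 * CliffordAlgebra.ι Q v₀ * ((Q v₀)⁻¹ • CliffordAlgebra.ι Q v₀) = x.1
  rw [mul_smul_comm, mul_assoc, CliffordAlgebra.ι_sq_scalar, ← Algebra.commutes,
    ← Algebra.smul_def, smul_smul, inv_mul_cancel₀ h₀, one_smul]

variable {X Y : Type*} [AddCommGroup X] [AddCommGroup Y] [Module (CliffordAlgebra.even Q) X]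
  [Module (CliffordAlgebra.even Q) Y]

theorem OddTensor.tmul_oddMulEven (x : CliffordAlgebra.evenOdd Q 1) (a : CliffordAlgebra.even Q)
    (y : X) : OddTensor.tmul (oddMulEven x a) y = OddTensor.tmul x (a • y) :=
  (Submodule.Quotient.eq _).2 (Submodule.subset_span ⟨x, a, y, rfl⟩)

theorem OddTensor.tmul_add (x : CliffordAlgebra.evenOdd Q 1) (y z : X) :
    OddTensor.tmul x (y + z) = OddTensor.tmul x y + OddTensor.tmul x z := by
  rw [OddTensor.tmul, TensorProduct.tmul_add]
  rfl

include h₀ in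
-- Every odd x equals v₀⁻¹(v₀x) with v₀x even, so v₀⁻¹ can be pulled out of all tensors.
theorem OddTensor.exists_eq_tmul (t : OddTensor Q X) : ∃ y, t = OddTensor.tmul (oddInv Q v₀) y := by
  obtain ⟨t, rfl⟩ := Submodule.Quotient.mk_surjective _ t
  induction t using TensorProduct.induction_on with
  | zero =>
    refine ⟨0, ?_⟩
    rw [OddTensor.tmul, TensorProduct.tmul_zero]
  | tmul x y =>
    refine ⟨ιMulOdd v₀ x • y, ?_⟩
    rw [← OddTensor.tmul_oddMulEven, oddMulEven_oddInv h₀]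
    rfl
  | add s t hs ht =>
    obtain ⟨y, hy⟩ := hs
    obtain ⟨z, hz⟩ := ht
    exact ⟨y + z, by rw [Submodule.Quotient.mk_add, hy, hz, OddTensor.tmul_add]⟩

include h₀ in
-- Think of θ as multiplication by v₀⁻¹: then x·y = (x v₀)·θ(y), and hθ says this is balanced. On
-- the tensors v₀⁻¹ ⊗ y the map is θ, hence it is bijective.
theorem OddTensor.exists_linearEquiv (θ : X ≃+ Y) (hθ : ∀ (x : CliffordAlgebra.evenOdd Q 1) a y,
      oddMulι v₀ (oddMulEven x a) • θ y = oddMulι v₀ x • θ (a • y)) :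
    ∃ e : OddTensor Q X ≃ₗ[CliffordAlgebra.even Q] Y,
      ∀ x y, e (OddTensor.tmul x y) = oddMulι v₀ x • θ y := by
  let g : CliffordAlgebra.evenOdd Q 1 ⊗[ℤ] X →ₗ[CliffordAlgebra.even Q] Y :=
    TensorProduct.AlgebraTensorModule.lift
      { toFun := fun x => (AddMonoidHom.toIntLinearMap
          ((DistribSMul.toAddMonoidHom Y (oddMulι v₀ x)).comp θ.toAddMonoidHom))
        map_add' := fun x y => by
          have : oddMulι v₀ (x + y) = oddMulι v₀ x + oddMulι v₀ y :=
            Subtype.ext (add_mul x.1 y.1 _)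
          ext z
          simp [this, add_smul]
        map_smul' := fun a x => by
          have : oddMulι v₀ (a • x) = a * oddMulι v₀ x := Subtype.ext (mul_assoc a.1 x.1 _)
          ext z
          simp [this, mul_smul] }
  have hg : ∀ x y, g (x ⊗ₜ y) = oddMulι v₀ x • θ y := fun x y => rfl
  let e : OddTensor Q X →ₗ[CliffordAlgebra.even Q] Y := Submodule.liftQ _ g (by
    rw [Submodule.span_le]
    rintro _ ⟨x, a, y, rfl⟩
    change g _ = 0
    rw [map_sub, hg, hg, hθ, sub_self])
  have he : ∀ x y, e (OddTensor.tmul x y) = oddMulι v₀ x • θ y := fun x y => rfl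
  have he' : ∀ y, e (OddTensor.tmul (oddInv Q v₀) y) = θ y := fun y => by
    rw [he, oddMulι_oddInv h₀, one_smul]
  refine ⟨LinearEquiv.ofBijective e ⟨(injective_iff_map_eq_zero e).2 fun t ht => ?_, fun y => ?_⟩,
    he⟩
  · obtain ⟨y, rfl⟩ := OddTensor.exists_eq_tmul h₀ t
    rw [he', EmbeddingLike.map_eq_zero_iff] at ht
    rw [ht, OddTensor.tmul, TensorProduct.tmul_zero]
    rfl
  · exact ⟨_, (he' (θ.symm y)).trans (θ.apply_symm_apply y)⟩

end OddTensor

/-! ### The graded Clifford module on two copies of a representation. -/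

section Double

variable {X Y : Type*} [AddCommGroup X] [AddCommGroup Y] [Module k X] [Module k Y] {v₀ : V}
  {T : V →ₗ[k] Module.End k X} (h : QuadRel Q v₀ T) (η : X ≃ₗ[k] Y)

variable (Q v₀ T) in
/-- The odd operators on the sum of two copies of a space with a solution of the quadratic
relation. -/
def oddOperator : V →ₗ[k] Module.End k (X × Y) where
  -- When T v₀ = 1, v₀ acts as η⁻¹ from Y to X and as Q(v₀)η from X to Y, so η is the action of
  -- v₀⁻¹. The two blocks at v are conjugate to each other and compose to Q(v).
  toFun v := LinearMap.inl k X Y ∘ₗ T v ∘ₗ η.symm.toLinearMap ∘ₗ LinearMap.snd k X Y +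
    LinearMap.inr k X Y ∘ₗ η.toLinearMap ∘ₗ
      (QuadraticMap.polar Q v₀ v • (1 : Module.End k X) - Q v₀ • T v) ∘ₗ LinearMap.fst k X Y
  map_add' u v := by
    refine LinearMap.ext fun x => Prod.ext ?_ ?_
    · simp
    · simp [QuadraticMap.polar_add_right, add_smul, smul_add]
      abel
  map_smul' t v := by
    refine LinearMap.ext fun x => Prod.ext ?_ ?_
    · simp
    · simp [QuadraticMap.polar_smul_right, smul_sub, smul_smul, mul_comm]

theorem oddOperator_apply (v : V) (y : X) (z : Y) : oddOperator Q v₀ T η v (y, z) =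
    (T v (η.symm z), η (QuadraticMap.polar Q v₀ v • y - Q v₀ • T v y)) := by
  simp [oddOperator]

/-- The representation of the Clifford algebra on the sum of two copies of a space with a solution
of the quadratic relation. -/
def QuadRel.cliffordRep : CliffordAlgebra Q →ₐ[k] Module.End k (X × Y) :=
  CliffordAlgebra.lift Q ⟨oddOperator Q v₀ T η, fun v => by
    have h1 : ∀ x, T v (QuadraticMap.polar Q v₀ v • x - Q v₀ • T v x) = Q v • x := fun x =>
      LinearMap.congr_fun (h.mul_polar_sub v) x
    have h2 : ∀ x, QuadraticMap.polar Q v₀ v • T v x - Q v₀ • T v (T v x) = Q v • x := fun x =>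
      LinearMap.congr_fun (h.polar_sub_mul v) x
    refine LinearMap.ext fun ⟨y, z⟩ => ?_
    rw [Module.End.mul_apply, oddOperator_apply, oddOperator_apply, η.symm_apply_apply, h1, h2,
      map_smul, η.apply_symm_apply]
    rfl⟩

theorem QuadRel.cliffordRep_ι (v : V) (y : X) (z : Y) :
    h.cliffordRep η (CliffordAlgebra.ι Q v) (y, z) =
      (T v (η.symm z), η (QuadraticMap.polar Q v₀ v • y - Q v₀ • T v y)) := by
  rw [QuadRel.cliffordRep, CliffordAlgebra.lift_ι_apply, oddOperator_apply]

variable {S : V →ₗ[k] Module.End k Y} (hS : QuadRel Q v₀ S)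

variable (hη : ∀ v x, S v (η x) = η ((Q v₀)⁻¹ • QuadraticMap.polar Q v₀ v • x - T v x))

theorem QuadRel.cliffordRep_even_left (a : CliffordAlgebra.even Q) (y : X) :
    h.cliffordRep η a (y, 0) = (h.evenLift a y, 0) := by
  refine (map_even_of_map_bilin (LinearMap.inl k X Y) h.evenLift
    ((h.cliffordRep η).comp (CliffordAlgebra.even Q).val) (fun u v x => ?_) a y).symm
  rw [h.evenLift_ι]
  change _ = h.cliffordRep η (CliffordAlgebra.ι Q u * CliffordAlgebra.ι Q v) (x, 0)
  conv_rhs => rw [map_mul, Module.End.mul_apply, h.cliffordRep_ι, h.cliffordRep_ι]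
  simp

include hη in
-- On the second summand the order of the two blocks is reversed; hη says that S is the conjugate of
-- T, and this absorbs the reversal.
theorem QuadRel.cliffordRep_even_right (h₀ : Q v₀ ≠ 0) (a : CliffordAlgebra.even Q) (z : Y) :
    h.cliffordRep η a (0, z) = (0, hS.evenLift a z) := by
  refine (map_even_of_map_bilin (LinearMap.inr k X Y) hS.evenLift
    ((h.cliffordRep η).comp (CliffordAlgebra.even Q).val) (fun u v z => ?_) a z).symm
  obtain ⟨x, rfl⟩ := η.surjective z
  rw [hS.evenLift_ι]
  change _ = h.cliffordRep η (CliffordAlgebra.ι Q u * CliffordAlgebra.ι Q v) (0, η x)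
  conv_rhs => rw [map_mul, Module.End.mul_apply, h.cliffordRep_ι, h.cliffordRep_ι]
  have h1 : QuadraticMap.polar Q v₀ v • η x - Q v₀ • S v (η x) = η (Q v₀ • T v x) := by
    rw [hη, ← map_smul, ← map_smul, ← map_sub, smul_sub, smul_inv_smul₀ h₀, sub_sub_cancel]
  have h2 : S u (QuadraticMap.polar Q v₀ v • η x - Q v₀ • S v (η x)) =
      η (QuadraticMap.polar Q v₀ u • T v x - Q v₀ • T u (T v x)) := by
    rw [h1, hη, smul_comm (QuadraticMap.polar Q v₀ u), inv_smul_smul₀ h₀, map_smul]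
  simp only [LinearMap.inr_apply, Module.End.mul_apply, LinearMap.sub_apply, LinearMap.smul_apply,
    Module.End.one_apply, h2, η.symm_apply_apply]
  simp

/-- Factor x as (x v₀) v₀⁻¹ and apply the two factors in turn; this reduces odd elements to the even
action. -/
theorem QuadRel.cliffordRep_odd (h₀ : Q v₀ ≠ 0) (hT : T v₀ = 1)
    (x : CliffordAlgebra.evenOdd Q 1) (y : X) (z : Y) :
    h.cliffordRep η x (y, z) =
      h.cliffordRep η (oddMulι v₀ x : CliffordAlgebra Q) ((Q v₀)⁻¹ • η.symm z, η y) := by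
  conv_lhs => rw [← oddMulι_mul_oddInv h₀ x]
  rw [map_mul, Module.End.mul_apply]
  congr 1
  change h.cliffordRep η ((Q v₀)⁻¹ • CliffordAlgebra.ι Q v₀) (y, z) = _
  rw [map_smul, LinearMap.smul_apply, h.cliffordRep_ι, hT, QuadraticMap.polar_self]
  simp only [Module.End.one_apply, two_nsmul, add_smul, add_sub_cancel_right, Prod.smul_mk,
    map_smul, inv_smul_smul₀ h₀]

include hη in
theorem QuadRel.cliffordRep_odd_left (h₀ : Q v₀ ≠ 0) (hT : T v₀ = 1)
    (x : CliffordAlgebra.evenOdd Q 1) (y : X) :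
    h.cliffordRep η x (y, 0) = (0, hS.evenLift (oddMulι v₀ x) (η y)) := by
  rw [h.cliffordRep_odd η h₀ hT, map_zero, smul_zero, h.cliffordRep_even_right η hS hη h₀]

theorem QuadRel.cliffordRep_odd_right (h₀ : Q v₀ ≠ 0) (hT : T v₀ = 1)
    (x : CliffordAlgebra.evenOdd Q 1) (z : Y) :
    (h.cliffordRep η x (0, z)).2 = 0 := by
  rw [h.cliffordRep_odd η h₀ hT, map_zero, h.cliffordRep_even_left]

include hη in
-- Both sides are the action of x a on y in the Clifford module, so the balancing condition for the
-- tensor product comes from associativity there.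
theorem QuadRel.evenLift_oddMulEven (h₀ : Q v₀ ≠ 0) (hT : T v₀ = 1)
    (x : CliffordAlgebra.evenOdd Q 1) (a : CliffordAlgebra.even Q) (y : X) :
    hS.evenLift (oddMulι v₀ (oddMulEven x a)) (η y) =
      hS.evenLift (oddMulι v₀ x) (η (h.evenLift a y)) := by
  have h1 := h.cliffordRep_odd_left η hS hη h₀ hT (oddMulEven x a) y
  have h2 := h.cliffordRep_odd_left η hS hη h₀ hT x (h.evenLift a y)
  rw [← h.cliffordRep_even_left η, ← Module.End.mul_apply, ← map_mul] at h2
  exact congrArg Prod.snd (h1.symm.trans h2)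

end Double

end

end QuadricMCM

/-! ### Clifford multiplication between the fibers of a module and of its syzygy. -/

namespace QuadricMCM

noncomputable section

variable {k : Type u} [Field k] {V : Type v} [AddCommGroup V] [Module k V] {n : ℕ}
  {Q : QuadraticForm k V} {b : Module.Basis (Fin n) k V}
  {d : ℕ} {c : Module.Basis (Fin (d + 1)) k V}

/-- A form vanishing everywhere has zero polar form and so equals its own radical. An anisotropic
vector is extended to a basis and then swapped into position 0. -/
theorem exists_basis_apply_ne_zero [Nontrivial V] (b : Module.Basis (Fin n) k V)
    (hQ : Q.radical = ⊥) : ∃ (d : ℕ) (c : Module.Basis (Fin (d + 1)) k V), Q (c 0) ≠ 0 := by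
  classical
  obtain ⟨v₀, h₀⟩ : ∃ v, Q v ≠ 0 := by
    by_contra! h
    have h1 : Q.radical = ⊤ :=
      eq_top_iff.2 fun v _ => QuadraticMap.mem_radical_iff'.2 ⟨h v, fun w => by rw [h, h]⟩
    exact bot_ne_top (hQ.symm.trans h1)
  have hv : v₀ ≠ 0 := fun h => h₀ (by rw [h, QuadraticMap.map_zero])
  have : Module.Finite k V := Module.Finite.of_basis b
  let c := Module.Basis.extend (LinearIndepOn.singleton (R := k) (v := id) (i := v₀) hv)
  have hfin := Module.Finite.finite_basis c
  have := Fintype.ofFinite ((LinearIndepOn.singleton (R := k) (v := id) (i := v₀) hv).extend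
    (Set.subset_univ _))
  let i₀ : (LinearIndepOn.singleton (R := k) (v := id) (i := v₀) hv).extend
      (Set.subset_univ _) := ⟨v₀, LinearIndepOn.subset_extend _ _ rfl⟩
  obtain ⟨d, hd⟩ := Nat.exists_eq_succ_of_ne_zero (Fintype.card_pos_iff.2 ⟨i₀⟩).ne'
  let e := Fintype.equivFinOfCardEq hd
  refine ⟨d, c.reindex (e.trans (Equiv.swap (e i₀) 0)), ?_⟩
  have h1 : (e.trans (Equiv.swap (e i₀) 0)).symm 0 = i₀ := by
    rw [Equiv.symm_apply_eq, Equiv.trans_apply, Equiv.swap_apply_left]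
  rwa [Module.Basis.reindex_apply, h1, Module.Basis.extend_apply_self]

theorem evenAction_act (ha : Q (c 0) ≠ 0) (M : LinMCM Q b) {r : ℕ} (F : NormalFrame c M.obj r)
    (a : CliffordAlgebra.even Q) (x : Fiber M.obj) :
    (evenAction b ha).act M a x = F.act ha a x :=
  (someFrame ha M).act_eq ha F a x

section Syzygy

variable {M N : GrMod Q b} {r : ℕ} (F : NormalFrame c M r) (G : NormalFrame c N r)
  (ha : Q (c 0) ≠ 0)

/-- The identification of the fibers of two modules given by frames of the same rank. -/
def NormalFrame.fiberEquiv : Fiber M ≃ₗ[k] Fiber N :=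
  (F.basis ha).equiv (G.basis ha) (Equiv.refl _)

theorem NormalFrame.fiberEquiv_mk (j : Fin r) :
    F.fiberEquiv G ha (Fiber.mk (F.w j)) = Fiber.mk (G.w j) := by
  rw [← F.basis_apply ha, ← G.basis_apply ha]
  exact Module.Basis.equiv_apply _ _ _ _

theorem NormalFrame.fiberEnd_fiberEquiv (hG : G.mat = syzMat Q (c 0) F.mat) (v : V)
    (x : Fiber M) : G.fiberEnd ha v (F.fiberEquiv G ha x) = F.fiberEquiv G ha
      ((Q (c 0))⁻¹ • QuadraticMap.polar Q (c 0) v • x - F.fiberEnd ha v x) := by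
  have h : G.fiberEnd ha v ∘ₗ (F.fiberEquiv G ha).toLinearMap = (F.fiberEquiv G ha).toLinearMap ∘ₗ
      ((Q (c 0))⁻¹ • QuadraticMap.polar Q (c 0) v • (1 : Module.End k (Fiber M)) -
        F.fiberEnd ha v) := by
    refine (F.basis ha).ext fun j => ?_
    simp only [LinearMap.comp_apply, LinearEquiv.coe_coe, LinearMap.sub_apply, LinearMap.smul_apply,
      Module.End.one_apply, NormalFrame.basis_apply, NormalFrame.fiberEnd_mk,
      NormalFrame.fiberEquiv_mk, map_sub, map_smul, map_sum, hG, syzMat_apply, Matrix.sub_apply,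
      Matrix.smul_apply, sub_smul, Finset.sum_sub_distrib]
    congr 1
    simp [Matrix.one_apply, ite_smul, smul_smul]
  exact LinearMap.congr_fun h x

/-- A syzygy of degree zero is a constant combination y of the columns of the presentation matrix,
so its linear entries evaluated at v are the matrix at v applied to y. This identifies the Clifford
action with evaluation of the presentation. -/
theorem NormalFrame.fiberEnd_fiberEquiv_symm {σ : FirstSyzygy M N}
    (F : NormalFrame c M σ.rank) (hF : ∀ j, F.w j = σ.π (Pi.single j 1))
    (G : NormalFrame c N σ.rank) (hG : ∀ i j, σ.ι (G.w j) i = linMat Q b F.mat i j) (v : V)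
    (s : N.carrier) (t : Fin n → Fin σ.rank → k) (hs : s ∈ N.gr 0)
    (h : ∀ j, σ.ι s j = ∑ i, t i j • toQuadricRing Q b (MvPolynomial.X i)) :
    F.fiberEnd ha v ((F.fiberEquiv G ha).symm (Fiber.mk s)) =
      ∑ j, (∑ i, t i j * b.repr v i) • Fiber.mk (σ.π (Pi.single j 1)) := by
  obtain ⟨y, rfl⟩ : ∃ y : Fin σ.rank → k, ∑ j, y j • G.w j = s := by
    obtain ⟨a, rfl⟩ := G.bijective.2 s
    have h0 := (G.sum_mem_iff 0 a).1 hs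
    refine ⟨fun i => MvPolynomial.constantCoeff (a i), Finset.sum_congr rfl fun i _ => ?_⟩
    rw [← algebraMap_smul (QuadricRing Q b) (MvPolynomial.constantCoeff (a i))]
    conv_rhs => rw [polyGr_zero (h0 i)]
    congr 1
    exact ((coordHom Q b c).commutes _).symm
  have h1 : ∀ i, ∑ j, y j * F.mat v i j = ∑ l, t l i * b.repr v l := by
    intro i
    have h2 : linForm Q b (∑ j, y j • matEntry F.mat i j) = linForm Q b (∑ l, t l i • b.coord l) := by
      simp only [map_sum, map_smul, linForm_coord]
      rw [← h i, map_sum, Finset.sum_apply]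
      refine Finset.sum_congr rfl fun j _ => ?_
      rw [← algebraMap_smul (QuadricRing Q b) (y j) (G.w j), map_smul, Pi.smul_apply, hG,
        algebraMap_smul, linMat_apply]
    have h3 := LinearMap.congr_fun (linForm_injective Q b c ha h2) v
    simpa [matEntry_apply] using h3
  have h2 : (F.fiberEquiv G ha).symm (Fiber.mk (∑ j, y j • G.w j)) =
      ∑ j, y j • Fiber.mk (F.w j) := by
    rw [LinearEquiv.symm_apply_eq]
    simp only [map_sum, map_smul, NormalFrame.fiberEquiv_mk, Fiber.mk_sum, Fiber.mk_smul]
  rw [h2]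
  simp only [map_sum, map_smul, NormalFrame.fiberEnd_mk, Finset.smul_sum, smul_smul, ← h1,
    Finset.sum_smul, ← hF]
  exact Finset.sum_comm

end Syzygy

/-- The identification η matches the two frames, which have equal rank and conjugate matrices. The
abstract construction on two copies of a representation therefore applies, and independence of the
frame compares it with the given actions. -/
theorem exists_cliffordRep (ha : Q (c 0) ≠ 0) (M : LinMCM Q b) (N : GrMod Q b)
    (σ : FirstSyzygy M.obj N) :
    ∃ (hN : isLinearMCM Q b N)
      (ρ : CliffordAlgebra Q →ₐ[k] Module.End k (Fiber M.obj × Fiber N))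
      (e : OddTensor Q ((evenAction b ha).functor.obj M) ≃ₗ[CliffordAlgebra.even Q]
        (evenAction b ha).functor.obj ⟨N, hN⟩),
      (∀ (a : CliffordAlgebra.even Q) (y : Fiber M.obj) (z : Fiber N),
        ρ (a : CliffordAlgebra Q) (y, z) =
          ((evenAction b ha).act M a y, (evenAction b ha).act ⟨N, hN⟩ a z)) ∧
      (∀ (x : CliffordAlgebra.evenOdd Q 1) (y : Fiber M.obj),
        (ρ (x : CliffordAlgebra Q) (y, 0)).1 = 0) ∧
      (∀ (x : CliffordAlgebra.evenOdd Q 1) (z : Fiber N),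
        (ρ (x : CliffordAlgebra Q) (0, z)).2 = 0) ∧
      (∀ (v : V) (s : N.carrier) (t : Fin n → Fin σ.rank → k), s ∈ N.gr 0 →
        (∀ j, σ.ι s j = ∑ i, t i j • toQuadricRing Q b (MvPolynomial.X i)) →
        ρ (CliffordAlgebra.ι Q v) (0, Fiber.mk s) =
          (∑ j, (∑ i, t i j * b.repr v i) • Fiber.mk (σ.π (Pi.single j 1)), 0)) ∧
      (∀ (x : CliffordAlgebra.evenOdd Q 1) (y : Fiber M.obj),
        e (OddTensor.tmul (N := (evenAction b ha).functor.obj M) x y) =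
          (ρ (x : CliffordAlgebra Q) (y, 0)).2) := by
  obtain ⟨F, hF⟩ := σ.exists_frame (c := c) ha M.property
  obtain ⟨G, hG, hGw⟩ := F.exists_syzygy_frame ha σ hF
  have hN : isLinearMCM Q b N := G.isLinearMCM ha
  let η := F.fiberEquiv G ha
  have hT := F.quadRel_fiberEnd ha
  have hS := G.quadRel_fiberEnd ha
  have hη := F.fiberEnd_fiberEquiv G ha hG
  have hM : ∀ a y, (evenAction b ha).act M a y = hT.evenLift a y := evenAction_act ha M F
  have hN' : ∀ a z, (evenAction b ha).act ⟨N, hN⟩ a z = hS.evenLift a z :=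
    evenAction_act ha ⟨N, hN⟩ G
  have h : ∀ x a (y : Fiber M.obj), hS.evenLift (oddMulι (c 0) (oddMulEven x a)) (η y) =
      hS.evenLift (oddMulι (c 0) x) (η ((evenAction b ha).act M a y)) := fun x a y => by
    rw [hM]
    exact hT.evenLift_oddMulEven η hS hη ha (F.fiberEnd_zero ha) x a y
  obtain ⟨e, he⟩ := OddTensor.exists_linearEquiv ha
    (X := (evenAction b ha).functor.obj M) (Y := (evenAction b ha).functor.obj ⟨N, hN⟩)
    η.toAddEquiv (fun x a y =>
      (hN' _ _).trans ((h x a y).trans (hN' _ _).symm))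
  refine ⟨hN, hT.cliffordRep η, e, fun a y z => ?_, fun x y => ?_, fun x z => ?_,
    fun v s t hs h => ?_, fun x y => ?_⟩
  · rw [hM, hN', ← add_zero y, ← zero_add z, ← Prod.mk_add_mk, map_add,
      hT.cliffordRep_even_left, hT.cliffordRep_even_right η hS hη ha]
    simp
  · rw [hT.cliffordRep_odd_left η hS hη ha (F.fiberEnd_zero ha)]
  · exact hT.cliffordRep_odd_right η ha (F.fiberEnd_zero ha) x z
  · rw [hT.cliffordRep_ι, F.fiberEnd_fiberEquiv_symm ha hF G hGw v s t hs h]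
    simp
  · rw [hT.cliffordRep_odd_left η hS hη ha (F.fiberEnd_zero ha)]
    exact (he x y).trans (hN' _ _)

end

end QuadricMCM

theorem mainTheorem6 {k : Type u} [Field k] {V : Type v} [AddCommGroup V] [Module k V]
    [Nontrivial V] {n : ℕ} (b : Module.Basis (Fin n) k V) (Q : QuadraticForm k V)
    (hQ : Q.radical = ⊥) :
    ∃ A : QuadricMCM.EvenAction Q b,
      A.functor.IsEquivalence ∧
      (∀ M : QuadricMCM.LinMCM Q b, ∃ N : QuadricMCM.GrMod Q b,
        Nonempty (QuadricMCM.FirstSyzygy M.obj N)) ∧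
      ∀ (M : QuadricMCM.LinMCM Q b) (N : QuadricMCM.GrMod Q b)
        (σ : QuadricMCM.FirstSyzygy M.obj N),
        ∃ (hN : QuadricMCM.isLinearMCM Q b N)
          (ρ : CliffordAlgebra Q →ₐ[k]
            Module.End k (QuadricMCM.Fiber M.obj × QuadricMCM.Fiber N))
          (e : QuadricMCM.OddTensor Q (A.functor.obj M) ≃ₗ[CliffordAlgebra.even Q]
            A.functor.obj ⟨N, hN⟩),
          -- the even part acts by the given actions on `T(M)` and on `T(Syz₁ M)`
          (∀ (a : CliffordAlgebra.even Q) (y : QuadricMCM.Fiber M.obj)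
            (z : QuadricMCM.Fiber N),
            ρ (a : CliffordAlgebra Q) (y, z) = (A.act M a y, A.act ⟨N, hN⟩ a z)) ∧
          -- the odd part exchanges the two summands
          (∀ (x : CliffordAlgebra.evenOdd Q 1) (y : QuadricMCM.Fiber M.obj),
            (ρ (x : CliffordAlgebra Q) (y, 0)).1 = 0) ∧
          (∀ (x : CliffordAlgebra.evenOdd Q 1) (z : QuadricMCM.Fiber N),
            (ρ (x : CliffordAlgebra Q) (0, z)).2 = 0) ∧
          -- `v ∈ V` acts from `T(Syz₁ M)` to `T(M)` by the linear presentation matrix at `v`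
          (∀ (v : V) (s : N.carrier) (c : Fin n → Fin σ.rank → k), s ∈ N.gr 0 →
            (∀ j, σ.ι s j = ∑ i, c i j • QuadricMCM.toQuadricRing Q b (MvPolynomial.X i)) →
            ρ (CliffordAlgebra.ι Q v) (0, QuadricMCM.Fiber.mk s) =
              (∑ j, (∑ i, c i j * b.repr v i) •
                QuadricMCM.Fiber.mk (σ.π (Pi.single j 1)), 0)) ∧
          -- the isomorphism `Cl₁ ⊗ T(M) ≃ T(Syz₁ M)` is Clifford multiplication
          (∀ (x : CliffordAlgebra.evenOdd Q 1) (y : QuadricMCM.Fiber M.obj),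
            e (QuadricMCM.OddTensor.tmul (N := A.functor.obj M) x y) =
              (ρ (x : CliffordAlgebra Q) (y, 0)).2) := by
  obtain ⟨d, c, ha⟩ := QuadricMCM.exists_basis_apply_ne_zero b hQ
  exact ⟨QuadricMCM.evenAction b ha, QuadricMCM.isEquivalence_functor ha,
    fun M => ⟨_, (QuadricMCM.someFrame ha M).nonempty_firstSyzygy ha⟩,
    QuadricMCM.exists_cliffordRep ha⟩
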